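/- Let $1<p<\infty$, let $a<b$ be real, $I=(a,b)$, $|I|=b-a$, and let $L_p(I)$ be the real or complex Lebesgue space. Let $T_2:L_p(I)\to L_p(I)$ be the operator $$T_2f(x)=\int_a^x (x-t)f(t)\,dt\qquad(x\in I).$$ For $u\in W_p^2(0,1)$ (identified with its continuous representative on $[0,1]$) put $Ku(x)=u(0)+(u(1)-u(0))x$, and let $$\mathcal B(0,1)=\sup\left\{\frac{\|u-Ku\|_{p,(0,1)}}{\|u''\|_{p,(0,1)}} : u\in W_p^2(0,1),\ u''\neq 0\right\}.$$ For a bounded linear operator $T:X\to Y$ between Banach spaces and an integer $n\ge 1$ let $a_n(T)=\inf\{\|T-F\| : F:X\to Y \text{ bounded and linear},\ \operatorname{rank}F<n\}$ be its $n$-th approximation number. Strict $s$-numbers are rules $s$ that assign to every bounded linear operator $T$ between Banach spaces (over the scalar field of $L_p(I)$) a sequence $(s_n(T))_{n\ge1}$ such that, for all $n\ge 1$ and all operators for which the expressions make sense: $\|T\|=s_1(T)\ge s_2(T)\ge\dots\ge 0$; $s_n(S+T)\le s_n(S)+\|T\|$; $s_n(RTS)\le\|R\|\,s_n(T)\,\|S\|$;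 $s_n(T)=0$ if $\operatorname{rank}T<n$; and $s_n(\mathrm{id}_E)=1$ for every Banach space $E$ with $\dim E\ge n$. They are injective if $s_n(JT)=s_n(T)$ for every linear isometric embedding $J$ of the target space of $T$ into a Banach space. **Theorem 4.2.** $\mathcal B(0,1)$ is finite. For every integer $n\ge 1$, $$\left(\frac{|I|}{n}\right)^2\mathcal B(0,1)\le a_n(T_2)\le\left(\frac{|I|}{n-3/2}\right)^2\mathcal B(0,1),$$ and $$\lim_{n\to\infty}n^2a_n(T_2)=|I|^2\,\mathcal B(0,1).$$ The same two-sided estimate (for every $n\ge1$) and the same limit hold with $a_n(T_2)$ replaced by $s_n(T_2)$, for all injective strict $s$-numbers $s$. -/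

import Mathlib

open Set Filter Topology MeasureTheory
open scoped ENNReal ContDiff

noncomputable section

/-! ### The Volterra-type operator -/

/-- The function `x ↦ ∫_a^x (x - t) f(t) dt`. -/
def volterraFun {𝕜 : Type} [RCLike 𝕜] (a : ℝ) (f : ℝ → 𝕜) (x : ℝ) : 𝕜 :=
  ∫ t in a..x, (x - t) • f t

theorem volterraFun_continuousOn {𝕜 : Type} [RCLike 𝕜] {a b : ℝ} {f : ℝ → 𝕜}
    (hf : IntegrableOn f (Ioo a b)) : ContinuousOn (volterraFun a f) (Ioo a b) := by
  rcases le_or_gt b a with h | h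
  · simp [Ioo_eq_empty_of_le h]
  have hf' : IntegrableOn f (Icc a b) := by
    rwa [integrableOn_Icc_iff_integrableOn_Ioo]
  have htf : IntegrableOn (fun t : ℝ => t • f t) (Icc a b) :=
    hf'.continuousOn_smul continuousOn_id isCompact_Icc
  have hc1 : ContinuousOn (fun x => ∫ t in a..x, f t) (Icc a b) := by
    have := intervalIntegral.continuousOn_primitive_interval (a := a) (b := b) (f := f)
      (μ := volume) (by rwa [uIcc_of_le h.le])
    rwa [uIcc_of_le h.le] at this
  have hc2 : ContinuousOn (fun x => ∫ t in a..x, t • f t) (Icc a b) := by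
    have := intervalIntegral.continuousOn_primitive_interval (a := a) (b := b)
      (f := fun t : ℝ => t • f t) (μ := volume) (by rwa [uIcc_of_le h.le])
    rwa [uIcc_of_le h.le] at this
  have key : ContinuousOn (fun x => x • (∫ t in a..x, f t) - ∫ t in a..x, t • f t)
      (Ioo a b) := ((continuousOn_id.smul hc1).sub hc2).mono Ioo_subset_Icc_self
  refine key.congr fun x hx => ?_
  have hsub : uIcc a x ⊆ Icc a b := by
    rw [uIcc_of_le hx.1.le]; exact Icc_subset_Icc_right hx.2.le
  have i1 : IntervalIntegrable f volume a x := (hf'.mono_set hsub).intervalIntegrable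
  have i2 : IntervalIntegrable (fun t : ℝ => t • f t) volume a x :=
    (htf.mono_set hsub).intervalIntegrable
  simp only [volterraFun, sub_smul]
  have i3 : IntervalIntegrable (fun t => x • f t) volume a x := i1.smul x
  rw [intervalIntegral.integral_sub i3 i2, intervalIntegral.integral_smul]

theorem volterraFun_norm_le {𝕜 : Type} [RCLike 𝕜] {a b : ℝ} {f : ℝ → 𝕜}
    (hf : IntegrableOn f (Ioo a b)) {x : ℝ} (hx : x ∈ Ioo a b) :
    ‖volterraFun a f x‖ ≤ (b - a) * ∫ t in Ioo a b, ‖f t‖ := by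
  rw [volterraFun, intervalIntegral.integral_of_le hx.1.le, ← integral_Ioc_eq_integral_Ioo,
    ← integral_const_mul]
  have hf' : IntegrableOn f (Ioc a b) := by
    rwa [integrableOn_Ioc_iff_integrableOn_Ioo]
  have hg : IntegrableOn (fun t => (b - a) * ‖f t‖) (Ioc a b) := hf'.norm.const_mul _
  have hs : Ioc a x ⊆ Ioc a b := Ioc_subset_Ioc_right hx.2.le
  refine (norm_integral_le_of_norm_le (hg.mono_set hs) ?_).trans
    (setIntegral_mono_set hg ?_ hs.eventuallyLE)
  · filter_upwards [ae_restrict_mem measurableSet_Ioc] with t ht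
    rw [norm_smul, Real.norm_eq_abs, abs_of_nonneg (by linarith [ht.2])]
    exact mul_le_mul_of_nonneg_right (by linarith [ht.1, hx.2]) (norm_nonneg _)
  · exact Eventually.of_forall fun t =>
      mul_nonneg (by linarith [hx.1, hx.2]) (norm_nonneg _)

theorem volterraFun_memLp {𝕜 : Type} [RCLike 𝕜] {p : ℝ≥0∞} {a b : ℝ} {f : ℝ → 𝕜}
    (hf : IntegrableOn f (Ioo a b)) :
    MemLp (volterraFun a f) p (volume.restrict (Ioo a b)) := by
  refine MemLp.of_bound
    ((volterraFun_continuousOn hf).aestronglyMeasurable measurableSet_Ioo)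
    ((b - a) * ∫ t in Ioo a b, ‖f t‖) ?_
  filter_upwards [ae_restrict_mem measurableSet_Ioo] with x hx
  exact volterraFun_norm_le hf hx

/-- Elements of `L_p` of a bounded interval are integrable on it. -/
theorem Lp_integrableOn_Ioo {𝕜 : Type} [RCLike 𝕜] {p : ℝ≥0∞} [hp : Fact (1 ≤ p)] {a b : ℝ}
    (f : Lp 𝕜 p (volume.restrict (Ioo a b))) : IntegrableOn f (Ioo a b) :=
  (Lp.memLp f).integrable hp.out

theorem volterraFun_congr {𝕜 : Type} [RCLike 𝕜] {a b : ℝ} {f g : ℝ → 𝕜}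
    (h : f =ᵐ[volume.restrict (Ioo a b)] g) {x : ℝ} (hx : x ∈ Ioo a b) :
    volterraFun a f x = volterraFun a g x := by
  refine intervalIntegral.integral_congr_ae_restrict ?_
  rw [uIoc_of_le hx.1.le]
  have h' : f =ᵐ[volume.restrict (Ioc a x)] g :=
    ae_mono (Measure.restrict_mono (Ioc_subset_Ioo_right hx.2) le_rfl) h
  filter_upwards [h'] with t ht
  rw [ht]

/-- The operator `T₂` on `L_p(a, b)`: `T₂ f (x) = ∫_a^x (x - t) f(t) dt`. -/
def volterraTwo (𝕜 : Type) [RCLike 𝕜] (p : ℝ≥0∞) [hp : Fact (1 ≤ p)] (a b : ℝ) :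
    Lp 𝕜 p (volume.restrict (Ioo a b)) →L[𝕜] Lp 𝕜 p (volume.restrict (Ioo a b)) :=
  LinearMap.mkContinuousOfExistsBound
    { toFun := fun f => (volterraFun_memLp (p := p) (Lp_integrableOn_Ioo f)).toLp
        (volterraFun a f)
      map_add' := fun f g => by
        rw [← MemLp.toLp_add, MemLp.toLp_eq_toLp_iff]
        filter_upwards [ae_restrict_mem measurableSet_Ioo] with x hx
        have hs : Ioc a x ⊆ Ioo a b := fun t ht => ⟨ht.1, ht.2.trans_lt hx.2⟩
        have hi : ∀ f : Lp 𝕜 p (volume.restrict (Ioo a b)),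
            IntervalIntegrable (fun t => (x - t) • f t) volume a x := fun f => by
          have h1 : IntervalIntegrable f volume a x := by
            rw [intervalIntegrable_iff_integrableOn_Ioc_of_le hx.1.le]
            exact (Lp_integrableOn_Ioo f).mono_set hs
          exact h1.continuousOn_smul (by fun_prop)
        rw [volterraFun_congr (Lp.coeFn_add f g) hx, Pi.add_apply]
        simp only [volterraFun, Pi.add_apply, smul_add]
        exact intervalIntegral.integral_add (hi f) (hi g)
      map_smul' := fun c f => by
        rw [RingHom.id_apply, ← MemLp.toLp_const_smul, MemLp.toLp_eq_toLp_iff]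
        filter_upwards [ae_restrict_mem measurableSet_Ioo] with x hx
        rw [volterraFun_congr (Lp.coeFn_smul c f) hx, Pi.smul_apply]
        simp only [volterraFun, Pi.smul_apply]
        rw [← intervalIntegral.integral_smul]
        simp only [smul_comm c] }
    (by
      set μ := volume.restrict (Ioo a b) with hμ
      set C : ℝ := measureUnivNNReal μ ^ p.toReal⁻¹ with hC
      set D : ℝ := (μ univ ^ (1 / (1 : ℝ≥0∞).toReal - 1 / p.toReal)).toReal with hD
      refine ⟨C * (|b - a| * D), fun f => ?_⟩
      have hint : ∫ t in Ioo a b, ‖f t‖ ≤ D * ‖f‖ := by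
        have hne : μ univ ^ (1 / (1 : ℝ≥0∞).toReal - 1 / p.toReal) ≠ ⊤ := by
          refine ENNReal.rpow_ne_top_of_nonneg ?_ (measure_ne_top _ _)
          rcases eq_or_ne p ⊤ with h | h
          · simp [h]
          · have : (1 : ℝ) ≤ p.toReal := by
              simpa using ENNReal.toReal_mono h hp.out
            have := inv_le_one_of_one_le₀ this
            simpa using this
        have h1 := eLpNorm_le_eLpNorm_mul_rpow_measure_univ (μ := μ) (f := f) hp.out
          (Lp.memLp f).1
        have h2 := ENNReal.toReal_mono (ENNReal.mul_ne_top (Lp.memLp f).2.ne hne) h1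
        rw [ENNReal.toReal_mul, ← Lp.norm_def, eLpNorm_one_eq_lintegral_enorm,
          ← integral_norm_eq_lintegral_enorm (Lp.memLp f).1] at h2
        rw [mul_comm]
        exact h2
      have hab : ∀ x ∈ Ioo a b, ‖volterraFun a f x‖ ≤ |b - a| * (D * ‖f‖) := fun x hx => by
        refine (volterraFun_norm_le (Lp_integrableOn_Ioo f) hx).trans ?_
        rw [abs_of_pos (by linarith [hx.1, hx.2])]
        exact mul_le_mul_of_nonneg_left hint (by linarith [hx.1, hx.2])
      have hmem := volterraFun_memLp (p := p) (Lp_integrableOn_Ioo f)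
      have := Lp.norm_le_of_ae_bound (f := hmem.toLp (volterraFun a f))
        (C := |b - a| * (D * ‖f‖)) (by positivity) (by
          filter_upwards [hmem.coeFn_toLp, ae_restrict_mem measurableSet_Ioo] with x h1 h2
          rw [h1]
          exact hab x h2)
      calc _ ≤ C * (|b - a| * (D * ‖f‖)) := this
        _ = C * (|b - a| * D) * ‖f‖ := by ring)

theorem volterraTwo_coeFn {𝕜 : Type} [RCLike 𝕜] {p : ℝ≥0∞} [Fact (1 ≤ p)] {a b : ℝ}
    (f : Lp 𝕜 p (volume.restrict (Ioo a b))) :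
    volterraTwo 𝕜 p a b f =ᵐ[volume.restrict (Ioo a b)]
      fun x => ∫ t in a..x, (x - t) • f t :=
  (volterraFun_memLp (p := p) (Lp_integrableOn_Ioo f)).coeFn_toLp

/-! ### Approximation numbers and strict `s`-numbers -/

/-- The `n`-th approximation number (`n ≥ 1`)
`a_n(T) = inf {‖T - F‖ : F bounded and linear, rank F < n}`. -/
def approxNumber {𝕜 : Type} [RCLike 𝕜] {X Y : Type} [NormedAddCommGroup X] [NormedSpace 𝕜 X]
    [NormedAddCommGroup Y] [NormedSpace 𝕜 Y] (T : X →L[𝕜] Y) (n : ℕ) : ℝ :=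
  sInf {r | ∃ F : X →L[𝕜] Y, (F : X →ₗ[𝕜] Y).rank < n ∧ r = ‖T - F‖}

/-- A rule that assigns to every bounded linear operator between Banach spaces over `𝕜` a
sequence of real numbers (only the terms with index `n ≥ 1` are meaningful). -/
abbrev OperatorSequence (𝕜 : Type) [RCLike 𝕜] : Type 1 :=
  ∀ ⦃X Y : Type⦄ [NormedAddCommGroup X] [NormedSpace 𝕜 X] [CompleteSpace X]
    [NormedAddCommGroup Y] [NormedSpace 𝕜 Y] [CompleteSpace Y], (X →L[𝕜] Y) → ℕ → ℝ

/-- `s` is an `s`-number function in the strict sense: the identity of *every* Banach space of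
dimension at least `n` has `n`-th `s`-number `1`. -/
structure IsStrictSNumber {𝕜 : Type} [RCLike 𝕜] (s : OperatorSequence 𝕜) : Prop where
  one_eq_norm : ∀ ⦃X Y : Type⦄ [NormedAddCommGroup X] [NormedSpace 𝕜 X] [CompleteSpace X]
    [NormedAddCommGroup Y] [NormedSpace 𝕜 Y] [CompleteSpace Y] (T : X →L[𝕜] Y),
    s T 1 = ‖T‖
  succ_le : ∀ ⦃X Y : Type⦄ [NormedAddCommGroup X] [NormedSpace 𝕜 X] [CompleteSpace X]
    [NormedAddCommGroup Y] [NormedSpace 𝕜 Y] [CompleteSpace Y] (T : X →L[𝕜] Y)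
    (n : ℕ), 1 ≤ n → s T (n + 1) ≤ s T n
  nonneg : ∀ ⦃X Y : Type⦄ [NormedAddCommGroup X] [NormedSpace 𝕜 X] [CompleteSpace X]
    [NormedAddCommGroup Y] [NormedSpace 𝕜 Y] [CompleteSpace Y] (T : X →L[𝕜] Y)
    (n : ℕ), 1 ≤ n → 0 ≤ s T n
  add_le : ∀ ⦃X Y : Type⦄ [NormedAddCommGroup X] [NormedSpace 𝕜 X] [CompleteSpace X]
    [NormedAddCommGroup Y] [NormedSpace 𝕜 Y] [CompleteSpace Y] (S T : X →L[𝕜] Y)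
    (n : ℕ), 1 ≤ n → s (S + T) n ≤ s S n + ‖T‖
  comp_le : ∀ ⦃W X Y Z : Type⦄ [NormedAddCommGroup W] [NormedSpace 𝕜 W] [CompleteSpace W]
    [NormedAddCommGroup X] [NormedSpace 𝕜 X] [CompleteSpace X]
    [NormedAddCommGroup Y] [NormedSpace 𝕜 Y] [CompleteSpace Y]
    [NormedAddCommGroup Z] [NormedSpace 𝕜 Z] [CompleteSpace Z]
    (R : Y →L[𝕜] Z) (T : X →L[𝕜] Y) (S : W →L[𝕜] X) (n : ℕ), 1 ≤ n →
    s ((R.comp T).comp S) n ≤ ‖R‖ * s T n * ‖S‖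
  eq_zero_of_rank_lt : ∀ ⦃X Y : Type⦄ [NormedAddCommGroup X] [NormedSpace 𝕜 X]
    [CompleteSpace X] [NormedAddCommGroup Y] [NormedSpace 𝕜 Y] [CompleteSpace Y]
    (T : X →L[𝕜] Y) (n : ℕ), 1 ≤ n → (T : X →ₗ[𝕜] Y).rank < n → s T n = 0
  id_eq_one : ∀ ⦃E : Type⦄ [NormedAddCommGroup E] [NormedSpace 𝕜 E] [CompleteSpace E]
    (n : ℕ), 1 ≤ n → (n : Cardinal) ≤ Module.rank 𝕜 E →
    s (ContinuousLinearMap.id 𝕜 E) n = 1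

/-- `s` is injective: its values do not change under composition with a metric injection
(a linear isometric embedding) of the target space. -/
def IsInjectiveSNumber {𝕜 : Type} [RCLike 𝕜] (s : OperatorSequence 𝕜) : Prop :=
  ∀ ⦃X Y Z : Type⦄ [NormedAddCommGroup X] [NormedSpace 𝕜 X] [CompleteSpace X]
    [NormedAddCommGroup Y] [NormedSpace 𝕜 Y] [CompleteSpace Y]
    [NormedAddCommGroup Z] [NormedSpace 𝕜 Z] [CompleteSpace Z]
    (J : Y →ₗᵢ[𝕜] Z) (T : X →L[𝕜] Y) (n : ℕ), 1 ≤ n →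
    s (J.toContinuousLinearMap.comp T) n = s T n

/-! ### The Sobolev space `W_p^2` and the constant `𝓑` -/

/-- `v` is the distributional derivative of `u` on `(c, d)`. -/
def HasDistribDeriv {𝕜 : Type} [RCLike 𝕜] (c d : ℝ) (u v : ℝ → 𝕜) : Prop :=
  ∀ φ : ℝ → ℝ, ContDiff ℝ ∞ φ → HasCompactSupport φ → tsupport φ ⊆ Ioo c d →
    ∫ x in Ioo c d, deriv φ x • u x = - ∫ x in Ioo c d, φ x • v x

/-- `u ∈ W_p^2(c, d)` with distributional derivatives `u' = u₁`, `u'' = u₂`, where `u` is the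
representative that is continuous on `[c, d]`. -/
structure IsSobolevTwo {𝕜 : Type} [RCLike 𝕜] (p : ℝ≥0∞) (c d : ℝ) (u u₁ u₂ : ℝ → 𝕜) :
    Prop where
  memLp_zero : MemLp u p (volume.restrict (Ioo c d))
  memLp_one : MemLp u₁ p (volume.restrict (Ioo c d))
  memLp_two : MemLp u₂ p (volume.restrict (Ioo c d))
  deriv_one : HasDistribDeriv c d u u₁
  deriv_two : HasDistribDeriv c d u₁ u₂
  continuousOn : ContinuousOn u (Icc c d)

/-- The affine interpolant `K u` of `u` at the endpoints `c`, `d`. -/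
def endpointInterp {𝕜 : Type} [RCLike 𝕜] (c d : ℝ) (u : ℝ → 𝕜) (x : ℝ) : 𝕜 :=
  u c + ((x - c) / (d - c)) • (u d - u c)

/-- `𝓑(c, d) = sup ‖u - K u‖_p / ‖u''‖_p` over all `u ∈ W_p^2(c, d)` with `u'' ≠ 0`. -/
def interpConst (𝕜 : Type) [RCLike 𝕜] (p : ℝ≥0∞) (c d : ℝ) : ℝ≥0∞ :=
  sSup {r | ∃ u u₁ u₂ : ℝ → 𝕜, IsSobolevTwo p c d u u₁ u₂ ∧
    ¬ u₂ =ᵐ[volume.restrict (Ioo c d)] 0 ∧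
    r = eLpNorm (fun x => u x - endpointInterp c d u x) p (volume.restrict (Ioo c d)) /
      eLpNorm u₂ p (volume.restrict (Ioo c d))}

end

/-! Write `B` for `𝓑(0,1)` and `q` for the real exponent. Twofold integration gives `u - Ku = -∫
green x t u''(t) dt`, so `B` is the `L_p` norm of the solution operator of `-u'' = f` with Dirichlet
conditions. Folding `(0,1)` at `1/2` compares it with the quarter-wave operator, whose kernel is
`min x t` (conditions `u(0) = u'(1) = 0`): that operator has norm `Λ = 4B` (`lintegral_min_rpow_le`,
`exists_symmetrization`). On an interval of length `L` both norms are multiplied by `L²`.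

Upper bound. `T₂ f` is replaced by the linear spline with nodes `a + h/2, a + 3h/2, ..., b`,
constant on the first half step. On a full step the error is a Green operator, of norm at most `h²
B`. On the half step `u'(a) = 0` makes it a quarter-wave operator, of norm at most `(h/2)² · 4B`,
the same number. The spline has one degree of freedom per node, which gives `h = |I| / (n - 3/2)`.

Lower bound. An `n`-dimensional space is built on which `T₂` is bounded below by `(|I|/n)² B`. By
compactness the quarter-wave operator has a nonnegative extremal (`exists_extremal`); extended by
reflections it becomes a wave `H`, with `U'' = -H`, `W'' = -|U|^(q-1) sgn U` and the Euler equation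
`W = Λ^q |H|^(q-1) sgn H`. The space is spanned by the arches of `H`. Neither the zero initial data
of `T₂` at the left end nor the zero data of the dual problem at the right end fit a wave, so both
ends are modified: the first arch is cut down to `(-σ, 0]` and followed by a gap `(0, σ]`, while at
the right end the dual problem skips `(2N - γ, 2N]` and runs on to `2N + ρ`. The parameters are
tuned so that the primal and dual functions coincide with the wave in the middle and err in the
favourable direction near the ends. As `σ, ρ ≤ 1`, the `N + 1` pieces fit in length `2(N + 1)`.

That the alternating sum `u` of the pieces controls the whole span is an oscillation argument
(`le_of_critical`, `bernstein_of_alternating`). Let `g` minimize the ratio of norms, scaled so that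
its largest coefficient has modulus one and agrees with that of `u`. If the minimum were below
`Λ^q`, the twofold integral of `|u|^(q-1) sgn u - |g|^(q-1) sgn g` from the right would alternate in
sign `n` times. Undoing an integration with a zero end value loses no sign change, and signed powers
are increasing, so `u - g` alternates `n` times and then so does its generating combination of
pieces. But one coefficient of that combination vanishes, and the remaining `n - 1` pieces cannot
alternate `n` times.

Averaging over rotations passes to complex scalars. A bounded-below `n`-dimensional space bounds
`a_n` by counting ranks, and an injective strict `s_n` by factoring the identity of that space. -/

noncomputable section

/-! ### Signed powers -/

/-- The signed power `sgn(x) |x|^r`. -/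
def spow (r x : ℝ) : ℝ := max x 0 ^ r - max (-x) 0 ^ r

theorem spow_of_nonneg {r x : ℝ} (hr : 0 < r) (hx : 0 ≤ x) : spow r x = x ^ r := by
  rw [spow, max_eq_left hx, max_eq_right (by linarith), Real.zero_rpow hr.ne', sub_zero]

theorem spow_neg (r x : ℝ) : spow r (-x) = -spow r x := by
  simp [spow]

theorem continuous_spow {r : ℝ} (hr : 0 < r) : Continuous (spow r) := by
  unfold spow
  exact ((continuous_id.max continuous_const).rpow_const fun _ => Or.inr hr.le).sub
    ((continuous_neg.max continuous_const).rpow_const fun _ => Or.inr hr.le)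

theorem spow_strictMono {r : ℝ} (hr : 0 < r) : StrictMono (spow r) := by
  intro x y hxy
  unfold spow
  rcases lt_or_ge 0 y with hy | hy
  · have h1 : max x 0 ^ r < max y 0 ^ r :=
      Real.rpow_lt_rpow (le_max_right _ _) (by
        rw [max_eq_left hy.le]; exact max_lt hxy hy) hr
    have h2 : max (-y) 0 ^ r ≤ max (-x) 0 ^ r :=
      Real.rpow_le_rpow (le_max_right _ _) (max_le_max (by linarith) le_rfl) hr.le
    linarith
  · have h1 : max x 0 ^ r ≤ max y 0 ^ r :=
      Real.rpow_le_rpow (le_max_right _ _) (max_le_max hxy.le le_rfl) hr.le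
    have h2 : max (-y) 0 ^ r < max (-x) 0 ^ r :=
      Real.rpow_lt_rpow (le_max_right _ _) (by
        rw [max_eq_left (by linarith : (0:ℝ) ≤ -x)]
        exact max_lt (by linarith) (by linarith)) hr
    linarith

theorem spow_zero {r : ℝ} (hr : 0 < r) : spow r 0 = 0 := by
  rw [spow_of_nonneg hr le_rfl, Real.zero_rpow hr.ne']

theorem mul_spow {r : ℝ} (hr : 0 < r) (x : ℝ) : x * spow r x = |x| ^ (r + 1) := by
  rcases le_total 0 x with hx | hx
  · rw [spow_of_nonneg hr hx, abs_of_nonneg hx, Real.rpow_add_one' hx (by linarith), mul_comm]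
  · have h : spow r x = -(-x) ^ r := by
      rw [← spow_of_nonneg hr (neg_nonneg.2 hx), spow_neg, neg_neg]
    rw [h, abs_of_nonpos hx, Real.rpow_add_one' (by linarith) (by linarith)]
    ring

theorem spow_mul {r : ℝ} (hr : 0 < r) (c x : ℝ) : spow r (c * x) = spow r c * spow r x := by
  have key : ∀ c x : ℝ, 0 ≤ c → spow r (c * x) = spow r c * spow r x := fun c x hc => by
    rw [spow_of_nonneg hr hc, spow, spow, mul_sub,
      ← Real.mul_rpow hc (le_max_right _ _), ← Real.mul_rpow hc (le_max_right _ _),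
      mul_max_of_nonneg _ _ hc, mul_max_of_nonneg _ _ hc, mul_zero, mul_neg]
  rcases le_total 0 c with hc | hc
  · exact key c x hc
  · rw [← neg_mul_neg, key _ _ (neg_nonneg.2 hc), spow_neg, spow_neg, neg_mul_neg]

theorem abs_spow {r : ℝ} (hr : 0 < r) (x : ℝ) : |spow r x| = |x| ^ r := by
  rcases le_total 0 x with hx | hx
  · rw [spow_of_nonneg hr hx, abs_of_nonneg hx, abs_of_nonneg (Real.rpow_nonneg hx r)]
  · have h : spow r x = -(-x) ^ r := by
      rw [← spow_of_nonneg hr (neg_nonneg.2 hx), spow_neg, neg_neg]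
    rw [h, abs_of_nonpos hx, abs_neg, abs_of_nonneg (Real.rpow_nonneg (by linarith) r)]

theorem hasDerivAt_abs_rpow_spow {q : ℝ} (hq : 1 < q) (x : ℝ) :
    HasDerivAt (fun x : ℝ => |x| ^ q) (q * spow (q - 1) x) x := by
  have h := hasDerivAt_abs_rpow x hq
  have e : q * |x| ^ (q - 2) * x = q * spow (q - 1) x := by
    have hr : 0 < q - 1 := by linarith
    rcases eq_or_ne x 0 with rfl | hx
    · simp [spow_zero hr]
    · rw [mul_assoc]
      congr 1
      have := mul_spow hr x
      apply mul_left_cancel₀ hx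
      rw [this]
      have h2 : x * (|x| ^ (q - 2) * x) = |x| ^ (q - 2) * |x| ^ (2:ℝ) := by
        rw [Real.rpow_two, sq_abs]; ring
      rw [h2, ← Real.rpow_add (abs_pos.2 hx)]
      congr 1; ring
  rwa [e] at h

/-! ### Interchange of iterated integrals -/

/-- Fubini on the triangle `A < t ≤ x ≤ C`. It plays the role of integration by parts when `g` is
merely integrable. -/
theorem integral_smul_primitive {𝕜 : Type} [RCLike 𝕜] {A C : ℝ} (hAC : A ≤ C) {f : ℝ → ℝ}
    {g : ℝ → 𝕜} (hf : IntervalIntegrable f volume A C) (hg : IntervalIntegrable g volume A C) :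
    ∫ x in A..C, f x • (∫ t in A..x, g t) = ∫ t in A..C, (∫ x in t..C, f x) • g t := by
  rw [intervalIntegrable_iff_integrableOn_Ioc_of_le hAC] at hf hg
  set μ := volume.restrict (Ioc A C) with hμ
  have hfg : Integrable (fun z : ℝ × ℝ => f z.1 • g z.2) (μ.prod μ) := hf.smul_prod hg
  have hmeas : MeasurableSet {z : ℝ × ℝ | z.2 ≤ z.1} := measurableSet_le measurable_snd measurable_fst
  have hind : Integrable (fun z : ℝ × ℝ => {z : ℝ × ℝ | z.2 ≤ z.1}.indicator
      (fun z => f z.1 • g z.2) z) (μ.prod μ) := hfg.indicator hmeas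
  have key := integral_integral_swap (f := fun x t => {z : ℝ × ℝ | z.2 ≤ z.1}.indicator
      (fun z => f z.1 • g z.2) (x, t)) hind
  rw [intervalIntegral.integral_of_le hAC, intervalIntegral.integral_of_le hAC]
  have l : ∀ x ∈ Ioc A C, ∫ t in Ioc A C, {z : ℝ × ℝ | z.2 ≤ z.1}.indicator
      (fun z => f z.1 • g z.2) (x, t) = f x • (∫ t in A..x, g t) := by
    intro x hx
    rw [intervalIntegral.integral_of_le hx.1.le, ← integral_smul]
    have : ∀ t, {z : ℝ × ℝ | z.2 ≤ z.1}.indicator (fun z => f z.1 • g z.2) (x, t)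
        = (Iic x).indicator (fun t => f x • g t) t := fun t => by
      simp [indicator_apply]
    simp_rw [this]
    rw [integral_indicator measurableSet_Iic, Measure.restrict_restrict measurableSet_Iic]
    congr 2
    ext t; simp only [mem_inter_iff, mem_Iic, mem_Ioc]
    constructor
    · rintro ⟨h1, h2, h3⟩; exact ⟨h2, h1⟩
    · rintro ⟨h1, h2⟩; exact ⟨h2, h1, h2.trans hx.2⟩
  have r : ∀ t ∈ Ioc A C, ∫ x in Ioc A C, {z : ℝ × ℝ | z.2 ≤ z.1}.indicator
      (fun z => f z.1 • g z.2) (x, t) = (∫ x in t..C, f x) • g t := by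
    intro t ht
    rw [intervalIntegral.integral_of_le ht.2, ← integral_smul_const,
      ← integral_Icc_eq_integral_Ioc (x := t)]
    have : ∀ x, {z : ℝ × ℝ | z.2 ≤ z.1}.indicator (fun z => f z.1 • g z.2) (x, t)
        = (Ici t).indicator (fun x => f x • g t) x := fun x => by
      simp [indicator_apply]
    simp_rw [this]
    rw [integral_indicator measurableSet_Ici, Measure.restrict_restrict measurableSet_Ici]
    congr 2
    ext x; simp only [mem_inter_iff, mem_Ici, mem_Ioc, mem_Icc]
    constructor
    · rintro ⟨h1, h2, h3⟩; exact ⟨h1, h3⟩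
    · rintro ⟨h1, h2⟩; exact ⟨h1, lt_of_lt_of_le ht.1 h1, h2⟩
  rw [← setIntegral_congr_fun measurableSet_Ioc l, ← setIntegral_congr_fun measurableSet_Ioc r]
  exact key

/-- The operator `x ↦ ∫_a^x (x - t) f(t) dt` is a twofold integration. -/
theorem volterraFun_eq_primitive {𝕜 : Type} [RCLike 𝕜] {a x : ℝ} (hx : a ≤ x) {f : ℝ → 𝕜}
    (hf : IntervalIntegrable f volume a x) :
    volterraFun a f x = ∫ y in a..x, ∫ t in a..y, f t := by
  have h := integral_smul_primitive hx (f := fun _ => (1 : ℝ)) intervalIntegrable_const hf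
  simp only [one_smul, intervalIntegral.integral_const, smul_eq_mul, mul_one] at h
  rw [h, volterraFun]

end

noncomputable section

/-! ### Distributional derivatives on an interval -/

theorem integral_deriv_of_tsupport_subset {φ : ℝ → ℝ} (hφ : ContDiff ℝ ∞ φ) (t d : ℝ)
    (hd : d ∉ tsupport φ) : ∫ x in t..d, deriv φ x = -φ t := by
  have h1 : ContDiff ℝ 1 φ := hφ.of_le (by exact_mod_cast le_top)
  rw [intervalIntegral.integral_deriv_eq_sub (fun x _ => (h1.differentiable one_ne_zero) x)
    ((h1.continuous_deriv le_rfl).intervalIntegrable _ _), image_eq_zero_of_notMem_tsupport hd,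
    zero_sub]

theorem intervalIntegrable_of_integrableOn_Ioo {E : Type} [NormedAddCommGroup E]
    {c d x y : ℝ} {v : ℝ → E} (hv : IntegrableOn v (Ioo c d)) (hx : x ∈ Icc c d)
    (hy : y ∈ Icc c d) : IntervalIntegrable v volume x y := by
  rw [← integrableOn_Icc_iff_integrableOn_Ioo] at hv
  refine (hv.mono_set ?_).intervalIntegrable
  exact (convex_Icc c d).ordConnected.uIcc_subset hx hy

theorem continuousOn_primitive_Icc {𝕜 : Type} [RCLike 𝕜] {c d : ℝ} {v : ℝ → 𝕜}
    (hv : IntegrableOn v (Ioo c d)) : ContinuousOn (fun x => ∫ t in c..x, v t) (Icc c d) := by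
  rcases le_or_gt c d with h | h
  · have := intervalIntegral.continuousOn_primitive_interval (a := c) (b := d) (f := v)
      (μ := volume) (by rwa [uIcc_of_le h, integrableOn_Icc_iff_integrableOn_Ioo])
    rwa [uIcc_of_le h] at this
  · simp [Icc_eq_empty_of_lt h]

/-- Fubini against `φ'`, whose integral from `t` to `d` is `-φ t`. -/
theorem hasDistribDeriv_primitive {𝕜 : Type} [RCLike 𝕜] {c d : ℝ} (hcd : c ≤ d) {v : ℝ → 𝕜}
    (hv : IntegrableOn v (Ioo c d)) :
    HasDistribDeriv c d (fun x => ∫ t in c..x, v t) v := by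
  intro φ hφ _ hsupp
  have h1 : ContDiff ℝ 1 φ := hφ.of_le (by exact_mod_cast le_top)
  have hv' : IntervalIntegrable v volume c d :=
    intervalIntegrable_of_integrableOn_Ioo hv (left_mem_Icc.2 hcd) (right_mem_Icc.2 hcd)
  have h := integral_smul_primitive hcd (f := deriv φ)
    ((h1.continuous_deriv le_rfl).intervalIntegrable _ _) hv'
  rw [intervalIntegral.integral_of_le hcd, integral_Ioc_eq_integral_Ioo] at h
  rw [h, intervalIntegral.integral_of_le hcd, integral_Ioc_eq_integral_Ioo, ← integral_neg]
  refine integral_congr_ae (Eventually.of_forall fun t => ?_)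
  simp only
  rw [integral_deriv_of_tsupport_subset hφ t d fun h => (hsupp h).2.false, neg_smul]

theorem exists_Icc_of_isCompact_subset_Ioo {c d : ℝ} (hcd : c < d) {K : Set ℝ} (hK : IsCompact K)
    (h : K ⊆ Ioo c d) : ∃ α β, c < α ∧ β < d ∧ α ≤ β ∧ K ⊆ Icc α β := by
  rcases K.eq_empty_or_nonempty with rfl | hne
  · exact ⟨(c + d) / 2, (c + d) / 2, by linarith, by linarith, le_rfl, empty_subset _⟩
  · obtain ⟨α, hα⟩ := hK.exists_isLeast hne
    obtain ⟨β, hβ⟩ := hK.exists_isGreatest hne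
    exact ⟨α, β, (h hα.1).1, (h hβ.1).2, hα.2 hβ.1, fun x hx => ⟨hα.2 hx, hβ.2 hx⟩⟩

/-- A test function of integral zero is the derivative of a test function. -/
theorem exists_testFunction_deriv_eq {c d : ℝ} (hcd : c < d) {χ : ℝ → ℝ} (hχ : ContDiff ℝ ∞ χ)
    (hc : HasCompactSupport χ) (hs : tsupport χ ⊆ Ioo c d) (h0 : ∫ x in Ioo c d, χ x = 0) :
    ∃ φ : ℝ → ℝ, ContDiff ℝ ∞ φ ∧ HasCompactSupport φ ∧ tsupport φ ⊆ Ioo c d ∧ deriv φ = χ := by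
  obtain ⟨α, β, hα, hβ, hαβ, hK⟩ := exists_Icc_of_isCompact_subset_Ioo hcd hc hs
  have hχc : Continuous χ := hχ.continuous
  have hχi : ∀ x y, IntervalIntegrable χ volume x y := fun x y => hχc.intervalIntegrable x y
  have hd : ∀ x, HasDerivAt (fun x => ∫ t in c..x, χ t) (χ x) x := fun x =>
    intervalIntegral.integral_hasDerivAt_right (hχi _ _)
      (hχc.stronglyMeasurableAtFilter _ _) hχc.continuousAt
  have hder : deriv (fun x => ∫ t in c..x, χ t) = χ := funext fun x => (hd x).deriv
  have hz : ∀ x, x ∉ Icc α β → χ x = 0 := fun x hx =>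
    image_eq_zero_of_notMem_tsupport fun h => hx (hK h)
  have hsub : tsupport (fun x => ∫ t in c..x, χ t) ⊆ Icc α β := by
    refine closure_minimal (fun x hx => ?_) isClosed_Icc
    by_contra hx'
    apply hx
    simp only
    rw [mem_Icc, not_and_or, not_le, not_le] at hx'
    rcases hx' with h | h
    · refine intervalIntegral.integral_zero_ae (Eventually.of_forall fun t ht => hz t fun h' => ?_)
      rw [mem_uIoc] at ht
      rcases ht with ht | ht <;> linarith [h'.1, ht.1, ht.2]
    -- To the right of the support the primitive is the full integral of `χ`; only here is the
    -- vanishing of that integral needed.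
    · have e1 : ∫ t in c..d, χ t = 0 := by
        rwa [intervalIntegral.integral_of_le hcd.le, integral_Ioc_eq_integral_Ioo]
      have e2 : ∫ t in x..d, χ t = 0 := by
        refine intervalIntegral.integral_zero_ae
          (Eventually.of_forall fun t ht => hz t fun h' => ?_)
        rw [mem_uIoc] at ht
        rcases ht with ht | ht <;> linarith [h'.2, ht.1, ht.2]
      have := intervalIntegral.integral_add_adjacent_intervals (hχi c x) (hχi x d)
      rw [e1, e2, add_zero] at this
      exact this
  refine ⟨fun x => ∫ t in c..x, χ t, ?_, ?_, hsub.trans (Icc_subset_Ioo hα hβ), hder⟩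
  · rw [contDiff_infty_iff_deriv, hder]
    exact ⟨fun x => (hd x).differentiableAt, hχ⟩
  · exact isCompact_Icc.of_isClosed_subset (isClosed_tsupport _) hsub

/-- The lemma of du Bois-Reymond. -/
theorem ae_eq_const_of_integral_deriv_smul_eq_zero {𝕜 : Type} [RCLike 𝕜] {c d : ℝ} (hcd : c < d)
    {w : ℝ → 𝕜} (hw : IntegrableOn w (Ioo c d))
    (h : ∀ φ : ℝ → ℝ, ContDiff ℝ ∞ φ → HasCompactSupport φ → tsupport φ ⊆ Ioo c d →
      ∫ x in Ioo c d, deriv φ x • w x = 0) :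
    ∃ C : 𝕜, ∀ᵐ x ∂volume.restrict (Ioo c d), w x = C := by
  let B : ContDiffBump ((c + d) / 2) := ⟨(d - c) / 8, (d - c) / 4, by linarith, by linarith⟩
  set ρ : ℝ → ℝ := B.normed volume with hρ
  have hρs : ContDiff ℝ ∞ ρ := B.contDiff_normed
  have hρc : HasCompactSupport ρ := B.hasCompactSupport_normed
  have hρt : tsupport ρ ⊆ Ioo c d := by
    rw [hρ, B.tsupport_normed_eq, Real.closedBall_eq_Icc]
    exact Icc_subset_Ioo (by simp [B]; linarith) (by simp [B]; linarith)
  have hset : ∀ {E : Type} [NormedAddCommGroup E] [NormedSpace ℝ E] (χ : ℝ → ℝ) (F : ℝ → E),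
      tsupport χ ⊆ Ioo c d → ∫ x in Ioo c d, χ x • F x = ∫ x, χ x • F x :=
    fun χ F hχ => setIntegral_eq_integral_of_forall_compl_eq_zero fun x hx => by
      rw [image_eq_zero_of_notMem_tsupport fun h => hx (hχ h), zero_smul]
  have hρ1 : ∫ x in Ioo c d, ρ x = 1 := by
    have := hset ρ (fun _ => (1 : ℝ)) hρt
    simp only [smul_eq_mul, mul_one] at this
    rw [this]; exact B.integral_normed
  have hint : ∀ χ : ℝ → ℝ, ContDiff ℝ ∞ χ → HasCompactSupport χ →
      IntegrableOn (fun x => χ x • w x) (Ioo c d) := fun χ h1 h2 => by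
    obtain ⟨C, hC⟩ := h2.exists_bound_of_continuous h1.continuous
    exact hw.bdd_smul C h1.continuous.aestronglyMeasurable
      (Eventually.of_forall hC)
  have hint' : ∀ χ : ℝ → ℝ, ContDiff ℝ ∞ χ → HasCompactSupport χ →
      IntegrableOn χ (Ioo c d) := fun χ h1 h2 =>
    (h1.continuous.integrable_of_hasCompactSupport h2).integrableOn
  -- A constant equals its average against the unit-mass bump `ρ`, which determines `C`. For a test
  -- function `g` of integral `m`, the function `g - m ρ` has integral zero, hence is a derivative
  -- of a test function and is annihilated by `w`.
  set C : 𝕜 := ∫ x in Ioo c d, ρ x • w x with hC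
  refine ⟨C, ?_⟩
  have key := isOpen_Ioo.ae_eq_zero_of_integral_contDiff_smul_eq_zero (U := Ioo c d)
    (f := fun x => w x - C) (μ := volume)
    (hw.sub (integrableOn_const (by simp))).locallyIntegrableOn ?_
  · rw [ae_restrict_iff' measurableSet_Ioo]
    filter_upwards [key] with x hx hx'
    exact sub_eq_zero.1 (hx hx')
  intro g hg1 hg2 hg3
  set m := ∫ x in Ioo c d, g x with hm
  have h1 : ContDiff ℝ ∞ (fun x => g x - m * ρ x) := hg1.sub (contDiff_const.mul hρs)
  have h2 : HasCompactSupport (fun x => g x - m * ρ x) :=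
    hg2.sub (hρc.mul_left (f := fun _ => m))
  have h3 : tsupport (fun x => g x - m * ρ x) ⊆ Ioo c d := by
    refine (tsupport_sub _ _).trans (union_subset hg3 ?_)
    exact (tsupport_mul_subset_right (f := fun _ => m) (g := ρ)).trans hρt
  obtain ⟨φ, p1, p2, p3, p4⟩ := exists_testFunction_deriv_eq hcd h1 h2 h3 (by
    rw [integral_sub (hint' g hg1 hg2) ((hint' ρ hρs hρc).const_mul m), integral_const_mul, hρ1,
      mul_one, sub_self])
  have h4 := h φ p1 p2 p3
  rw [p4] at h4
  have h5 : ∫ x in Ioo c d, g x • w x = m • C := by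
    have e : ∀ x, (g x - m * ρ x) • w x = g x • w x - m • (ρ x • w x) := fun x => by
      rw [sub_smul, mul_smul]
    simp_rw [e] at h4
    rw [integral_sub (g := fun x => m • (ρ x • w x)) (hint g hg1 hg2)
      ((hint ρ hρs hρc).smul m), integral_smul, ← hC] at h4
    exact sub_eq_zero.1 h4
  rw [← hset g _ hg3]
  simp_rw [smul_sub]
  rw [integral_sub (hint g hg1 hg2) ((hint' g hg1 hg2).smul_const C), integral_smul_const, h5,
    sub_self]

/-- The difference between `u` and the primitive of `v` has zero distributional derivative, so du
Bois-Reymond applies. -/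
theorem HasDistribDeriv.exists_eq_primitive {𝕜 : Type} [RCLike 𝕜] {c d : ℝ} (hcd : c < d)
    {u v : ℝ → 𝕜} (hu : IntegrableOn u (Ioo c d)) (hv : IntegrableOn v (Ioo c d))
    (h : HasDistribDeriv c d u v) :
    ∃ C : 𝕜, ∀ᵐ x ∂volume.restrict (Ioo c d), u x = C + ∫ t in c..x, v t := by
  have hp : IntegrableOn (fun x => ∫ t in c..x, v t) (Ioo c d) :=
    ((continuousOn_primitive_Icc hv).integrableOn_compact isCompact_Icc).mono_set Ioo_subset_Icc_self
  obtain ⟨C, hC⟩ := ae_eq_const_of_integral_deriv_smul_eq_zero hcd (hu.sub hp) (by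
    intro φ h1 h2 h3
    have hi : ∀ F : ℝ → 𝕜, IntegrableOn F (Ioo c d) →
        IntegrableOn (fun x => deriv φ x • F x) (Ioo c d) := fun F hF => by
      have hdc : Continuous (deriv φ) :=
        (h1.of_le (by exact_mod_cast le_top : (1 : WithTop ℕ∞) ≤ (⊤ : ℕ∞))).continuous_deriv le_rfl
      obtain ⟨C, hC⟩ := h2.deriv.exists_bound_of_continuous hdc
      exact hF.bdd_smul C hdc.aestronglyMeasurable (Eventually.of_forall hC)
    simp only [Pi.sub_apply, smul_sub]
    rw [integral_sub (hi _ hu) (hi _ hp), h φ h1 h2 h3,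
      hasDistribDeriv_primitive hcd.le hv φ h1 h2 h3, sub_self])
  exact ⟨C, hC.mono fun x hx => by rw [← hx]; simp⟩

/-! ### The Green kernel of the interpolation problem -/

theorem volterraFun_eq_setIntegral {𝕜 : Type} [RCLike 𝕜] {a b x : ℝ} (f : ℝ → 𝕜)
    (hx : x ∈ Icc a b) : volterraFun a f x = ∫ t in Ioo a b, max (x - t) 0 • f t := by
  rw [volterraFun, intervalIntegral.integral_of_le hx.1, ← integral_Ioc_eq_integral_Ioo]
  have h1 : ∫ t in Ioc a x, (x - t) • f t = ∫ t in Ioc a x, max (x - t) 0 • f t :=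
    setIntegral_congr_fun measurableSet_Ioc fun t ht => by
      simp only [max_eq_left (sub_nonneg.2 ht.2)]
  rw [h1]
  refine (setIntegral_eq_of_subset_of_forall_sdiff_eq_zero measurableSet_Ioc
    (Ioc_subset_Ioc_right hx.2) fun t ht => ?_).symm
  have : x < t := by
    by_contra h
    exact ht.2 ⟨ht.1.1, not_lt.1 h⟩
  rw [max_eq_right (by linarith), zero_smul]

/-- The Green function of `-u'' = f`, `u(0) = u(1) = 0`. -/
def green (x t : ℝ) : ℝ := min x t * (1 - max x t)

theorem continuous_green : Continuous (fun z : ℝ × ℝ => green z.1 z.2) := by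
  unfold green; fun_prop

theorem green_nonneg {x t : ℝ} (hx : x ∈ Icc (0 : ℝ) 1) (ht : t ∈ Icc (0 : ℝ) 1) :
    0 ≤ green x t :=
  mul_nonneg (le_min hx.1 ht.1) (by linarith [max_le hx.2 ht.2])

theorem green_le_one {x t : ℝ} (hx : x ∈ Icc (0 : ℝ) 1) (ht : t ∈ Icc (0 : ℝ) 1) :
    green x t ≤ 1 :=
  mul_le_one₀ ((min_le_left _ _).trans hx.2) (by linarith [max_le hx.2 ht.2])
    (by linarith [le_max_left x t, hx.1])

theorem integrableOn_continuous_smul {𝕜 : Type} [RCLike 𝕜] {c d : ℝ} {κ : ℝ → ℝ}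
    (hκ : Continuous κ) {f : ℝ → 𝕜} (hf : IntegrableOn f (Ioo c d)) :
    IntegrableOn (fun t => κ t • f t) (Ioo c d) := by
  rw [← integrableOn_Icc_iff_integrableOn_Ioo] at hf ⊢
  exact hf.continuousOn_smul hκ.continuousOn isCompact_Icc

theorem volterraFun_sub_smul {𝕜 : Type} [RCLike 𝕜] {f : ℝ → 𝕜} (hf : IntegrableOn f (Ioo 0 1))
    {x : ℝ} (hx : x ∈ Icc (0 : ℝ) 1) :
    volterraFun 0 f x - x • volterraFun 0 f 1 = -∫ t in Ioo (0 : ℝ) 1, green x t • f t := by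
  rw [volterraFun_eq_setIntegral f hx, volterraFun_eq_setIntegral f (right_mem_Icc.2 zero_le_one),
    ← integral_smul, ← integral_sub (g := fun t => x • (max (1 - t) 0 • f t))
      (integrableOn_continuous_smul (by fun_prop) hf)
      ((integrableOn_continuous_smul (by fun_prop) hf).smul x), ← integral_neg]
  refine setIntegral_congr_fun measurableSet_Ioo fun t ht => ?_
  rw [← mul_smul, ← sub_smul, ← neg_smul, green, max_eq_left (by linarith [ht.2] : 0 ≤ 1 - t)]
  congr 1
  rcases le_total x t with h | h
  · rw [max_eq_right (by linarith), min_eq_left h, max_eq_right h]; ring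
  · rw [max_eq_left (by linarith), min_eq_right h, max_eq_left h]; ring

/-- Every `f` in `L_p` is thus a second derivative, so the supremum defining `interpConst` runs over
all nonzero densities. -/
theorem isSobolevTwo_volterraFun {𝕜 : Type} [RCLike 𝕜] {p : ℝ≥0∞} [hp : Fact (1 ≤ p)]
    {f : ℝ → 𝕜} (hf : MemLp f p (volume.restrict (Ioo 0 1))) :
    IsSobolevTwo p 0 1 (volterraFun 0 f) (fun x => ∫ t in (0 : ℝ)..x, f t) f := by
  have hfi : IntegrableOn f (Ioo 0 1) := hf.integrable hp.out
  have hc := continuousOn_primitive_Icc hfi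
  have hpi : IntegrableOn (fun x => ∫ t in (0 : ℝ)..x, f t) (Ioo 0 1) :=
    (hc.integrableOn_compact isCompact_Icc).mono_set Ioo_subset_Icc_self
  have heq : EqOn (volterraFun 0 f) (fun x => ∫ y in (0 : ℝ)..x, ∫ t in (0 : ℝ)..y, f t)
      (Icc 0 1) := fun x hx => volterraFun_eq_primitive hx.1
    (intervalIntegrable_of_integrableOn_Ioo hfi (left_mem_Icc.2 zero_le_one) hx)
  have hmem : ∀ F : ℝ → 𝕜, ContinuousOn F (Icc 0 1) → MemLp F p (volume.restrict (Ioo 0 1)) := by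
    intro F hF
    obtain ⟨C, hC⟩ := isCompact_Icc.exists_bound_of_continuousOn hF
    refine MemLp.of_bound ((hF.mono Ioo_subset_Icc_self).aestronglyMeasurable measurableSet_Ioo) C ?_
    filter_upwards [ae_restrict_mem measurableSet_Ioo] with x hx
    exact hC x (Ioo_subset_Icc_self hx)
  have hcu : ContinuousOn (volterraFun 0 f) (Icc 0 1) :=
    (continuousOn_primitive_Icc hpi).congr heq
  refine ⟨hmem _ hcu, hmem _ hc, hf, ?_, hasDistribDeriv_primitive zero_le_one hfi, hcu⟩
  intro φ h1 h2 h3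
  rw [← hasDistribDeriv_primitive zero_le_one hpi φ h1 h2 h3]
  refine setIntegral_congr_fun measurableSet_Ioo fun x hx => ?_
  simp only [heq (Ioo_subset_Icc_self hx)]

/-- Integrating twice gives `u = α + β x + T₂ u''`. The affine part is reproduced by interpolation,
and `volterraFun_sub_smul` evaluates the rest. -/
theorem IsSobolevTwo.sub_endpointInterp {𝕜 : Type} [RCLike 𝕜] {p : ℝ≥0∞} [hp : Fact (1 ≤ p)]
    {u u₁ u₂ : ℝ → 𝕜} (h : IsSobolevTwo p 0 1 u u₁ u₂) {x : ℝ} (hx : x ∈ Icc (0 : ℝ) 1) :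
    u x - endpointInterp 0 1 u x = -∫ t in Ioo (0 : ℝ) 1, green x t • u₂ t := by
  have i0 : IntegrableOn u (Ioo 0 1) := h.memLp_zero.integrable hp.out
  have i1 : IntegrableOn u₁ (Ioo 0 1) := h.memLp_one.integrable hp.out
  have i2 : IntegrableOn u₂ (Ioo 0 1) := h.memLp_two.integrable hp.out
  obtain ⟨β, hβ⟩ := h.deriv_two.exists_eq_primitive zero_lt_one i1 i2
  obtain ⟨α, hα⟩ := h.deriv_one.exists_eq_primitive zero_lt_one i0 i1
  have hc := continuousOn_primitive_Icc i2
  have hpi : IntegrableOn (fun x => ∫ t in (0 : ℝ)..x, u₂ t) (Ioo 0 1) :=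
    (hc.integrableOn_compact isCompact_Icc).mono_set Ioo_subset_Icc_self
  have heq : EqOn (volterraFun 0 u₂) (fun x => ∫ y in (0 : ℝ)..x, ∫ t in (0 : ℝ)..y, u₂ t)
      (Icc 0 1) := fun x hx => volterraFun_eq_primitive hx.1
    (intervalIntegrable_of_integrableOn_Ioo i2 (left_mem_Icc.2 zero_le_one) hx)
  have hcu : ContinuousOn (volterraFun 0 u₂) (Icc 0 1) :=
    (continuousOn_primitive_Icc hpi).congr heq
  have hu : EqOn u (fun x => α + x • β + volterraFun 0 u₂ x) (Icc 0 1) := by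
    have hae : u =ᵐ[volume.restrict (Icc 0 1)] fun x => α + x • β + volterraFun 0 u₂ x := by
      rw [restrict_Ioo_eq_restrict_Icc.symm]
      filter_upwards [hα, ae_restrict_mem measurableSet_Ioo] with y hy hy'
      have hyI := Ioo_subset_Icc_self hy'
      have h0 : (0 : ℝ) ∈ Icc (0 : ℝ) 1 := left_mem_Icc.2 zero_le_one
      rw [hy, heq hyI, add_assoc]
      congr 1
      have : ∫ t in (0 : ℝ)..y, u₁ t = ∫ t in (0 : ℝ)..y, (β + ∫ s in (0 : ℝ)..t, u₂ s) := by
        refine intervalIntegral.integral_congr_ae_restrict ?_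
        rw [uIoc_of_le hyI.1]
        exact ae_mono (Measure.restrict_mono (Ioc_subset_Ioo_right hy'.2) le_rfl) hβ
      rw [this, intervalIntegral.integral_add intervalIntegrable_const
        (intervalIntegrable_of_integrableOn_Ioo hpi h0 hyI), intervalIntegral.integral_const,
        sub_zero]
    -- The interpolant reads the values at `0` and `1`, so the almost-everywhere identity is
    -- upgraded by continuity on the closed interval.
    refine Measure.eqOn_Icc_of_ae_eq volume zero_ne_one hae h.continuousOn ?_
    exact (Continuous.continuousOn (by fun_prop)).add hcu
  have h0 : volterraFun 0 u₂ 0 = 0 := by simp [volterraFun]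
  rw [← volterraFun_sub_smul i2 hx, endpointInterp, hu hx, hu (left_mem_Icc.2 zero_le_one),
    hu (right_mem_Icc.2 zero_le_one)]
  simp only [h0, sub_zero, div_one, zero_smul, one_smul, add_zero]
  module

end

noncomputable section

/-! ### The interpolation constant as the norm of the Green operator -/

section interpConst

variable {𝕜 : Type} [RCLike 𝕜] {p : ℝ≥0∞}

instance isProbabilityMeasure_restrict_Ioo_zero_one :
    IsProbabilityMeasure (volume.restrict (Ioo (0 : ℝ) 1)) :=
  ⟨by simp⟩

theorem eLpNorm_green_le [Fact (1 ≤ p)] {f : ℝ → 𝕜} (hf : MemLp f p (volume.restrict (Ioo 0 1))) :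
    eLpNorm (fun x => ∫ t in Ioo (0 : ℝ) 1, green x t • f t) p (volume.restrict (Ioo 0 1)) ≤
      interpConst 𝕜 p 0 1 * eLpNorm f p (volume.restrict (Ioo 0 1)) := by
  have hp0 : p ≠ 0 := (zero_lt_one.trans_le Fact.out).ne'
  have hS := isSobolevTwo_volterraFun hf
  have hcongr : eLpNorm (fun x => ∫ t in Ioo (0 : ℝ) 1, green x t • f t) p
      (volume.restrict (Ioo 0 1)) = eLpNorm (fun x => volterraFun 0 f x -
        endpointInterp 0 1 (volterraFun 0 f) x) p (volume.restrict (Ioo 0 1)) := by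
    refine eLpNorm_congr_norm_ae ?_
    filter_upwards [ae_restrict_mem measurableSet_Ioo] with x hx
    rw [hS.sub_endpointInterp (Ioo_subset_Icc_self hx), norm_neg]
  by_cases h0 : f =ᵐ[volume.restrict (Ioo 0 1)] 0
  · have : ∀ x, ∫ t in Ioo (0 : ℝ) 1, green x t • f t = 0 := fun x => by
      refine integral_eq_zero_of_ae ?_
      filter_upwards [h0] with t ht
      rw [ht]; simp
    simp [this]
  · have hne : eLpNorm f p (volume.restrict (Ioo 0 1)) ≠ 0 := by
      rwa [Ne, eLpNorm_eq_zero_iff hf.1 hp0]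
    rw [hcongr, ← ENNReal.div_le_iff_le_mul (Or.inl hne) (Or.inl hf.2.ne)]
    exact le_sSup ⟨_, _, _, hS, h0, rfl⟩

theorem IsSobolevTwo.enorm_sub_le [Fact (1 ≤ p)] {u u₁ u₂ : ℝ → 𝕜}
    (h : IsSobolevTwo p 0 1 u u₁ u₂) {x : ℝ} (hx : x ∈ Icc (0 : ℝ) 1) :
    ‖u x - endpointInterp 0 1 u x‖ₑ ≤
      ∫⁻ t in Ioo (0 : ℝ) 1, ENNReal.ofReal (green x t) * ‖u₂ t‖ₑ := by
  rw [h.sub_endpointInterp hx, enorm_neg]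
  refine (enorm_integral_le_lintegral_enorm _).trans_eq ?_
  refine setLIntegral_congr_fun measurableSet_Ioo fun t ht => ?_
  rw [enorm_smul, Real.enorm_of_nonneg (green_nonneg hx (Ioo_subset_Icc_self ht))]

theorem lintegral_green_le_lintegral {x : ℝ} (hx : x ∈ Icc (0 : ℝ) 1) (k : ℝ → ℝ≥0∞) :
    ∫⁻ t in Ioo (0 : ℝ) 1, ENNReal.ofReal (green x t) * k t ≤ ∫⁻ t in Ioo (0 : ℝ) 1, k t := by
  refine setLIntegral_mono' measurableSet_Ioo fun t ht => ?_
  have : ENNReal.ofReal (green x t) ≤ 1 :=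
    ENNReal.ofReal_le_one.2 (green_le_one hx (Ioo_subset_Icc_self ht))
  calc _ ≤ 1 * k t := by gcongr
    _ = k t := one_mul _

theorem interpConst_le_one [hp : Fact (1 ≤ p)] : interpConst 𝕜 p 0 1 ≤ 1 := by
  refine sSup_le ?_
  rintro r ⟨u, u₁, u₂, h, -, rfl⟩
  refine ENNReal.div_le_of_le_mul ?_
  rw [one_mul]
  have h1 : ∀ᵐ x ∂volume.restrict (Ioo (0 : ℝ) 1), ‖u x - endpointInterp 0 1 u x‖ₑ ≤
      eLpNorm u₂ p (volume.restrict (Ioo 0 1)) := by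
    filter_upwards [ae_restrict_mem measurableSet_Ioo] with x hx
    refine (h.enorm_sub_le (Ioo_subset_Icc_self hx)).trans
      ((lintegral_green_le_lintegral (Ioo_subset_Icc_self hx) _).trans ?_)
    rw [← eLpNorm_one_eq_lintegral_enorm]
    exact eLpNorm_le_eLpNorm_of_exponent_le hp.out h.memLp_two.1
  refine (eLpNorm_le_of_ae_enorm_bound h1).trans ?_
  simp

theorem interpConst_ne_top [Fact (1 ≤ p)] : interpConst 𝕜 p 0 1 ≠ ⊤ :=
  (interpConst_le_one.trans_lt ENNReal.one_lt_top).ne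

theorem lintegral_ofReal_green_mul {f : ℝ → ℝ} (hf : IntegrableOn f (Ioo 0 1)) (h0 : ∀ t, 0 ≤ f t)
    {x : ℝ} (hx : x ∈ Icc (0 : ℝ) 1) :
    ‖∫ t in Ioo (0 : ℝ) 1, green x t • ((f t : ℝ) : 𝕜)‖ₑ =
      ∫⁻ t in Ioo (0 : ℝ) 1, ENNReal.ofReal (green x t) * ENNReal.ofReal (f t) := by
  have e : ∀ t, green x t • ((f t : ℝ) : 𝕜) = ((green x t * f t : ℝ) : 𝕜) := fun t => by
    rw [RCLike.real_smul_eq_coe_mul, RCLike.ofReal_mul]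
  have hnn : ∀ t ∈ Ioo (0 : ℝ) 1, 0 ≤ green x t * f t := fun t ht =>
    mul_nonneg (green_nonneg hx (Ioo_subset_Icc_self ht)) (h0 t)
  simp_rw [e]
  rw [integral_ofReal, ← ofReal_norm, RCLike.norm_ofReal,
    abs_of_nonneg (setIntegral_nonneg measurableSet_Ioo hnn),
    ofReal_integral_eq_lintegral_ofReal]
  · refine setLIntegral_congr_fun measurableSet_Ioo fun t ht => ?_
    rw [ENNReal.ofReal_mul (green_nonneg hx (Ioo_subset_Icc_self ht))]
  · exact integrableOn_continuous_smul (𝕜 := ℝ) (κ := green x)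
      (by unfold green; fun_prop) hf
  · filter_upwards [ae_restrict_mem measurableSet_Ioo] with t ht using hnn t ht

/-- Otherwise the Green operator would annihilate the constant `1`, although its kernel is positive
inside the square. -/
theorem interpConst_pos [Fact (1 ≤ p)] : interpConst 𝕜 p 0 1 ≠ 0 := by
  intro hB
  have hp0 : p ≠ 0 := (zero_lt_one.trans_le Fact.out).ne'
  have h := eLpNorm_green_le (𝕜 := 𝕜) (p := p) (f := fun _ => ((1 : ℝ) : 𝕜))
    (memLp_const _)
  have hcg : Continuous fun z : ℝ × ℝ => green z.1 z.2 • ((1 : ℝ) : 𝕜) :=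
    continuous_green.smul continuous_const
  have hm : AEStronglyMeasurable
      (fun x => ∫ t in Ioo (0 : ℝ) 1, green x t • ((1 : ℝ) : 𝕜))
      (volume.restrict (Ioo 0 1)) :=
    (hcg.stronglyMeasurable.integral_prod_right (ν := volume.restrict (Ioo (0 : ℝ) 1))).aestronglyMeasurable
  rw [hB, zero_mul, nonpos_iff_eq_zero, eLpNorm_eq_zero_iff hm hp0] at h
  obtain ⟨x, hx, hx'⟩ := ((h.and (ae_restrict_mem measurableSet_Ioo))).exists
  have h3 := lintegral_ofReal_green_mul (𝕜 := 𝕜) (f := fun _ => 1)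
    (integrableOn_const (by simp)) (fun _ => zero_le_one) (Ioo_subset_Icc_self hx')
  have hx0 : ∫ t in Ioo (0 : ℝ) 1, green x t • ((1 : ℝ) : 𝕜) = 0 := hx
  rw [hx0] at h3
  simp only [enorm_zero, ENNReal.ofReal_one, mul_one] at h3
  have h4 := h3.symm
  rw [lintegral_eq_zero_iff (by unfold green; fun_prop)] at h4
  obtain ⟨t, ht, ht'⟩ := ((h4.and (ae_restrict_mem measurableSet_Ioo))).exists
  simp only [Pi.zero_apply, ENNReal.ofReal_eq_zero] at ht
  have : 0 < green x t := mul_pos (lt_min hx'.1 ht'.1) (by linarith [max_lt hx'.2 ht'.2])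
  linarith

/-- Extended-nonnegative form of `eLpNorm_green_le`, free of integrability hypotheses. When `∫ k^q =
∞` the right-hand side is infinite only because `interpConst` is nonzero. -/
theorem lintegral_green_rpow_le [Fact (1 ≤ p)] (hp : p ≠ ⊤) {k : ℝ → ℝ≥0∞} (hk : Measurable k) :
    ∫⁻ x in Ioo (0 : ℝ) 1, (∫⁻ t in Ioo (0 : ℝ) 1, ENNReal.ofReal (green x t) * k t) ^ p.toReal ≤
      interpConst 𝕜 p 0 1 ^ p.toReal * ∫⁻ t in Ioo (0 : ℝ) 1, k t ^ p.toReal := by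
  have hp0 : p ≠ 0 := (zero_lt_one.trans_le Fact.out).ne'
  have hq : 0 < p.toReal := ENNReal.toReal_pos hp0 hp
  rcases eq_or_ne (∫⁻ t in Ioo (0 : ℝ) 1, k t ^ p.toReal) ⊤ with hI | hI
  · rw [hI, ENNReal.mul_top]
    · exact le_top
    · simp [ENNReal.rpow_eq_zero_iff, interpConst_pos, interpConst_ne_top]
  have hfin : ∀ᵐ t ∂volume.restrict (Ioo (0 : ℝ) 1), k t < ⊤ := by
    filter_upwards [ae_lt_top (hk.pow_const _) hI] with t ht
    by_contra h
    rw [not_lt_top_iff.1 h, ENNReal.top_rpow_of_pos hq] at ht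
    exact ht.false
  have hkf : ∀ᵐ t ∂volume.restrict (Ioo (0 : ℝ) 1), ‖(((k t).toReal : ℝ) : 𝕜)‖ₑ = k t := by
    filter_upwards [hfin] with t ht
    rw [← ofReal_norm, RCLike.norm_ofReal, abs_of_nonneg ENNReal.toReal_nonneg,
      ENNReal.ofReal_toReal ht.ne]
  have hpow : ∫⁻ t in Ioo (0 : ℝ) 1, ‖(((k t).toReal : ℝ) : 𝕜)‖ₑ ^ p.toReal =
      ∫⁻ t in Ioo (0 : ℝ) 1, k t ^ p.toReal :=
    lintegral_congr_ae (hkf.mono fun t ht => by simp only [ht])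
  have hf : MemLp (fun t => (((k t).toReal : ℝ) : 𝕜)) p (volume.restrict (Ioo 0 1)) := by
    refine ⟨(RCLike.measurable_ofReal.comp hk.ennreal_toReal).aestronglyMeasurable, ?_⟩
    rw [eLpNorm_lt_top_iff_lintegral_rpow_enorm_lt_top hp0 hp, hpow]
    exact hI.lt_top
  have hre : IntegrableOn (fun t => (k t).toReal) (Ioo 0 1) := by
    have := (hf.integrable Fact.out).re
    simpa [IntegrableOn] using this
  have h := ENNReal.rpow_le_rpow (eLpNorm_green_le hf) hq.le
  rw [ENNReal.mul_rpow_of_nonneg _ _ hq.le, eLpNorm_eq_lintegral_rpow_enorm_toReal hp0 hp,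
    eLpNorm_eq_lintegral_rpow_enorm_toReal hp0 hp, hpow, ← ENNReal.rpow_mul, ← ENNReal.rpow_mul,
    one_div_mul_cancel hq.ne', ENNReal.rpow_one, ENNReal.rpow_one] at h
  refine le_trans (le_of_eq ?_) h
  refine setLIntegral_congr_fun measurableSet_Ioo fun x hx => ?_
  rw [lintegral_ofReal_green_mul hre (fun _ => ENNReal.toReal_nonneg) (Ioo_subset_Icc_self hx)]
  congr 1
  refine lintegral_congr_ae ?_
  filter_upwards [hfin] with t ht
  rw [ENNReal.ofReal_toReal ht.ne]

end interpConst

end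

noncomputable section

/-! ### Affine substitutions and foldings -/

/-- The endpoints may come in either order, so reflections are included. -/
theorem lintegral_Ioo_comp_affine {c d : ℝ} (hcd : c ≠ d) (F : ℝ → ℝ≥0∞) :
    ∫⁻ x in Ioo (min c d) (max c d), F x =
      ENNReal.ofReal |d - c| * ∫⁻ y in Ioo (0 : ℝ) 1, F (c + (d - c) * y) := by
  have hne : d - c ≠ 0 := sub_ne_zero.2 hcd.symm
  have himg : (fun y : ℝ => c + (d - c) * y) '' Ioo 0 1 = Ioo (min c d) (max c d) := by
    have : (fun y : ℝ => c + (d - c) * y) = (fun y => c + y) ∘ fun y => (d - c) * y := rfl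
    rw [this, image_comp]
    rcases lt_or_gt_of_ne hcd with h | h
    · rw [image_mul_left_Ioo (by linarith), image_const_add_Ioo, min_eq_left h.le,
        max_eq_right h.le]
      congr 1 <;> ring
    · have e : (fun y : ℝ => (d - c) * y) = (fun y => (c - d) * y) ∘ fun y => -y := by
        ext y; simp; ring
      rw [e, image_comp, image_neg_Ioo, image_mul_left_Ioo (by linarith), image_const_add_Ioo,
        min_eq_right h.le, max_eq_left h.le]
      congr 1 <;> ring
  rw [← himg, lintegral_image_eq_lintegral_abs_deriv_mul measurableSet_Ioo
    (f' := fun _ => d - c), lintegral_const_mul' _ _ ENNReal.ofReal_ne_top]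
  · intro x _
    simpa using (((hasDerivAt_id x).const_mul (d - c)).const_add c).hasDerivWithinAt
  · intro x _ y _ h
    simpa [hne] using h

theorem lintegral_Ioo_add_Ioo {a b c : ℝ} (hab : a < b) (hbc : b < c) (F : ℝ → ℝ≥0∞) :
    ∫⁻ x in Ioo a c, F x = (∫⁻ x in Ioo a b, F x) + ∫⁻ x in Ioo b c, F x := by
  rw [← setLIntegral_congr (Ioo_ae_eq_Ioc (a := a) (b := b)).symm,
    ← lintegral_union measurableSet_Ioo, Ioc_union_Ioo_eq_Ioo hab.le hbc]
  exact disjoint_left.2 fun x hx hx' => (hx'.1.trans_le hx.2).false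

theorem lintegral_Ioo_fold (F : ℝ → ℝ≥0∞) :
    ∫⁻ x in Ioo (0 : ℝ) 1, F x =
      ENNReal.ofReal (1 / 2) * (∫⁻ y in Ioo (0 : ℝ) 1, F (y / 2)) +
      ENNReal.ofReal (1 / 2) * (∫⁻ y in Ioo (0 : ℝ) 1, F (1 - y / 2)) := by
  have h1 := lintegral_Ioo_comp_affine (c := 0) (d := 1 / 2) (by norm_num) F
  have h2 := lintegral_Ioo_comp_affine (c := 1) (d := 1 / 2) (by norm_num) F
  norm_num at h1 h2
  have e1 : ∀ y : ℝ, 1 / 2 * y = y / 2 := fun y => by ring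
  have e2 : ∀ y : ℝ, 1 + -(1 / 2 * y) = 1 - y / 2 := fun y => by ring
  simp_rw [e1] at h1
  simp_rw [e2] at h2
  rw [← h1, ← h2]
  exact lintegral_Ioo_add_Ioo (by norm_num) (by norm_num) F

theorem lintegral_Ioo_fold' {F H : ℝ → ℝ≥0∞} (hF : Measurable F)
    (h : ∀ y ∈ Ioo (0 : ℝ) 1, F (y / 2) + F (1 - y / 2) = H y) :
    ∫⁻ x in Ioo (0 : ℝ) 1, F x = ENNReal.ofReal (1 / 2) * ∫⁻ y in Ioo (0 : ℝ) 1, H y := by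
  rw [lintegral_Ioo_fold, ← mul_add, ← lintegral_add_left (by fun_prop)]
  congr 1
  exact setLIntegral_congr_fun measurableSet_Ioo h

theorem green_symm_left (x t : ℝ) : green (1 - x) t = green x (1 - t) := by
  unfold green
  rcases le_total (1 - x) t with h | h
  · rw [min_eq_left h, max_eq_right h, min_eq_right (by linarith), max_eq_left (by linarith)]
    ring
  · rw [min_eq_right h, max_eq_left h, min_eq_left (by linarith), max_eq_right (by linarith)]
    ring

/-- Method of images: a solution even about `1/2` has zero slope there, so the folded Dirichlet
kernel is the kernel of the mixed problem on the half interval. -/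
theorem green_half_add {z y : ℝ} (hz : z ∈ Ioo (0 : ℝ) 1) (hy : y ∈ Ioo (0 : ℝ) 1) :
    green (z / 2) (y / 2) + green (z / 2) (1 - y / 2) = min z y / 2 := by
  unfold green
  obtain ⟨hz0, hz1⟩ := hz
  obtain ⟨hy0, hy1⟩ := hy
  rw [min_eq_left (by linarith : z / 2 ≤ 1 - y / 2), max_eq_right (by linarith : z / 2 ≤ 1 - y / 2)]
  rcases le_total z y with h | h
  · rw [min_eq_left (by linarith), max_eq_right (by linarith), min_eq_left h]; ring
  · rw [min_eq_right (by linarith), max_eq_left (by linarith), min_eq_right h]; ring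

theorem measurable_green_right (x : ℝ) : Measurable (green x) := by unfold green; fun_prop

theorem half_mem_Icc {y : ℝ} (hy : y ∈ Ioo (0 : ℝ) 1) : y / 2 ∈ Icc (0 : ℝ) 1 :=
  ⟨by linarith [hy.1], by linarith [hy.2]⟩

theorem one_sub_half_mem_Icc {y : ℝ} (hy : y ∈ Ioo (0 : ℝ) 1) : 1 - y / 2 ∈ Icc (0 : ℝ) 1 :=
  ⟨by linarith [hy.2], by linarith [hy.1]⟩

theorem measurable_lintegral_green {k : ℝ → ℝ≥0∞} (hk : Measurable k) :
    Measurable fun x => ∫⁻ t in Ioo (0 : ℝ) 1, ENNReal.ofReal (green x t) * k t := by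
  refine Measurable.lintegral_prod_right' (f := fun z : ℝ × ℝ =>
    ENNReal.ofReal (green z.1 z.2) * k z.2) ?_
  exact (continuous_green.measurable.ennreal_ofReal).mul (hk.comp measurable_snd)

theorem ofReal_green_half_add {z y : ℝ} (hz : z ∈ Ioo (0 : ℝ) 1) (hy : y ∈ Ioo (0 : ℝ) 1) :
    ENNReal.ofReal (green (z / 2) (y / 2)) + ENNReal.ofReal (green (z / 2) (1 - y / 2)) =
      ENNReal.ofReal (1 / 2) * ENNReal.ofReal (min z y) := by
  rw [← ENNReal.ofReal_add (green_nonneg (half_mem_Icc hz) (half_mem_Icc hy))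
    (green_nonneg (half_mem_Icc hz) (one_sub_half_mem_Icc hy)), green_half_add hz hy,
    ← ENNReal.ofReal_mul (by norm_num)]
  congr 1; ring

/-! ### The quarter-wave kernel `min(x, t)` -/

/-- The Green bound is tested on the extension of `k` that is even about `1/2`. Folding leaves `∫
k^q` unchanged and turns the Green operator into `1/4` of the operator with kernel `min`: a factor
`1/2` from the kernel, another from the measure. -/
theorem lintegral_min_rpow_le {𝕜 : Type} [RCLike 𝕜] {p : ℝ≥0∞} [Fact (1 ≤ p)] (hp : p ≠ ⊤)
    {k : ℝ → ℝ≥0∞} (hk : Measurable k) :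
    ∫⁻ x in Ioo (0 : ℝ) 1, (∫⁻ t in Ioo (0 : ℝ) 1, ENNReal.ofReal (min x t) * k t) ^ p.toReal ≤
      (4 * interpConst 𝕜 p 0 1) ^ p.toReal * ∫⁻ t in Ioo (0 : ℝ) 1, k t ^ p.toReal := by
  have hp0 : p ≠ 0 := (zero_lt_one.trans_le Fact.out).ne'
  have hq : 0 < p.toReal := ENNReal.toReal_pos hp0 hp
  set q := p.toReal with hqdef
  -- The tent `1 - |1 - 2t|` equals `2t` on the left half and `2(1 - t)` on the right half.
  set K : ℝ → ℝ≥0∞ := fun t => k (1 - |1 - 2 * t|) with hK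
  have hKm : Measurable K := hk.comp (by fun_prop)
  have hK1 : ∀ y ∈ Ioo (0 : ℝ) 1, K (y / 2) = k y := fun y hy => by
    simp only [hK]; rw [abs_of_nonneg (by linarith [hy.2])]; congr 1; ring
  have hK2 : ∀ y ∈ Ioo (0 : ℝ) 1, K (1 - y / 2) = k y := fun y hy => by
    simp only [hK]; rw [abs_of_nonpos (by linarith [hy.2])]; congr 1; ring
  have hhalf : ENNReal.ofReal (1 / 2) * 2 = 1 := by
    rw [← ENNReal.ofReal_ofNat, ← ENNReal.ofReal_mul (by norm_num)]; norm_num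
  have hpow : ∫⁻ t in Ioo (0 : ℝ) 1, K t ^ q = ∫⁻ t in Ioo (0 : ℝ) 1, k t ^ q := by
    rw [lintegral_Ioo_fold' (H := fun y => 2 * k y ^ q) (hKm.pow_const _)
      fun y hy => by rw [hK1 y hy, hK2 y hy, two_mul],
      lintegral_const_mul _ (hk.pow_const _), ← mul_assoc, hhalf, one_mul]
  have hG1 : ∀ z ∈ Ioo (0 : ℝ) 1,
      ∫⁻ t in Ioo (0 : ℝ) 1, ENNReal.ofReal (green (z / 2) t) * K t =
        ENNReal.ofReal (1 / 4) * ∫⁻ t in Ioo (0 : ℝ) 1, ENNReal.ofReal (min z t) * k t := by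
    intro z hz
    rw [lintegral_Ioo_fold' (F := fun t => ENNReal.ofReal (green (z / 2) t) * K t)
      (H := fun y => ENNReal.ofReal (1 / 2) * (ENNReal.ofReal (min z y) * k y))
      ((measurable_green_right _).ennreal_ofReal.mul hKm) fun y hy => by
        rw [hK1 y hy, hK2 y hy, ← add_mul, ofReal_green_half_add hz hy, mul_assoc],
      lintegral_const_mul' _ _ ENNReal.ofReal_ne_top, ← mul_assoc,
      ← ENNReal.ofReal_mul (by norm_num)]
    norm_num
  have hG2 : ∀ z ∈ Ioo (0 : ℝ) 1,
      ∫⁻ t in Ioo (0 : ℝ) 1, ENNReal.ofReal (green (1 - z / 2) t) * K t =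
        ENNReal.ofReal (1 / 4) * ∫⁻ t in Ioo (0 : ℝ) 1, ENNReal.ofReal (min z t) * k t := by
    intro z hz
    rw [← hG1 z hz, lintegral_Ioo_fold, lintegral_Ioo_fold (fun t =>
      ENNReal.ofReal (green (z / 2) t) * K t), add_comm]
    congr 2 <;>
    · refine setLIntegral_congr_fun measurableSet_Ioo fun y hy => ?_
      rw [hK1 y hy, hK2 y hy, green_symm_left]
      try rw [sub_sub_cancel]
  have h := lintegral_green_rpow_le (𝕜 := 𝕜) hp hKm
  rw [← hqdef, hpow, lintegral_Ioo_fold' (H := fun z => 2 * (ENNReal.ofReal (1 / 4) ^ q *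
      (∫⁻ t in Ioo (0 : ℝ) 1, ENNReal.ofReal (min z t) * k t) ^ q))
      ((measurable_lintegral_green hKm).pow_const _) fun z hz => by
        rw [hG1 z hz, hG2 z hz, ← two_mul, ENNReal.mul_rpow_of_nonneg _ _ hq.le],
      lintegral_const_mul' _ _ (by simp), ← mul_assoc, hhalf, one_mul,
      lintegral_const_mul' _ _ (ENNReal.rpow_ne_top_of_nonneg hq.le ENNReal.ofReal_ne_top)] at h
  have h4 : (4 : ℝ≥0∞) ^ q * ENNReal.ofReal (1 / 4) ^ q = 1 := by
    rw [← ENNReal.mul_rpow_of_nonneg _ _ hq.le, ← ENNReal.ofReal_ofNat,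
      ← ENNReal.ofReal_mul (by norm_num)]
    norm_num
  calc _ = (4 : ℝ≥0∞) ^ q * ENNReal.ofReal (1 / 4) ^ q * ∫⁻ x in Ioo (0 : ℝ) 1,
        (∫⁻ t in Ioo (0 : ℝ) 1, ENNReal.ofReal (min x t) * k t) ^ q := by rw [h4, one_mul]
    _ ≤ (4 : ℝ≥0∞) ^ q * (interpConst 𝕜 p 0 1 ^ q * ∫⁻ t in Ioo (0 : ℝ) 1, k t ^ q) := by
        rw [mul_assoc]; gcongr
    _ = _ := by rw [ENNReal.mul_rpow_of_nonneg _ _ hq.le, mul_assoc]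

/-- Transfer of an `L^q` bound for a kernel on `(0, 1)` to other intervals. -/
theorem lintegral_kernel_rpow_le_of_affine {q : ℝ} (hq : 0 < q) {κ κ' : ℝ → ℝ → ℝ≥0∞} {D : ℝ≥0∞}
    (hκ : ∀ k : ℝ → ℝ≥0∞, Measurable k →
      ∫⁻ x in Ioo (0 : ℝ) 1, (∫⁻ t in Ioo (0 : ℝ) 1, κ x t * k t) ^ q ≤
        D ^ q * ∫⁻ t in Ioo (0 : ℝ) 1, k t ^ q)
    {c d c' d' L : ℝ} (hL : 0 < L) (h1 : |d - c| = L) (h2 : |d' - c'| = L)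
    (hle : ∀ y ∈ Ioo (0 : ℝ) 1, ∀ s ∈ Ioo (0 : ℝ) 1,
      κ' (c + (d - c) * y) (c' + (d' - c') * s) ≤ ENNReal.ofReal L * κ y s)
    {k : ℝ → ℝ≥0∞} (hk : Measurable k) :
    ∫⁻ x in Ioo (min c d) (max c d), (∫⁻ t in Ioo (min c' d') (max c' d'), κ' x t * k t) ^ q ≤
      (ENNReal.ofReal (L ^ 2) * D) ^ q * ∫⁻ t in Ioo (min c' d') (max c' d'), k t ^ q := by
  have hcd : c ≠ d := fun h => by simp [h] at h1; linarith
  have hcd' : c' ≠ d' := fun h => by simp [h] at h2; linarith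
  rw [lintegral_Ioo_comp_affine hcd, lintegral_Ioo_comp_affine hcd' (fun t => k t ^ q), h1, h2]
  -- One factor `L` comes from the kernel and one from `dt`; the factors from the outer variable
  -- occur on both sides.
  have hin : ∀ y ∈ Ioo (0 : ℝ) 1,
      ∫⁻ t in Ioo (min c' d') (max c' d'), κ' (c + (d - c) * y) t * k t ≤
        ENNReal.ofReal (L ^ 2) * ∫⁻ s in Ioo (0 : ℝ) 1, κ y s * k (c' + (d' - c') * s) := by
    intro y hy
    rw [lintegral_Ioo_comp_affine hcd', h2, pow_two, ENNReal.ofReal_mul hL.le, mul_assoc,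
      ← lintegral_const_mul' _ (fun s => κ y s * k (c' + (d' - c') * s)) ENNReal.ofReal_ne_top]
    refine mul_le_mul_right ?_ _
    refine setLIntegral_mono' measurableSet_Ioo fun s hs => ?_
    rw [← mul_assoc]
    gcongr
    exact hle y hy s hs
  have hLq : ENNReal.ofReal (L ^ 2) ^ q ≠ ⊤ :=
    ENNReal.rpow_ne_top_of_nonneg hq.le ENNReal.ofReal_ne_top
  calc _ ≤ ENNReal.ofReal L * ∫⁻ y in Ioo (0 : ℝ) 1, ENNReal.ofReal (L ^ 2) ^ q *
        (∫⁻ s in Ioo (0 : ℝ) 1, κ y s * k (c' + (d' - c') * s)) ^ q := by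
        refine mul_le_mul_right ?_ _
        refine setLIntegral_mono' measurableSet_Ioo fun y hy => ?_
        rw [← ENNReal.mul_rpow_of_nonneg _ _ hq.le]
        gcongr
        exact hin y hy
    _ ≤ ENNReal.ofReal L * (ENNReal.ofReal (L ^ 2) ^ q *
        (D ^ q * ∫⁻ s in Ioo (0 : ℝ) 1, k (c' + (d' - c') * s) ^ q)) := by
        rw [lintegral_const_mul' _ _ hLq]
        gcongr
        exact hκ _ (hk.comp (by fun_prop))
    _ = _ := by
        rw [ENNReal.mul_rpow_of_nonneg _ _ hq.le]
        ring

/-! ### Symmetrization -/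

theorem ENNReal_two_point_holder {q : ℝ} (hq : 1 < q) (a b A B : ℝ≥0∞) :
    a ^ (q - 1) * A + b ^ (q - 1) * B ≤ (a ^ q + b ^ q) ^ (1 - 1 / q) * (A ^ q + B ^ q) ^ (1 / q) := by
  have hc : (q / (q - 1)).HolderConjugate q := by
    rw [Real.holderConjugate_comm]
    exact Real.HolderConjugate.conjExponent hq
  have h := ENNReal.inner_le_Lp_mul_Lq (Finset.univ : Finset (Fin 2))
    ![a ^ (q - 1), b ^ (q - 1)] ![A, B] hc
  simp only [Fin.sum_univ_two, Matrix.cons_val_zero, Matrix.cons_val_one,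
    ← ENNReal.rpow_mul] at h
  have e1 : (q - 1) * (q / (q - 1)) = q := by field_simp [(by linarith : q - 1 ≠ 0)]
  have e2 : 1 / (q / (q - 1)) = 1 - 1 / q := by
    rw [one_div_div]; field_simp
  rwa [e1, e2] at h

/-- Minkowski's integral inequality for functions with values in the two-dimensional `ℓ^q`: the norm
of an integral is at most the integral of the norm. The proof pairs `(a, b)` with its norming
functional `(a^(q-1), b^(q-1))`. -/
theorem lintegral_rpow_add_lintegral_rpow_le {μ : Measure ℝ} {q : ℝ} (hq : 1 < q)
    {A B : ℝ → ℝ≥0∞} (hA : Measurable A) :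
    (∫⁻ t, A t ∂μ) ^ q + (∫⁻ t, B t ∂μ) ^ q ≤ (∫⁻ t, (A t ^ q + B t ^ q) ^ (1 / q) ∂μ) ^ q := by
  have hq0 : 0 < q := by linarith
  have hroot : ∀ x : ℝ≥0∞, (x ^ q) ^ (1 / q) = x := fun x => by
    rw [← ENNReal.rpow_mul, mul_one_div_cancel hq0.ne', ENNReal.rpow_one]
  have hroot' : ∀ x : ℝ≥0∞, (x ^ (1 / q)) ^ q = x := fun x => by
    rw [← ENNReal.rpow_mul, one_div_mul_cancel hq0.ne', ENNReal.rpow_one]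
  have hleA : ∀ t, A t ≤ (A t ^ q + B t ^ q) ^ (1 / q) := fun t => by
    conv_lhs => rw [← hroot (A t)]
    exact ENNReal.rpow_le_rpow le_self_add (by positivity)
  have hleB : ∀ t, B t ≤ (A t ^ q + B t ^ q) ^ (1 / q) := fun t => by
    conv_lhs => rw [← hroot (B t)]
    exact ENNReal.rpow_le_rpow le_add_self (by positivity)
  set a := ∫⁻ t, A t ∂μ with ha
  set b := ∫⁻ t, B t ∂μ with hb
  set I := ∫⁻ t, (A t ^ q + B t ^ q) ^ (1 / q) ∂μ with hI
  have haI : a ≤ I := lintegral_mono hleA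
  have hbI : b ≤ I := lintegral_mono hleB
  rcases eq_or_ne I ⊤ with hIt | hIt
  · rw [hIt, ENNReal.top_rpow_of_pos hq0]; exact le_top
  have hat : a ≠ ⊤ := (haI.trans_lt hIt.lt_top).ne
  have hbt : b ≠ ⊤ := (hbI.trans_lt hIt.lt_top).ne
  set S := a ^ q + b ^ q with hS
  have hSt : S ≠ ⊤ := ENNReal.add_ne_top.2
    ⟨ENNReal.rpow_ne_top_of_nonneg hq0.le hat, ENNReal.rpow_ne_top_of_nonneg hq0.le hbt⟩
  rcases eq_or_ne S 0 with hS0 | hS0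
  · rw [hS0]; exact zero_le
  have hsplit : ∀ x : ℝ≥0∞, x ^ q = x ^ (q - 1) * x := fun x => by
    have := ENNReal.rpow_add_of_nonneg (x := x) (q - 1) 1 (by linarith) zero_le_one
    rwa [sub_add_cancel, ENNReal.rpow_one] at this
  have key : S ≤ S ^ (1 - 1 / q) * I := by
    have h1 : a ^ (q - 1) ≠ ⊤ := ENNReal.rpow_ne_top_of_nonneg (by linarith) hat
    have h2 : b ^ (q - 1) ≠ ⊤ := ENNReal.rpow_ne_top_of_nonneg (by linarith) hbt
    have h3 : S ^ (1 - 1 / q) ≠ ⊤ := ENNReal.rpow_ne_top_of_nonneg (by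
      rw [sub_nonneg, div_le_one hq0]; exact hq.le) hSt
    calc S = ∫⁻ t, (a ^ (q - 1) * A t + b ^ (q - 1) * B t) ∂μ := by
          rw [lintegral_add_left (hA.const_mul _), lintegral_const_mul' _ _ h1,
            lintegral_const_mul' _ _ h2, ← ha, ← hb, ← hsplit, ← hsplit]
      _ ≤ ∫⁻ t, S ^ (1 - 1 / q) * (A t ^ q + B t ^ q) ^ (1 / q) ∂μ :=
          lintegral_mono fun t => ENNReal_two_point_holder hq a b (A t) (B t)
      _ = _ := lintegral_const_mul' _ _ h3
  -- Dividing by `S^(1 - 1/q)` is legitimate since the cases `S = 0` and `I = ∞` are already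
  -- settled.
  have key2 : S ^ (1 / q) ≤ I := by
    have hpos : S ^ (1 - 1 / q) ≠ 0 := by
      simp [ENNReal.rpow_eq_zero_iff, hS0, hSt]
    have hfin : S ^ (1 - 1 / q) ≠ ⊤ := ENNReal.rpow_ne_top_of_nonneg (by
      rw [sub_nonneg, div_le_one hq0]; exact hq.le) hSt
    rw [← ENNReal.mul_le_mul_iff_right hpos hfin, ← ENNReal.rpow_add _ _ hS0 hSt]
    simpa using key
  calc S = (S ^ (1 / q)) ^ q := (hroot' S).symm
    _ ≤ I ^ q := ENNReal.rpow_le_rpow key2 hq0.le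

/-- The symmetric matrix with entries `α, β` is `α` times the identity plus `β` times the swap, both
isometries of `ℓ^q`. -/
theorem two_point_minkowski {q : ℝ} (hq : 1 < q) (α β k l : ℝ≥0∞) :
    ((α * k + β * l) ^ q + (β * k + α * l) ^ q) ^ (1 / q) ≤
      (α + β) * (k ^ q + l ^ q) ^ (1 / q) := by
  have hq0 : 0 < q := by linarith
  have h := ENNReal.Lp_add_le (Finset.univ : Finset (Fin 2)) ![α * k, α * l] ![β * l, β * k] hq.le
  simp only [Fin.sum_univ_two, Matrix.cons_val_zero, Matrix.cons_val_one,
    ENNReal.mul_rpow_of_nonneg _ _ hq0.le, ← mul_add] at h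
  have hroot : ∀ x y : ℝ≥0∞, (x ^ q * y) ^ (1 / q) = x * y ^ (1 / q) := fun x y => by
    rw [ENNReal.mul_rpow_of_nonneg _ _ (by positivity), ← ENNReal.rpow_mul,
      mul_one_div_cancel hq0.ne', ENNReal.rpow_one]
  rw [hroot, hroot, add_comm (l ^ q), ← add_mul, add_comm (α * l)] at h
  exact h

/-- Converse of `lintegral_min_rpow_le`. Replacing the two values of `k` at mirror points by their
`ℓ^q` norm keeps the `L^q` mass up to the folding factor and, by Minkowski, does not decrease the
image. Together the two results identify the norm of the `min` kernel as `4B`. -/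
theorem exists_symmetrization {q : ℝ} (hq : 1 < q) {k : ℝ → ℝ≥0∞} (hk : Measurable k) :
    ∃ k' : ℝ → ℝ≥0∞, Measurable k' ∧
      ∫⁻ t in Ioo (0 : ℝ) 1, k' t ^ q = 2 * ∫⁻ t in Ioo (0 : ℝ) 1, k t ^ q ∧
      2 * (4 ^ q * ∫⁻ x in Ioo (0 : ℝ) 1,
        (∫⁻ t in Ioo (0 : ℝ) 1, ENNReal.ofReal (green x t) * k t) ^ q) ≤
      ∫⁻ x in Ioo (0 : ℝ) 1, (∫⁻ t in Ioo (0 : ℝ) 1, ENNReal.ofReal (min x t) * k' t) ^ q := by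
  have hq0 : 0 < q := by linarith
  have hhalf : 2 * ENNReal.ofReal (1 / 2) = 1 := by
    rw [← ENNReal.ofReal_ofNat, ← ENNReal.ofReal_mul (by norm_num)]; norm_num
  have hk1 : Measurable fun y => k (y / 2) := hk.comp (by fun_prop)
  have hk2 : Measurable fun y => k (1 - y / 2) := hk.comp (by fun_prop)
  refine ⟨fun y => (k (y / 2) ^ q + k (1 - y / 2) ^ q) ^ (1 / q), by fun_prop, ?_, ?_⟩
  · rw [lintegral_Ioo_fold' (F := fun t => k t ^ q)
      (H := fun y => k (y / 2) ^ q + k (1 - y / 2) ^ q) (by fun_prop) fun y _ => rfl,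
      ← mul_assoc, hhalf, one_mul]
    refine lintegral_congr fun y => ?_
    rw [← ENNReal.rpow_mul, one_div_mul_cancel hq0.ne', ENNReal.rpow_one]
  · set Gk : ℝ → ℝ≥0∞ := fun x => ∫⁻ t in Ioo (0 : ℝ) 1, ENNReal.ofReal (green x t) * k t with hGk
    set α : ℝ → ℝ → ℝ≥0∞ := fun z y => ENNReal.ofReal (1 / 2) *
      ENNReal.ofReal (green (z / 2) (y / 2)) with hα
    set β : ℝ → ℝ → ℝ≥0∞ := fun z y => ENNReal.ofReal (1 / 2) *
      ENNReal.ofReal (green (z / 2) (1 - y / 2)) with hβ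
    have hαm : ∀ z, Measurable (α z) := fun z => by
      simp only [hα]; unfold green; fun_prop
    have hβm : ∀ z, Measurable (β z) := fun z => by
      simp only [hβ]; unfold green; fun_prop
    have hG1 : ∀ z, Gk (z / 2) = ∫⁻ y in Ioo (0 : ℝ) 1,
        (α z y * k (y / 2) + β z y * k (1 - y / 2)) := fun z => by
      simp only [hGk]
      rw [lintegral_Ioo_fold' (F := fun t => ENNReal.ofReal (green (z / 2) t) * k t)
        ((measurable_green_right _).ennreal_ofReal.mul hk) fun y _ => rfl,
        ← lintegral_const_mul' _ _ ENNReal.ofReal_ne_top]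
      refine lintegral_congr fun y => ?_
      simp only [hα, hβ]; ring
    have hG2 : ∀ z, Gk (1 - z / 2) = ∫⁻ y in Ioo (0 : ℝ) 1,
        (β z y * k (y / 2) + α z y * k (1 - y / 2)) := fun z => by
      simp only [hGk]
      rw [lintegral_Ioo_fold' (F := fun t => ENNReal.ofReal (green (1 - z / 2) t) * k t)
        ((measurable_green_right _).ennreal_ofReal.mul hk) fun y _ => rfl,
        ← lintegral_const_mul' _ _ ENNReal.ofReal_ne_top]
      refine lintegral_congr fun y => ?_
      simp only [hα, hβ, green_symm_left, sub_sub_cancel]; ring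
    have hGm : Measurable Gk := measurable_lintegral_green hk
    have h4 : (4 : ℝ≥0∞) * ENNReal.ofReal (1 / 4) = 1 := by
      rw [← ENNReal.ofReal_ofNat, ← ENNReal.ofReal_mul (by norm_num)]; norm_num
    rw [lintegral_Ioo_fold' (F := fun x => Gk x ^ q)
      (H := fun z => Gk (z / 2) ^ q + Gk (1 - z / 2) ^ q) (hGm.pow_const _) fun y _ => rfl,
      mul_left_comm, ← mul_assoc 2, hhalf, one_mul,
      ← lintegral_const_mul' _ _ (ENNReal.rpow_ne_top_of_nonneg hq0.le (by simp))]
    refine setLIntegral_mono' measurableSet_Ioo fun z hz => ?_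
    have hmono : Gk (z / 2) ^ q + Gk (1 - z / 2) ^ q ≤
        (ENNReal.ofReal (1 / 4) * ∫⁻ y in Ioo (0 : ℝ) 1, ENNReal.ofReal (min z y) *
          (k (y / 2) ^ q + k (1 - y / 2) ^ q) ^ (1 / q)) ^ q := by
      rw [hG1, hG2]
      refine (lintegral_rpow_add_lintegral_rpow_le hq
        (((hαm z).mul hk1).add ((hβm z).mul hk2))).trans ?_
      rw [← lintegral_const_mul' _ _ ENNReal.ofReal_ne_top]
      gcongr ?_ ^ q
      refine setLIntegral_mono' measurableSet_Ioo fun y hy => ?_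
      refine (two_point_minkowski hq _ _ _ _).trans_eq ?_
      simp only [hα, hβ]
      rw [← mul_add, ofReal_green_half_add hz hy, ← mul_assoc (ENNReal.ofReal (1 / 2)),
        ← ENNReal.ofReal_mul (by norm_num), mul_assoc]
      norm_num
    calc _ ≤ 4 ^ q * (ENNReal.ofReal (1 / 4) * ∫⁻ y in Ioo (0 : ℝ) 1, ENNReal.ofReal (min z y) *
          (k (y / 2) ^ q + k (1 - y / 2) ^ q) ^ (1 / q)) ^ q := by gcongr
      _ = _ := by
        rw [← ENNReal.mul_rpow_of_nonneg _ _ hq0.le, ← mul_assoc, h4, one_mul]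

end

noncomputable section

/-! ### Local estimates for the interpolation error -/

section upper

variable {𝕜 : Type} [RCLike 𝕜] {p : ℝ≥0∞} {a b : ℝ}

theorem enorm_setIntegral_smul_le {f : ℝ → 𝕜} {κ κ' : ℝ → ℝ} {c d : ℝ} (hcd : Ioo c d ⊆ Ioo a b)
    (h1 : ∀ t ∈ Ioo c d, |κ t| ≤ κ' t) (h2 : ∀ t ∈ Ioo a b, t ∉ Ioo c d → κ t = 0) :
    ‖∫ t in Ioo a b, κ t • f t‖ₑ ≤ ∫⁻ t in Ioo c d, ENNReal.ofReal (κ' t) * ‖f t‖ₑ := by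
  rw [setIntegral_eq_of_subset_of_forall_sdiff_eq_zero measurableSet_Ioo hcd
    fun t ht => by rw [h2 t ht.1 ht.2, zero_smul]]
  refine (enorm_integral_le_lintegral_enorm _).trans
    (setLIntegral_mono' measurableSet_Ioo fun t ht => ?_)
  rw [enorm_smul, Real.enorm_eq_ofReal_abs]
  gcongr
  exact h1 t ht

theorem integral_volterra_sub {f : ℝ → 𝕜} (hf : IntegrableOn f (Ioo a b)) {x y : ℝ}
    (hx : x ∈ Icc a b) (hy : y ∈ Icc a b) (r : ℝ) :
    r • (volterraFun a f x - volterraFun a f y) =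
      ∫ t in Ioo a b, (r * (max (x - t) 0 - max (y - t) 0)) • f t := by
  rw [volterraFun_eq_setIntegral f hx, volterraFun_eq_setIntegral f hy,
    ← integral_sub (integrableOn_continuous_smul (by fun_prop) hf)
      (integrableOn_continuous_smul (by fun_prop) hf), ← integral_smul]
  congr 1 with t
  rw [mul_smul, sub_smul]

/-- The error on `(c, d)` only sees `f` on `(c, d)`: for `t ≤ c` the kernel is affine in `x` and is
reproduced, for `t ≥ d` it vanishes. What remains is minus the Green function of `(c, d)`. -/
theorem enorm_volterraFun_sub_endpointInterp_le {f : ℝ → 𝕜} (hf : IntegrableOn f (Ioo a b))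
    {c d x : ℝ} (hac : a ≤ c) (hdb : d ≤ b) (hx : x ∈ Ioo c d) :
    ‖volterraFun a f x - endpointInterp c d (volterraFun a f) x‖ₑ ≤
      ∫⁻ t in Ioo c d, ENNReal.ofReal ((min x t - c) * (d - max x t) / (d - c)) * ‖f t‖ₑ := by
  obtain ⟨hcx, hxd⟩ := hx
  have hcd : 0 < d - c := by linarith
  have hc : c ∈ Icc a b := ⟨hac, by linarith⟩
  have hd : d ∈ Icc a b := ⟨by linarith, hdb⟩
  have hxm : x ∈ Icc a b := ⟨by linarith, by linarith⟩
  have e : volterraFun a f x - endpointInterp c d (volterraFun a f) x =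
      ∫ t in Ioo a b, ((1 * (max (x - t) 0 - max (c - t) 0)) -
        (x - c) / (d - c) * (max (d - t) 0 - max (c - t) 0)) • f t := by
    simp_rw [sub_smul]
    rw [integral_sub (integrableOn_continuous_smul (by fun_prop) hf)
      (integrableOn_continuous_smul (by fun_prop) hf), ← integral_volterra_sub hf hxm hc,
      ← integral_volterra_sub hf hd hc, endpointInterp, one_smul, sub_add_eq_sub_sub]
  rw [e]
  refine enorm_setIntegral_smul_le (Ioo_subset_Ioo hac hdb) (fun t ht => ?_) fun t ht ht' => ?_
  · obtain ⟨hct, htd⟩ := ht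
    rw [max_eq_right (by linarith : c - t ≤ 0), max_eq_left (by linarith : 0 ≤ d - t)]
    rcases le_total x t with h | h
    · rw [max_eq_right (by linarith), min_eq_left h, max_eq_right h, abs_of_nonpos]
      · apply le_of_eq; field_simp; ring
      · have : 0 ≤ (x - c) / (d - c) * (d - t - 0) := by
          apply mul_nonneg (div_nonneg _ _) _ <;> linarith
        linarith
    · rw [max_eq_left (by linarith), min_eq_right h, max_eq_left h]
      have : 1 * (x - t - 0) - (x - c) / (d - c) * (d - t - 0) =
          -((t - c) * (d - x) / (d - c)) := by
        field_simp; ring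
      rw [this, abs_neg, abs_of_nonneg]
      apply div_nonneg (mul_nonneg _ _) <;> linarith
  · rcases le_or_gt t c with h | h
    · rw [max_eq_left (by linarith), max_eq_left (by linarith), max_eq_left (by linarith)]
      field_simp; ring
    · have : d ≤ t := by
        by_contra h'
        exact ht' ⟨h, not_le.1 h'⟩
      rw [max_eq_right (by linarith), max_eq_right (by linarith), max_eq_right (by linarith)]
      ring

/-- Since `u'(a) = 0`, subtracting the constant `u(d)` leaves a mixed boundary problem on `(a, d)`,
whose kernel is the quarter-wave one reflected. -/
theorem enorm_volterraFun_sub_le {f : ℝ → 𝕜} (hf : IntegrableOn f (Ioo a b)) {d x : ℝ}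
    (hdb : d ≤ b) (hx : x ∈ Ioo a d) :
    ‖volterraFun a f x - volterraFun a f d‖ₑ ≤
      ∫⁻ t in Ioo a d, ENNReal.ofReal (min (d - x) (d - t)) * ‖f t‖ₑ := by
  obtain ⟨hax, hxd⟩ := hx
  rw [← one_smul ℝ (_ - _), integral_volterra_sub hf ⟨hax.le, by linarith⟩ ⟨by linarith, hdb⟩]
  refine enorm_setIntegral_smul_le (Ioo_subset_Ioo le_rfl hdb) (fun t ht => ?_) fun t ht ht' => ?_
  · rw [max_eq_left (by linarith [ht.2] : 0 ≤ d - t), one_mul]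
    rcases le_total x t with h | h
    · rw [max_eq_right (by linarith), min_eq_right (by linarith), zero_sub, abs_neg,
        abs_of_nonneg (by linarith [ht.2])]
    · rw [max_eq_left (by linarith), min_eq_left (by linarith), abs_of_nonpos (by linarith)]
      linarith
  · have : d ≤ t := by
      by_contra h'
      exact ht' ⟨ht.1, not_le.1 h'⟩
    rw [max_eq_right (by linarith), max_eq_right (by linarith)]
    ring

theorem enorm_volterraFun_le {f : ℝ → 𝕜} {x : ℝ} (hx : x ∈ Ioo a b) :
    ‖volterraFun a f x‖ₑ ≤ ∫⁻ t in Ioo a b, ENNReal.ofReal (max (x - t) 0) * ‖f t‖ₑ := by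
  rw [volterraFun_eq_setIntegral f (Ioo_subset_Icc_self hx)]
  exact enorm_setIntegral_smul_le Subset.rfl (fun t _ => (abs_of_nonneg (le_max_right _ _)).le)
    fun t ht ht' => absurd ht ht'

theorem lintegral_volterraFun_sub_endpointInterp_le [Fact (1 ≤ p)] (hp : p ≠ ⊤) {f : ℝ → 𝕜}
    (hfm : Measurable f) (hf : IntegrableOn f (Ioo a b)) {c d : ℝ} (hac : a ≤ c) (hcd : c < d)
    (hdb : d ≤ b) :
    ∫⁻ x in Ioo c d, ‖volterraFun a f x - endpointInterp c d (volterraFun a f) x‖ₑ ^ p.toReal ≤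
      (ENNReal.ofReal ((d - c) ^ 2) * interpConst 𝕜 p 0 1) ^ p.toReal *
        ∫⁻ t in Ioo c d, ‖f t‖ₑ ^ p.toReal := by
  have hq : 0 < p.toReal := ENNReal.toReal_pos (zero_lt_one.trans_le Fact.out).ne' hp
  have h := lintegral_kernel_rpow_le_of_affine (κ := fun x t => ENNReal.ofReal (green x t))
    (κ' := fun x t => ENNReal.ofReal ((min x t - c) * (d - max x t) / (d - c)))
    (c := c) (d := d) (c' := c) (d' := d) hq
    (fun k hk => lintegral_green_rpow_le (𝕜 := 𝕜) hp hk) (sub_pos.2 hcd)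
    (abs_of_pos (sub_pos.2 hcd)) (abs_of_pos (sub_pos.2 hcd)) (fun y hy s hs => by
      have hL : 0 < d - c := sub_pos.2 hcd
      rw [← ENNReal.ofReal_mul hL.le, min_add_add_left, max_add_add_left,
        ← mul_min_of_nonneg _ _ hL.le, ← mul_max_of_nonneg _ _ hL.le, green]
      refine (congrArg _ ?_).le
      field_simp; ring) hfm.enorm
  rw [min_eq_left hcd.le, max_eq_right hcd.le] at h
  refine le_trans (setLIntegral_mono' measurableSet_Ioo fun x hx => ?_) h
  exact ENNReal.rpow_le_rpow (enorm_volterraFun_sub_endpointInterp_le hf hac hdb hx) hq.le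

theorem lintegral_volterraFun_sub_le [Fact (1 ≤ p)] (hp : p ≠ ⊤) {f : ℝ → 𝕜}
    (hfm : Measurable f) (hf : IntegrableOn f (Ioo a b)) {d : ℝ} (had : a < d) (hdb : d ≤ b) :
    ∫⁻ x in Ioo a d, ‖volterraFun a f x - volterraFun a f d‖ₑ ^ p.toReal ≤
      (ENNReal.ofReal ((d - a) ^ 2) * (4 * interpConst 𝕜 p 0 1)) ^ p.toReal *
        ∫⁻ t in Ioo a d, ‖f t‖ₑ ^ p.toReal := by
  have hq : 0 < p.toReal := ENNReal.toReal_pos (zero_lt_one.trans_le Fact.out).ne' hp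
  have hL : 0 < d - a := sub_pos.2 had
  have hL' : |a - d| = d - a := by rw [abs_sub_comm, abs_of_pos hL]
  have h := lintegral_kernel_rpow_le_of_affine (κ := fun x t => ENNReal.ofReal (min x t))
    (κ' := fun x t => ENNReal.ofReal (min (d - x) (d - t)))
    (c := d) (d := a) (c' := d) (d' := a) hq
    (fun k hk => lintegral_min_rpow_le (𝕜 := 𝕜) hp hk) hL hL' hL' (fun y hy s hs => by
      rw [← ENNReal.ofReal_mul hL.le, mul_min_of_nonneg _ _ hL.le]
      refine (congrArg _ ?_).le
      congr 1 <;> ring) hfm.enorm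
  rw [min_eq_right had.le, max_eq_left had.le] at h
  refine le_trans (setLIntegral_mono' measurableSet_Ioo fun x hx => ?_) h
  exact ENNReal.rpow_le_rpow (enorm_volterraFun_sub_le hf hdb hx) hq.le

/-- Reversing only the variable `t` turns `(x - t)⁺` into `(y + s - 1)⁺`, which is at most `min y s`
on the unit square. -/
theorem lintegral_volterraFun_le [Fact (1 ≤ p)] (hp : p ≠ ⊤) (hab : a < b) {f : ℝ → 𝕜}
    (hfm : Measurable f) :
    ∫⁻ x in Ioo a b, ‖volterraFun a f x‖ₑ ^ p.toReal ≤
      (ENNReal.ofReal ((b - a) ^ 2) * (4 * interpConst 𝕜 p 0 1)) ^ p.toReal *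
        ∫⁻ t in Ioo a b, ‖f t‖ₑ ^ p.toReal := by
  have hq : 0 < p.toReal := ENNReal.toReal_pos (zero_lt_one.trans_le Fact.out).ne' hp
  have hL : 0 < b - a := sub_pos.2 hab
  have hL' : |a - b| = b - a := by rw [abs_sub_comm, abs_of_pos hL]
  have h := lintegral_kernel_rpow_le_of_affine (κ := fun x t => ENNReal.ofReal (min x t))
    (κ' := fun x t => ENNReal.ofReal (max (x - t) 0))
    (c := a) (d := b) (c' := b) (d' := a) hq
    (fun k hk => lintegral_min_rpow_le (𝕜 := 𝕜) hp hk) hL (abs_of_pos hL) hL'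
    (fun y hy s hs => by
      rw [← ENNReal.ofReal_mul hL.le]
      refine ENNReal.ofReal_le_ofReal (max_le ?_ (mul_nonneg hL.le (le_min hy.1.le hs.1.le)))
      have e : a + (b - a) * y - (b + (a - b) * s) = (b - a) * (y + s - 1) := by ring
      rw [e]
      refine mul_le_mul_of_nonneg_left (le_min ?_ ?_) hL.le
      · linarith [hs.2]
      · linarith [hy.2]) hfm.enorm
  rw [min_eq_left hab.le, max_eq_right hab.le, min_eq_right hab.le, max_eq_left hab.le] at h
  refine le_trans (setLIntegral_mono' measurableSet_Ioo fun x hx => ?_) h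
  exact ENNReal.rpow_le_rpow (enorm_volterraFun_le hx) hq.le

/-! ### Approximation by linear splines -/

theorem Lp_norm_le_of_lintegral_rpow_le [Fact (1 ≤ p)] (hp : p ≠ ⊤) {μ : Measure ℝ}
    (f g : Lp 𝕜 p μ) {C : ℝ≥0∞} (hC : C ≠ ⊤)
    (h : ∫⁻ x, ‖g x‖ₑ ^ p.toReal ∂μ ≤ C ^ p.toReal * ∫⁻ x, ‖f x‖ₑ ^ p.toReal ∂μ) :
    ‖g‖ ≤ C.toReal * ‖f‖ := by
  have hp0 : p ≠ 0 := (zero_lt_one.trans_le Fact.out).ne'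
  have hq : 0 < p.toReal := ENNReal.toReal_pos hp0 hp
  rw [Lp.norm_def, Lp.norm_def, ← ENNReal.toReal_mul]
  refine ENNReal.toReal_mono (ENNReal.mul_ne_top hC (Lp.memLp f).2.ne) ?_
  rw [eLpNorm_eq_lintegral_rpow_enorm_toReal hp0 hp, eLpNorm_eq_lintegral_rpow_enorm_toReal hp0 hp]
  refine (ENNReal.rpow_le_rpow h (by positivity)).trans_eq ?_
  rw [ENNReal.mul_rpow_of_nonneg _ _ (by positivity), ← ENNReal.rpow_mul,
    mul_one_div_cancel hq.ne', ENNReal.rpow_one]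

theorem exists_integral_norm_le [Fact (1 ≤ p)] : ∃ D : ℝ, 0 ≤ D ∧
    ∀ f : Lp 𝕜 p (volume.restrict (Ioo a b)), ∫ t in Ioo a b, ‖f t‖ ≤ D * ‖f‖ := by
  set μ := volume.restrict (Ioo a b) with hμ
  have hp1 : (1 : ℝ≥0∞) ≤ p := Fact.out
  set D := μ univ ^ (1 / (1 : ℝ≥0∞).toReal - 1 / p.toReal) with hD
  have hne : D ≠ ⊤ := by
    refine ENNReal.rpow_ne_top_of_nonneg ?_ (measure_ne_top _ _)
    rcases eq_or_ne p ⊤ with h | h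
    · simp [h]
    · have : (1 : ℝ) ≤ p.toReal := by simpa using ENNReal.toReal_mono h hp1
      simpa using inv_le_one_of_one_le₀ this
  refine ⟨D.toReal, ENNReal.toReal_nonneg, fun f => ?_⟩
  have h1 := eLpNorm_le_eLpNorm_mul_rpow_measure_univ (μ := μ) (f := f) hp1 (Lp.memLp f).1
  have h2 := ENNReal.toReal_mono (ENNReal.mul_ne_top (Lp.memLp f).2.ne hne) h1
  rw [ENNReal.toReal_mul, ← Lp.norm_def, eLpNorm_one_eq_lintegral_enorm,
    ← integral_norm_eq_lintegral_enorm (Lp.memLp f).1] at h2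
  rwa [mul_comm]

/-- Evaluation of `x ↦ ∫_a^x (x - t) f(t) dt` at a point, as a functional on `L_p`. -/
def volterraEval (𝕜 : Type) [RCLike 𝕜] (p : ℝ≥0∞) [Fact (1 ≤ p)] (a b x : ℝ) :
    Lp 𝕜 p (volume.restrict (Ioo a b)) →L[𝕜] 𝕜 :=
  LinearMap.mkContinuousOfExistsBound
    { toFun := fun f => ∫ t in Ioo a b, max (x - t) 0 • f t
      map_add' := fun f g => by
        rw [← integral_add (integrableOn_continuous_smul (by fun_prop) (Lp_integrableOn_Ioo f))
          (integrableOn_continuous_smul (by fun_prop) (Lp_integrableOn_Ioo g))]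
        refine integral_congr_ae ?_
        filter_upwards [Lp.coeFn_add f g] with t ht
        rw [ht, Pi.add_apply, smul_add]
      map_smul' := fun r f => by
        rw [RingHom.id_apply, ← integral_smul]
        refine integral_congr_ae ?_
        filter_upwards [Lp.coeFn_smul r f] with t ht
        rw [ht, Pi.smul_apply, smul_comm] }
    (by
      obtain ⟨D, hD, hf⟩ := exists_integral_norm_le (𝕜 := 𝕜) (p := p) (a := a) (b := b)
      refine ⟨|x - a| * D, fun f => ?_⟩
      refine (norm_integral_le_of_norm_le ((Lp_integrableOn_Ioo f).norm.const_mul |x - a|)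
        ?_).trans ?_
      · filter_upwards [ae_restrict_mem measurableSet_Ioo] with t ht
        rw [norm_smul, Real.norm_eq_abs, abs_of_nonneg (le_max_right _ _)]
        refine mul_le_mul_of_nonneg_right (max_le ?_ (abs_nonneg _)) (norm_nonneg _)
        exact le_trans (by linarith [ht.1]) (le_abs_self (x - a))
      · rw [integral_const_mul, mul_assoc]
        exact mul_le_mul_of_nonneg_left (hf f) (abs_nonneg _))

theorem volterraEval_apply [Fact (1 ≤ p)] {x : ℝ} (hx : x ∈ Icc a b)
    (f : Lp 𝕜 p (volume.restrict (Ioo a b))) :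
    volterraEval 𝕜 p a b x f = volterraFun a f x :=
  (volterraFun_eq_setIntegral (f : ℝ → 𝕜) hx).symm

/-- The continuous function that is `0` before `c`, affine on `[c, c + h]` and `1` after it. -/
def ramp (h c x : ℝ) : ℝ := max 0 (min 1 ((x - c) / h))

theorem ramp_of_le {h c x : ℝ} (hh : 0 < h) (hx : x ≤ c) : ramp h c x = 0 := by
  rw [ramp, max_eq_left]
  exact (min_le_right _ _).trans (div_nonpos_of_nonpos_of_nonneg (by linarith) hh.le)

theorem ramp_of_ge {h c x : ℝ} (hh : 0 < h) (hx : c + h ≤ x) : ramp h c x = 1 := by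
  rw [ramp, min_eq_left, max_eq_right zero_le_one]
  rw [le_div_iff₀ hh]; linarith

theorem ramp_of_mem {h c x : ℝ} (hh : 0 < h) (hx : x ∈ Icc c (c + h)) :
    ramp h c x = (x - c) / h := by
  rw [ramp, min_eq_right, max_eq_right]
  · exact div_nonneg (by linarith [hx.1]) hh.le
  · rw [div_le_one hh]; linarith [hx.2]

theorem memLp_ramp [Fact (1 ≤ p)] (h c : ℝ) :
    MemLp (fun x => ((ramp h c x : ℝ) : 𝕜)) p (volume.restrict (Ioo a b)) := by
  refine MemLp.of_bound (Measurable.aestronglyMeasurable ?_) 1 (Eventually.of_forall fun x => ?_)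
  · refine RCLike.measurable_ofReal.comp ?_
    unfold ramp; fun_prop
  · rw [RCLike.norm_ofReal, abs_of_nonneg (le_max_left _ _)]
    exact max_le zero_le_one (min_le_left _ _)

/-- Linear spline with nodes `c, c + h, …, c + N h`, constant before `c`. -/
def spline (u : ℝ → 𝕜) (h c : ℝ) (N : ℕ) (x : ℝ) : 𝕜 :=
  u c + ∑ j ∈ Finset.range N, (u (c + (j + 1) * h) - u (c + j * h)) * (ramp h (c + j * h) x : ℝ)

theorem spline_of_le (u : ℝ → 𝕜) {h c : ℝ} (N : ℕ) {x : ℝ} (hh : 0 < h) (hx : x ≤ c) :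
    spline u h c N x = u c := by
  rw [spline, Finset.sum_eq_zero, add_zero]
  intro j _
  have : 0 ≤ (j : ℝ) * h := by positivity
  rw [ramp_of_le hh (by linarith)]
  simp

theorem spline_of_mem (u : ℝ → 𝕜) {h c : ℝ} {N j : ℕ} (hj : j < N) {x : ℝ} (hh : 0 < h)
    (hx : x ∈ Ioo (c + j * h) (c + (j + 1) * h)) :
    spline u h c N x = endpointInterp (c + j * h) (c + (j + 1) * h) u x := by
  obtain ⟨M, rfl⟩ := Nat.exists_eq_add_of_lt hj
  -- The sum is split at the active ramp: earlier ramps equal one and telescope, later ones vanish.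
  rw [spline, add_assoc j M 1, add_comm M 1, ← add_assoc, Finset.sum_range_add,
    Finset.sum_range_succ]
  have h1 : ∑ i ∈ Finset.range j, (u (c + (i + 1) * h) - u (c + i * h)) *
      ((ramp h (c + i * h) x : ℝ) : 𝕜) = u (c + j * h) - u c := by
    have := Finset.sum_range_sub (fun i : ℕ => u (c + i * h)) j
    simp only [Nat.cast_add, Nat.cast_one, Nat.cast_zero, zero_mul, add_zero] at this
    rw [← this]
    refine Finset.sum_congr rfl fun i hi => ?_
    have hi' : ((i : ℝ) + 1) ≤ j := by exact_mod_cast Finset.mem_range.1 hi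
    rw [ramp_of_ge hh]
    · simp
    · nlinarith [hx.1]
  have h2 : ∑ i ∈ Finset.range M, (u (c + (((j + 1 + i : ℕ) : ℝ) + 1) * h) -
      u (c + ((j + 1 + i : ℕ) : ℝ) * h)) * ((ramp h (c + ((j + 1 + i : ℕ) : ℝ) * h) x : ℝ) : 𝕜)
      = 0 := by
    refine Finset.sum_eq_zero fun i _ => ?_
    rw [ramp_of_le hh]
    · simp
    · have : 0 ≤ (i : ℝ) * h := by positivity
      push_cast
      nlinarith [hx.2]
  rw [h1, h2, ramp_of_mem hh ⟨hx.1.le, by nlinarith [hx.2]⟩, endpointInterp]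
  have e : c + (j + 1) * h - (c + j * h) = h := by ring
  rw [e, RCLike.real_smul_eq_coe_mul]
  ring

/-- Spline interpolation of `T₂ f`, as an operator on `L_p`. -/
def splineOp (𝕜 : Type) [RCLike 𝕜] (p : ℝ≥0∞) [Fact (1 ≤ p)] (a b h c : ℝ) (N : ℕ) :
    Lp 𝕜 p (volume.restrict (Ioo a b)) →L[𝕜] Lp 𝕜 p (volume.restrict (Ioo a b)) :=
  (volterraEval 𝕜 p a b c).smulRight ((memLp_const (1 : 𝕜)).toLp _) +
    ∑ j ∈ Finset.range N,
      (volterraEval 𝕜 p a b (c + (j + 1) * h) - volterraEval 𝕜 p a b (c + j * h)).smulRight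
        ((memLp_ramp h (c + j * h)).toLp _)

theorem splineOp_coeFn [Fact (1 ≤ p)] {h c : ℝ} {N : ℕ} (hh : 0 ≤ h) (hac : a ≤ c)
    (hN : c + N * h ≤ b) (f : Lp 𝕜 p (volume.restrict (Ioo a b))) :
    splineOp 𝕜 p a b h c N f =ᵐ[volume.restrict (Ioo a b)] spline (volterraFun a f) h c N := by
  induction N with
  | zero =>
    simp only [splineOp, Finset.range_zero, Finset.sum_empty, add_zero,
      ContinuousLinearMap.smulRight_apply]
    filter_upwards [Lp.coeFn_smul (volterraEval 𝕜 p a b c f)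
      ((memLp_const (1 : 𝕜) (p := p) (μ := volume.restrict (Ioo a b))).toLp _),
      (memLp_const (1 : 𝕜) (p := p) (μ := volume.restrict (Ioo a b))).coeFn_toLp] with x h1 h2
    rw [h1, Pi.smul_apply, h2, volterraEval_apply ⟨hac, by simpa using hN⟩]
    simp [spline]
  | succ N ih =>
    push_cast at hN
    have hNh : 0 ≤ (N : ℝ) * h := by positivity
    have hstep : splineOp 𝕜 p a b h c (N + 1) f = splineOp 𝕜 p a b h c N f +
        (volterraEval 𝕜 p a b (c + (N + 1) * h) - volterraEval 𝕜 p a b (c + N * h)) f •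
          (memLp_ramp h (c + N * h)).toLp _ := by
      simp only [splineOp, Finset.sum_range_succ, ← add_assoc]
      rfl
    rw [hstep]
    filter_upwards [Lp.coeFn_add (splineOp 𝕜 p a b h c N f)
        ((volterraEval 𝕜 p a b (c + (N + 1) * h) - volterraEval 𝕜 p a b (c + N * h)) f •
          (memLp_ramp h (c + N * h)).toLp _), ih (by linarith),
      Lp.coeFn_smul ((volterraEval 𝕜 p a b (c + (N + 1) * h) -
        volterraEval 𝕜 p a b (c + N * h)) f)
        ((memLp_ramp (𝕜 := 𝕜) (p := p) (a := a) (b := b) h (c + N * h)).toLp _),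
      (memLp_ramp (𝕜 := 𝕜) (p := p) (a := a) (b := b) h (c + N * h)).coeFn_toLp] with x h1 h2 h3 h4
    rw [h1, Pi.add_apply, h2, h3, Pi.smul_apply, h4, _root_.sub_apply,
      volterraEval_apply ⟨by linarith, hN⟩, volterraEval_apply ⟨by linarith, by linarith⟩]
    simp only [spline, Finset.sum_range_succ, smul_eq_mul, add_assoc]

/-- The range is spanned by the constant and `N` ramps. The rank must be strictly below the index,
hence `N + 2`. -/
theorem rank_splineOp_lt [Fact (1 ≤ p)] (h c : ℝ) (N : ℕ) :
    (splineOp 𝕜 p a b h c N : Lp 𝕜 p (volume.restrict (Ioo a b)) →ₗ[𝕜]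
      Lp 𝕜 p (volume.restrict (Ioo a b))).rank < (N + 2 : ℕ) := by
  classical
  set e : ℕ → Lp 𝕜 p (volume.restrict (Ioo a b)) := fun j => (memLp_ramp h (c + j * h)).toLp _
    with he
  set e' : Lp 𝕜 p (volume.restrict (Ioo a b)) := (memLp_const (1 : 𝕜)).toLp _ with he'
  set S : Finset (Lp 𝕜 p (volume.restrict (Ioo a b))) := insert e' ((Finset.range N).image e) with hS
  have hle : LinearMap.range (splineOp 𝕜 p a b h c N : Lp 𝕜 p (volume.restrict (Ioo a b)) →ₗ[𝕜]
      Lp 𝕜 p (volume.restrict (Ioo a b))) ≤ Submodule.span 𝕜 (S : Set _) := by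
    rintro _ ⟨f, rfl⟩
    have : (splineOp 𝕜 p a b h c N) f = volterraEval 𝕜 p a b c f • e' +
        ∑ j ∈ Finset.range N, (volterraEval 𝕜 p a b (c + (j + 1) * h) -
          volterraEval 𝕜 p a b (c + j * h)) f • e j := by
      simp [splineOp, he, he']
    rw [ContinuousLinearMap.coe_coe, this]
    refine Submodule.add_mem _ (Submodule.smul_mem _ _ (Submodule.subset_span ?_))
      (Submodule.sum_mem _ fun j hj => Submodule.smul_mem _ _ (Submodule.subset_span ?_))
    · simp [hS]
    · exact Finset.mem_coe.2 (Finset.mem_insert_of_mem (Finset.mem_image_of_mem e hj))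
  have hcard : S.card ≤ N + 1 :=
    (Finset.card_insert_le _ _).trans (Nat.succ_le_succ (Finset.card_image_le.trans (by simp)))
  calc _ ≤ Module.rank 𝕜 (Submodule.span 𝕜 (S : Set (Lp 𝕜 p (volume.restrict (Ioo a b))))) :=
        Submodule.rank_mono hle
    _ ≤ S.card := rank_span_finset_le S
    _ < (N + 2 : ℕ) := by exact_mod_cast Nat.lt_succ_of_le hcard

theorem approxNumber_le {X Y : Type} [NormedAddCommGroup X] [NormedSpace 𝕜 X]
    [NormedAddCommGroup Y] [NormedSpace 𝕜 Y] (T F : X →L[𝕜] Y) {n : ℕ}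
    (hF : (F : X →ₗ[𝕜] Y).rank < n) : approxNumber T n ≤ ‖T - F‖ :=
  csInf_le ⟨0, by rintro r ⟨F, -, rfl⟩; exact norm_nonneg _⟩ ⟨F, hF, rfl⟩

/-- The `q`-th powers of errors and data add over the subintervals, and each subinterval has the
same constant `h² B`. The first one has half the length but four times the kernel norm. -/
theorem norm_volterraTwo_sub_splineOp_le [Fact (1 ≤ p)] (hp : p ≠ ⊤) {h : ℝ} (hh : 0 < h) (N : ℕ)
    (hN : a + h / 2 + N * h = b) :
    ‖volterraTwo 𝕜 p a b - splineOp 𝕜 p a b h (a + h / 2) N‖ ≤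
      h ^ 2 * (interpConst 𝕜 p 0 1).toReal := by
  set c := a + h / 2 with hc
  set q := p.toReal with hqdef
  have hq : 0 < q := ENNReal.toReal_pos (zero_lt_one.trans_le Fact.out).ne' hp
  set D : ℝ≥0∞ := ENNReal.ofReal (h ^ 2) * interpConst 𝕜 p 0 1 with hD
  have hDt : D ≠ ⊤ := ENNReal.mul_ne_top ENNReal.ofReal_ne_top interpConst_ne_top
  have hDr : D.toReal = h ^ 2 * (interpConst 𝕜 p 0 1).toReal := by
    rw [hD, ENNReal.toReal_mul, ENNReal.toReal_ofReal (by positivity)]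
  rw [← hDr]
  refine ContinuousLinearMap.opNorm_le_bound _ ENNReal.toReal_nonneg fun f => ?_
  refine Lp_norm_le_of_lintegral_rpow_le hp _ _ hDt ?_
  rw [← hqdef]
  set u := volterraFun a (f : ℝ → 𝕜) with hu
  have hfi := Lp_integrableOn_Ioo f
  have hfm : Measurable (f : ℝ → 𝕜) := (Lp.stronglyMeasurable f).measurable
  have hcoe : ∫⁻ x in Ioo a b, ‖(volterraTwo 𝕜 p a b - splineOp 𝕜 p a b h c N) f x‖ₑ ^ q =
      ∫⁻ x in Ioo a b, ‖u x - spline u h c N x‖ₑ ^ q := by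
    refine lintegral_congr_ae ?_
    rw [_root_.sub_apply]
    filter_upwards [Lp.coeFn_sub (volterraTwo 𝕜 p a b f) (splineOp 𝕜 p a b h c N f),
      volterraTwo_coeFn f, splineOp_coeFn hh.le (by linarith) hN.le f] with x h1 h2 h3
    rw [h1, Pi.sub_apply, h2, h3]
    rfl
  rw [hcoe]
  have key : ∀ j ≤ N, ∫⁻ x in Ioo a (c + j * h), ‖u x - spline u h c N x‖ₑ ^ q ≤
      D ^ q * ∫⁻ x in Ioo a (c + j * h), ‖f x‖ₑ ^ q := by
    intro j
    induction j with
    | zero =>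
      intro _
      rw [Nat.cast_zero, zero_mul, add_zero]
      have hcb : c ≤ b := by
        have : 0 ≤ (N : ℝ) * h := by positivity
        linarith
      have h0 := lintegral_volterraFun_sub_le (𝕜 := 𝕜) hp hfm hfi (d := c) (by linarith) hcb
      -- Balance of the two kinds of subinterval: `(h/2)² · 4 = h²`.
      have e : ENNReal.ofReal ((c - a) ^ 2) * (4 * interpConst 𝕜 p 0 1) = D := by
        rw [hD, ← mul_assoc, ← ENNReal.ofReal_ofNat 4, ← ENNReal.ofReal_mul (by positivity)]
        congr 2
        rw [hc]; ring
      rw [e] at h0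
      refine le_trans (le_of_eq ?_) h0
      refine setLIntegral_congr_fun measurableSet_Ioo fun x hx => ?_
      rw [spline_of_le u N hh hx.2.le]
    | succ j ih =>
      intro hj
      have hjN : ((j : ℝ) + 1) ≤ N := by exact_mod_cast hj
      have hjh : 0 ≤ (j : ℝ) * h := by positivity
      have l1 : a < c + j * h := by linarith
      have l2 : c + j * h < c + (j + 1) * h := by nlinarith
      have l3 : c + (j + 1) * h ≤ b := by nlinarith
      rw [Nat.cast_add, Nat.cast_one, lintegral_Ioo_add_Ioo l1 l2, lintegral_Ioo_add_Ioo l1 l2,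
        mul_add]
      refine add_le_add (ih (by omega)) ?_
      have h0 := lintegral_volterraFun_sub_endpointInterp_le (𝕜 := 𝕜) hp hfm hfi l1.le l2 l3
      have e : c + (j + 1) * h - (c + j * h) = h := by ring
      rw [e, ← hD] at h0
      refine le_trans (le_of_eq ?_) h0
      refine setLIntegral_congr_fun measurableSet_Ioo fun x hx => ?_
      rw [spline_of_mem u (by omega) hh hx]
  have := key N le_rfl
  rwa [hN] at this

/-- For `n = N + 2`, the condition `h/2 + N h = b - a` gives the step `(b - a)/(n - 3/2)`. For `n =
1` the factor `(1 - 3/2)⁻² = 4` makes the claim the norm bound of `lintegral_volterraFun_le`. -/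
theorem approxNumber_volterraTwo_le [Fact (1 ≤ p)] (hp : p ≠ ⊤) (hab : a < b) {n : ℕ}
    (hn : 1 ≤ n) : approxNumber (volterraTwo 𝕜 p a b) n ≤
      ((b - a) / ((n : ℝ) - 3 / 2)) ^ 2 * (interpConst 𝕜 p 0 1).toReal := by
  rcases hn.eq_or_lt with rfl | hn
  · refine (approxNumber_le _ 0 (by simp)).trans ?_
    rw [sub_zero]
    set D : ℝ≥0∞ := ENNReal.ofReal ((b - a) ^ 2) * (4 * interpConst 𝕜 p 0 1) with hD
    have hDr : D.toReal = ((b - a) / (((1 : ℕ) : ℝ) - 3 / 2)) ^ 2 *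
        (interpConst 𝕜 p 0 1).toReal := by
      rw [hD, ENNReal.toReal_mul, ENNReal.toReal_ofReal (by positivity), ENNReal.toReal_mul,
        ENNReal.toReal_ofNat]
      push_cast
      ring
    rw [← hDr]
    refine ContinuousLinearMap.opNorm_le_bound _ ENNReal.toReal_nonneg fun f => ?_
    refine Lp_norm_le_of_lintegral_rpow_le hp _ _ (ENNReal.mul_ne_top ENNReal.ofReal_ne_top
      (ENNReal.mul_ne_top (by simp) interpConst_ne_top)) ?_
    refine le_trans (le_of_eq ?_) (lintegral_volterraFun_le (𝕜 := 𝕜) hp hab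
      (Lp.stronglyMeasurable f).measurable)
    refine lintegral_congr_ae ?_
    filter_upwards [volterraTwo_coeFn f] with x hx
    rw [hx]
    rfl
  · obtain ⟨N, rfl⟩ := Nat.exists_eq_add_of_le hn
    have hN : (0 : ℝ) < ((2 + N : ℕ) : ℝ) - 3 / 2 := by
      push_cast
      have : (0 : ℝ) ≤ N := by positivity
      linarith
    have hh : 0 < (b - a) / (((2 + N : ℕ) : ℝ) - 3 / 2) := div_pos (sub_pos.2 hab) hN
    refine (approxNumber_le _ _ ?_).trans (norm_volterraTwo_sub_splineOp_le hp hh N ?_)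
    · rw [Nat.succ_eq_add_one, show 1 + 1 + N = N + 2 by ring]
      exact rank_splineOp_lt _ _ _
    · have e : ((Nat.succ 1 + N : ℕ) : ℝ) - 3 / 2 = N + 1 / 2 := by push_cast; ring
      have e' : (N : ℝ) + 1 / 2 ≠ 0 := by positivity
      rw [e]
      field_simp
      ring

end upper

end

noncomputable section

/-! ### The quarter-wave operator -/

/-- The solution operator of `-u'' = g`, `u(0) = u'(1) = 0`. -/
def quarterOp (g : ℝ → ℝ) (x : ℝ) : ℝ := ∫ y in (0 : ℝ)..x, ∫ t in y..1, g t

theorem continuousOn_tail {c d : ℝ} {g : ℝ → ℝ} (hg : IntegrableOn g (Ioo c d)) :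
    ContinuousOn (fun y => ∫ t in y..d, g t) (Icc c d) := by
  rcases le_or_gt c d with h | h
  · have hd := right_mem_Icc.2 h
    have hc := left_mem_Icc.2 h
    refine ((continuousOn_const (c := ∫ t in c..d, g t)).sub
      (continuousOn_primitive_Icc (𝕜 := ℝ) hg)).congr fun y hy => ?_
    change _ = (∫ t in c..d, g t) - ∫ t in c..y, g t
    rw [eq_sub_iff_add_eq, add_comm]
    exact intervalIntegral.integral_add_adjacent_intervals
      (intervalIntegrable_of_integrableOn_Ioo hg hc hy)
      (intervalIntegrable_of_integrableOn_Ioo hg hy hd)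
  · simp [Icc_eq_empty_of_lt h]

theorem integrableOn_tail {c d : ℝ} {g : ℝ → ℝ} (hg : IntegrableOn g (Ioo c d)) :
    IntegrableOn (fun y => ∫ t in y..d, g t) (Ioo c d) :=
  ((continuousOn_tail hg).integrableOn_compact isCompact_Icc).mono_set Ioo_subset_Icc_self

theorem continuousOn_quarterOp {g : ℝ → ℝ} (hg : IntegrableOn g (Ioo 0 1)) :
    ContinuousOn (quarterOp g) (Icc 0 1) :=
  continuousOn_primitive_Icc (integrableOn_tail hg)

/-- Fubini with the indicator of `y ≤ x`, whose integral over `(0, t)` is `min x t`. -/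
theorem quarterOp_eq {g : ℝ → ℝ} (hg : IntegrableOn g (Ioo 0 1)) {x : ℝ} (hx : x ∈ Icc (0 : ℝ) 1) :
    quarterOp g x = ∫ t in (0 : ℝ)..1, min x t * g t := by
  have h0 : (0 : ℝ) ∈ Icc (0 : ℝ) 1 := left_mem_Icc.2 zero_le_one
  have h1 : (1 : ℝ) ∈ Icc (0 : ℝ) 1 := right_mem_Icc.2 zero_le_one
  have hi : IntervalIntegrable ((Iic x).indicator fun _ => (1 : ℝ)) volume 0 1 := by
    rw [intervalIntegrable_iff_integrableOn_Ioc_of_le zero_le_one]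
    exact (integrableOn_const (by simp)).indicator measurableSet_Iic
  have hind : ∀ s ∈ Icc (0 : ℝ) 1, ∀ F : ℝ → ℝ, ∫ y in (0 : ℝ)..s, (Iic x).indicator F y =
      ∫ y in (0 : ℝ)..min x s, F y := fun s hs F => by
    rw [intervalIntegral.integral_of_le hs.1, intervalIntegral.integral_of_le (le_min hx.1 hs.1),
      integral_indicator measurableSet_Iic, Measure.restrict_restrict measurableSet_Iic,
      inter_comm, ← Ioc_inter_Iic]
    congr 2
    ext y; simp only [mem_inter_iff, mem_Ioc, mem_Iic]; tauto
  have h := integral_smul_primitive zero_le_one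
    (intervalIntegrable_of_integrableOn_Ioo hg h0 h1) hi
  have e : ∫ t in (0 : ℝ)..1, (∫ x in t..1, g x) • (Iic x).indicator (fun _ => (1 : ℝ)) t =
      quarterOp g x := by
    have := hind 1 h1 fun t => ∫ s in t..1, g s
    rw [min_eq_left hx.2] at this
    rw [quarterOp, ← this]
    refine intervalIntegral.integral_congr fun t _ => ?_
    by_cases ht : t ∈ Iic x <;> simp [indicator, ht]
  rw [← e, ← h]
  refine intervalIntegral.integral_congr fun t ht => ?_
  rw [uIcc_of_le zero_le_one] at ht
  rw [hind t ht]
  simp [mul_comm]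

/-- Both sides equal the integral of the product of the tails of `f` and `g`. -/
theorem integral_mul_quarterOp {f g : ℝ → ℝ} (hf : IntegrableOn f (Ioo 0 1))
    (hg : IntegrableOn g (Ioo 0 1)) :
    ∫ x in (0 : ℝ)..1, f x * quarterOp g x = ∫ x in (0 : ℝ)..1, quarterOp f x * g x := by
  have h0 : (0 : ℝ) ∈ Icc (0 : ℝ) 1 := left_mem_Icc.2 zero_le_one
  have h1 : (1 : ℝ) ∈ Icc (0 : ℝ) 1 := right_mem_Icc.2 zero_le_one
  have e : ∀ f g : ℝ → ℝ, IntegrableOn f (Ioo 0 1) → IntegrableOn g (Ioo 0 1) →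
      ∫ x in (0 : ℝ)..1, f x * quarterOp g x =
        ∫ x in (0 : ℝ)..1, (∫ t in x..1, f t) * ∫ t in x..1, g t := fun f g hf hg =>
    integral_smul_primitive zero_le_one (intervalIntegrable_of_integrableOn_Ioo hf h0 h1)
      (intervalIntegrable_of_integrableOn_Ioo (integrableOn_tail hg) h0 h1)
  rw [e f g hf hg]
  simp_rw [mul_comm (quarterOp f _)]
  rw [e g f hg hf]
  simp_rw [mul_comm]

theorem ofReal_intervalIntegral {F : ℝ → ℝ} (hF : IntegrableOn F (Ioo 0 1))
    (h0 : ∀ x ∈ Ioo (0 : ℝ) 1, 0 ≤ F x) :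
    ENNReal.ofReal (∫ x in (0 : ℝ)..1, F x) = ∫⁻ x in Ioo (0 : ℝ) 1, ENNReal.ofReal (F x) := by
  rw [intervalIntegral.integral_of_le zero_le_one, integral_Ioc_eq_integral_Ioo,
    ofReal_integral_eq_lintegral_ofReal hF]
  filter_upwards [ae_restrict_mem measurableSet_Ioo] with x hx using h0 x hx

theorem ofReal_quarterOp {g : ℝ → ℝ} (hg : IntegrableOn g (Ioo 0 1))
    (h0 : ∀ t ∈ Icc (0 : ℝ) 1, 0 ≤ g t) {x : ℝ} (hx : x ∈ Icc (0 : ℝ) 1) :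
    ENNReal.ofReal (quarterOp g x) =
      ∫⁻ t in Ioo (0 : ℝ) 1, ENNReal.ofReal (min x t) * ENNReal.ofReal (g t) := by
  rw [quarterOp_eq hg hx, ofReal_intervalIntegral (F := fun t => min x t * g t)
    (integrableOn_continuous_smul (κ := fun t => min x t) (by fun_prop) hg)]
  · refine setLIntegral_congr_fun measurableSet_Ioo fun t ht => ?_
    rw [ENNReal.ofReal_mul (le_min hx.1 ht.1.le)]
  · exact fun t ht => mul_nonneg (le_min hx.1 ht.1.le) (h0 t (Ioo_subset_Icc_self ht))

theorem quarterOp_nonneg {g : ℝ → ℝ} (h0 : ∀ t ∈ Icc (0 : ℝ) 1, 0 ≤ g t) {x : ℝ}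
    (hx : x ∈ Icc (0 : ℝ) 1) : 0 ≤ quarterOp g x := by
  refine intervalIntegral.integral_nonneg hx.1 fun y hy =>
    intervalIntegral.integral_nonneg (hy.2.trans hx.2) fun t ht => h0 t ⟨hy.1.trans ht.1, ht.2⟩

/-- The slope of `quarterOp g` is a tail of `g`, bounded by the total mass. This equicontinuity is
the source of compactness. -/
theorem abs_quarterOp_sub_le {g : ℝ → ℝ} (hg : IntegrableOn g (Ioo 0 1))
    (h0 : ∀ t ∈ Icc (0 : ℝ) 1, 0 ≤ g t) {x y : ℝ} (hx : x ∈ Icc (0 : ℝ) 1)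
    (hy : y ∈ Icc (0 : ℝ) 1) :
    |quarterOp g x - quarterOp g y| ≤ (∫ t in (0 : ℝ)..1, g t) * |x - y| := by
  have h0' : (0 : ℝ) ∈ Icc (0 : ℝ) 1 := left_mem_Icc.2 zero_le_one
  have h1 : (1 : ℝ) ∈ Icc (0 : ℝ) 1 := right_mem_Icc.2 zero_le_one
  have hti := fun z (hz : z ∈ Icc (0 : ℝ) 1) =>
    intervalIntegrable_of_integrableOn_Ioo (integrableOn_tail hg) h0' hz
  rw [quarterOp, quarterOp, intervalIntegral.integral_interval_sub_left (hti x hx) (hti y hy),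
    ← Real.norm_eq_abs]
  refine intervalIntegral.norm_integral_le_of_norm_le_const fun s hs => ?_
  have hs' : s ∈ Icc (0 : ℝ) 1 :=
    (convex_Icc (0 : ℝ) 1).ordConnected.uIcc_subset hy hx (uIoc_subset_uIcc hs)
  have hnn := intervalIntegral.integral_nonneg (μ := volume) hs'.2
    fun t ht => h0 t ⟨hs'.1.trans ht.1, ht.2⟩
  have hnn' := intervalIntegral.integral_nonneg (μ := volume) hs'.1
    fun t ht => h0 t ⟨ht.1, ht.2.trans hs'.2⟩
  have := intervalIntegral.integral_add_adjacent_intervals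
    (intervalIntegrable_of_integrableOn_Ioo hg h0' hs')
    (intervalIntegrable_of_integrableOn_Ioo hg hs' h1)
  rw [Real.norm_eq_abs, abs_of_nonneg hnn]
  linarith

theorem ofReal_integral_quarterOp_rpow {q : ℝ} (hq : 0 < q) {g : ℝ → ℝ}
    (hg : IntegrableOn g (Ioo 0 1)) (h0 : ∀ t ∈ Icc (0 : ℝ) 1, 0 ≤ g t) :
    ENNReal.ofReal (∫ x in (0 : ℝ)..1, quarterOp g x ^ q) =
      ∫⁻ x in Ioo (0 : ℝ) 1,
        (∫⁻ t in Ioo (0 : ℝ) 1, ENNReal.ofReal (min x t) * ENNReal.ofReal (g t)) ^ q := by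
  have hc := (continuousOn_quarterOp hg).rpow_const (p := q) fun _ _ => Or.inr hq.le
  rw [ofReal_intervalIntegral ((hc.integrableOn_compact isCompact_Icc).mono_set
    Ioo_subset_Icc_self) fun x hx =>
      Real.rpow_nonneg (quarterOp_nonneg h0 (Ioo_subset_Icc_self hx)) q]
  refine setLIntegral_congr_fun measurableSet_Ioo fun x hx => ?_
  rw [← ofReal_quarterOp hg h0 (Ioo_subset_Icc_self hx), ENNReal.ofReal_rpow_of_nonneg
    (quarterOp_nonneg h0 (Ioo_subset_Icc_self hx)) hq.le]

/-- The strict form of Young's inequality. -/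
theorem young_gap {q s t : ℝ} (hq : 1 < q) (hs : 0 ≤ s) (ht : 0 ≤ t) :
    s ^ (q - 1) * t ≤ (1 - 1 / q) * s ^ q + t ^ q / q ∧
      (s ^ (q - 1) * t = (1 - 1 / q) * s ^ q + t ^ q / q → t = s) := by
  have hq0 : 0 < q := by linarith
  rcases hs.eq_or_lt with rfl | hs
  · rw [Real.zero_rpow (by linarith), Real.zero_rpow hq0.ne', zero_mul, mul_zero, zero_add]
    refine ⟨by positivity, fun h => ?_⟩
    have : t ^ q = 0 := by
      have := (div_eq_zero_iff.1 h.symm)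
      rcases this with h | h
      · exact h
      · linarith
    exact (Real.rpow_eq_zero ht hq0.ne').1 this
  have hsq : s ^ q = s ^ (q - 1) * s := by
    rw [← Real.rpow_add_one hs.ne']; congr 1; ring
  have hpos : 0 < s ^ (q - 1) := Real.rpow_pos_of_pos hs _
  have htq : t ^ q = s ^ (q - 1) * s * (1 + (t / s - 1)) ^ q := by
    rw [← hsq, ← Real.mul_rpow hs.le (by
      have : 0 ≤ t / s := by positivity
      linarith)]
    congr 1; field_simp; ring
  -- The defect in Young's inequality is `s^q / q` times the defect in Bernoulli's inequality at
  -- `t/s - 1`, which also settles the equality case.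
  have hgap : (1 - 1 / q) * s ^ q + t ^ q / q - s ^ (q - 1) * t =
      s ^ (q - 1) * s / q * ((1 + (t / s - 1)) ^ q - (1 + q * (t / s - 1))) := by
    rw [htq, hsq]; field_simp; ring
  have hm1 : -1 ≤ t / s - 1 := by
    have : 0 ≤ t / s := by positivity
    linarith
  have hc : 0 < s ^ (q - 1) * s / q := by positivity
  refine ⟨?_, fun h => ?_⟩
  · have := one_add_mul_self_le_rpow_one_add hm1 hq.le
    have := mul_nonneg hc.le (sub_nonneg.2 this)
    linarith
  · by_contra hne
    have hne' : t / s - 1 ≠ 0 := fun h' => hne (by field_simp at h'; linarith)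
    have := one_add_mul_self_lt_rpow_one_add hm1 hne' hq
    have := mul_pos hc (sub_pos.2 this)
    linarith

/-! ### Extremal functions of the quarter-wave operator -/

section extremal

variable {𝕜 : Type} [RCLike 𝕜] {p : ℝ≥0∞}

/-- If `u` nearly attains `B`, the symmetrization of `|u''|`, normalized in `L^q`, nearly attains
`4B` for the kernel `min`. Taking the modulus costs nothing because the kernel is positive. -/
theorem exists_near_extremal [Fact (1 ≤ p)] (hp1 : 1 < p) (hp : p ≠ ⊤) {r : ℝ≥0∞}
    (hr : r < interpConst 𝕜 p 0 1) :
    ∃ g : ℝ → ℝ, Measurable g ∧ (∀ t, 0 ≤ g t) ∧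
      ∫⁻ t in Ioo (0 : ℝ) 1, ENNReal.ofReal (g t) ^ p.toReal = 1 ∧
      (4 * r) ^ p.toReal ≤ ∫⁻ x in Ioo (0 : ℝ) 1,
        (∫⁻ t in Ioo (0 : ℝ) 1, ENNReal.ofReal (min x t) * ENNReal.ofReal (g t)) ^ p.toReal := by
  have hp0 : p ≠ 0 := (zero_lt_one.trans hp1).ne'
  have hq1 : 1 < p.toReal := by
    rw [← ENNReal.toReal_one]; exact (ENNReal.toReal_lt_toReal (by simp) hp).2 hp1
  set q := p.toReal with hqdef
  have hq : 0 < q := by linarith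
  obtain ⟨_, ⟨u, u₁, u₂, hu, hne, rfl⟩, hlt⟩ := lt_sSup_iff.1 hr
  have hm := hu.memLp_two.1
  set v := hm.mk u₂ with hv
  have hvm : Measurable v := hm.stronglyMeasurable_mk.measurable
  have hae : u₂ =ᵐ[volume.restrict (Ioo 0 1)] v := hm.ae_eq_mk
  set k : ℝ → ℝ≥0∞ := fun t => ‖v t‖ₑ with hk
  have hkm : Measurable k := hvm.enorm
  have hn : eLpNorm u₂ p (volume.restrict (Ioo 0 1)) ^ q = ∫⁻ t in Ioo (0 : ℝ) 1, k t ^ q := by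
    rw [eLpNorm_congr_ae hae, eLpNorm_eq_lintegral_rpow_enorm_toReal hp0 hp, ← ENNReal.rpow_mul,
      ← hqdef, one_div_mul_cancel hq.ne', ENNReal.rpow_one]
  have hn0 : eLpNorm u₂ p (volume.restrict (Ioo 0 1)) ≠ 0 := by
    rwa [Ne, eLpNorm_eq_zero_iff hm hp0]
  have hnt := hu.memLp_two.2.ne
  have hG : r ^ q * ∫⁻ t in Ioo (0 : ℝ) 1, k t ^ q ≤ ∫⁻ x in Ioo (0 : ℝ) 1,
      (∫⁻ t in Ioo (0 : ℝ) 1, ENNReal.ofReal (green x t) * k t) ^ q := by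
    have h1 := ((ENNReal.lt_div_iff_mul_lt (Or.inl hn0) (Or.inl hnt)).1 hlt).le
    have h2 := ENNReal.rpow_le_rpow h1 hq.le
    rw [ENNReal.mul_rpow_of_nonneg _ _ hq.le, hn, eLpNorm_eq_lintegral_rpow_enorm_toReal hp0 hp,
      ← ENNReal.rpow_mul, ← hqdef, one_div_mul_cancel hq.ne', ENNReal.rpow_one] at h2
    refine h2.trans (setLIntegral_mono' measurableSet_Ioo fun x hx => ?_)
    refine ENNReal.rpow_le_rpow ((hu.enorm_sub_le (Ioo_subset_Icc_self hx)).trans_eq ?_) hq.le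
    refine lintegral_congr_ae ?_
    filter_upwards [hae] with t ht
    simp only [hk, ht]
  obtain ⟨k', hk'm, hk'1, hk'2⟩ := exists_symmetrization hq1 hkm
  set J := ∫⁻ t in Ioo (0 : ℝ) 1, k' t ^ q with hJ
  have hJ0 : J ≠ 0 := by
    rw [hk'1, ← hn]
    simp [ENNReal.rpow_eq_zero_iff, hn0, hnt]
  have hJt : J ≠ ⊤ := by
    rw [hk'1, ← hn]
    exact ENNReal.mul_ne_top (by simp) (ENNReal.rpow_ne_top_of_nonneg hq.le hnt)
  set N := J ^ (1 / q) with hN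
  have hNq : N ^ q = J := by
    rw [hN, ← ENNReal.rpow_mul, one_div_mul_cancel hq.ne', ENNReal.rpow_one]
  have hN0 : N ≠ 0 := fun h => hJ0 (by rw [← hNq, h, ENNReal.zero_rpow_of_pos hq])
  have hNt : N ≠ ⊤ := fun h => hJt (by rw [← hNq, h, ENNReal.top_rpow_of_pos hq])
  have hfin : ∀ᵐ t ∂volume.restrict (Ioo (0 : ℝ) 1), k' t < ⊤ := by
    filter_upwards [ae_lt_top (hk'm.pow_const _) hJt] with t ht
    by_contra h
    rw [not_lt_top_iff.1 h, ENNReal.top_rpow_of_pos hq] at ht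
    exact ht.false
  have hg : ∀ᵐ t ∂volume.restrict (Ioo (0 : ℝ) 1),
      ENNReal.ofReal (N⁻¹ * k' t).toReal = N⁻¹ * k' t := by
    filter_upwards [hfin] with t ht
    exact ENNReal.ofReal_toReal (ENNReal.mul_ne_top (ENNReal.inv_ne_top.2 hN0) ht.ne)
  have hNinv : N⁻¹ ^ q * J = 1 := by
    rw [ENNReal.inv_rpow, hNq, ENNReal.inv_mul_cancel hJ0 hJt]
  have hNit : N⁻¹ ^ q ≠ ⊤ :=
    ENNReal.rpow_ne_top_of_nonneg hq.le (ENNReal.inv_ne_top.2 hN0)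
  refine ⟨fun t => (N⁻¹ * k' t).toReal, (hk'm.const_mul _).ennreal_toReal,
    fun t => ENNReal.toReal_nonneg, ?_, ?_⟩
  · rw [← hNinv, hJ, ← lintegral_const_mul' _ _ hNit]
    refine lintegral_congr_ae ?_
    filter_upwards [hg] with t ht
    rw [ht, ENNReal.mul_rpow_of_nonneg _ _ hq.le]
  · have e : ∀ x, ∫⁻ t in Ioo (0 : ℝ) 1, ENNReal.ofReal (min x t) *
        ENNReal.ofReal (N⁻¹ * k' t).toReal =
        N⁻¹ * ∫⁻ t in Ioo (0 : ℝ) 1, ENNReal.ofReal (min x t) * k' t := fun x => by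
      rw [← lintegral_const_mul' _ _ (ENNReal.inv_ne_top.2 hN0)]
      refine lintegral_congr_ae ?_
      filter_upwards [hg] with t ht
      rw [ht]; ring
    simp_rw [e, ENNReal.mul_rpow_of_nonneg _ _ hq.le]
    rw [lintegral_const_mul' _ _ hNit]
    calc (4 : ℝ≥0∞) ^ q * r ^ q = N⁻¹ ^ q * (2 * (4 ^ q * (r ^ q * ∫⁻ t in Ioo (0 : ℝ) 1, k t ^ q))) := by
          rw [← mul_one (4 ^ q * r ^ q), ← hNinv, hk'1]; ring
      _ ≤ N⁻¹ ^ q * (2 * (4 ^ q * ∫⁻ x in Ioo (0 : ℝ) 1,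
          (∫⁻ t in Ioo (0 : ℝ) 1, ENNReal.ofReal (green x t) * k t) ^ q)) := by gcongr
      _ ≤ _ := by gcongr

theorem facts_of_lintegral_rpow_eq_one {q : ℝ} (hq : 1 < q) {g : ℝ → ℝ} (hg : Measurable g)
    (h0 : ∀ t, 0 ≤ g t) (h1 : ∫⁻ t in Ioo (0 : ℝ) 1, ENNReal.ofReal (g t) ^ q = 1) :
    IntegrableOn g (Ioo 0 1) ∧ IntegrableOn (fun t => g t ^ q) (Ioo 0 1) ∧
      ∫ t in (0 : ℝ)..1, g t ≤ 1 ∧ ∫ t in (0 : ℝ)..1, g t ^ q = 1 := by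
  have hq0 : 0 < q := by linarith
  have hgq : ∀ t, 0 ≤ g t ^ q := fun t => Real.rpow_nonneg (h0 t) q
  have h1' : ∫⁻ t in Ioo (0 : ℝ) 1, ENNReal.ofReal (g t ^ q) = 1 := by
    rw [← h1]
    exact lintegral_congr fun t => (ENNReal.ofReal_rpow_of_nonneg (h0 t) hq0.le).symm
  have hi : IntegrableOn (fun t => g t ^ q) (Ioo 0 1) := by
    refine ⟨(hg.pow_const q).aestronglyMeasurable, ?_⟩
    rw [hasFiniteIntegral_iff_ofReal (Eventually.of_forall hgq), h1']
    exact ENNReal.one_lt_top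
  -- Young's inequality with `s = 1`; integrated, it gives `∫ g ≤ 1`.
  have hy : ∀ t, g t ≤ (1 - 1 / q) + g t ^ q / q := fun t => by
    simpa using (young_gap hq zero_le_one (h0 t)).1
  have hi2 : IntegrableOn (fun t => (1 - 1 / q) + g t ^ q / q) (Ioo 0 1) :=
    (integrableOn_const (by simp)).add (hi.div_const q)
  have hi1 : IntegrableOn g (Ioo 0 1) := by
    refine hi2.mono' hg.aestronglyMeasurable (Eventually.of_forall fun t => ?_)
    rw [Real.norm_eq_abs, abs_of_nonneg (h0 t)]
    exact hy t
  have hone : ∫ t in (0 : ℝ)..1, g t ^ q = 1 := by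
    have := ofReal_intervalIntegral hi fun x _ => hgq x
    rw [h1'] at this
    simpa using this
  have hII : ∀ {F : ℝ → ℝ}, IntegrableOn F (Ioo 0 1) → IntervalIntegrable F volume 0 1 := fun hF =>
    intervalIntegrable_of_integrableOn_Ioo hF (left_mem_Icc.2 zero_le_one)
      (right_mem_Icc.2 zero_le_one)
  refine ⟨hi1, hi, ?_, hone⟩
  have := intervalIntegral.integral_mono_on zero_le_one (hII hi1) (hII hi2) fun t _ => hy t
  rw [intervalIntegral.integral_add intervalIntegrable_const ((hII hi).div_const q),
    intervalIntegral.integral_div, hone, intervalIntegral.integral_const] at this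
  simpa using this

theorem integral_quarterOp_rpow_le [Fact (1 ≤ p)] (hp : p ≠ ⊤) {g : ℝ → ℝ} (hgm : Measurable g)
    (hg : IntegrableOn g (Ioo 0 1)) (hgq : IntegrableOn (fun t => g t ^ p.toReal) (Ioo 0 1))
    (h0 : ∀ t, 0 ≤ g t) :
    ∫ x in (0 : ℝ)..1, quarterOp g x ^ p.toReal ≤
      (4 * (interpConst 𝕜 p 0 1).toReal) ^ p.toReal * ∫ t in (0 : ℝ)..1, g t ^ p.toReal := by
  have hq : 0 < p.toReal := ENNReal.toReal_pos (zero_lt_one.trans_le Fact.out).ne' hp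
  have hnn : 0 ≤ ∫ t in (0 : ℝ)..1, g t ^ p.toReal :=
    intervalIntegral.integral_nonneg zero_le_one fun t _ => Real.rpow_nonneg (h0 t) _
  have h := lintegral_min_rpow_le (𝕜 := 𝕜) hp (k := fun t => ENNReal.ofReal (g t)) hgm.ennreal_ofReal
  rw [← ofReal_integral_quarterOp_rpow hq hg fun t _ => h0 t] at h
  have e : ∫⁻ t in Ioo (0 : ℝ) 1, ENNReal.ofReal (g t) ^ p.toReal =
      ENNReal.ofReal (∫ t in (0 : ℝ)..1, g t ^ p.toReal) := by
    rw [ofReal_intervalIntegral hgq fun x _ => Real.rpow_nonneg (h0 x) _]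
    exact lintegral_congr fun t => ENNReal.ofReal_rpow_of_nonneg (h0 t) hq.le
  have e2 : (4 * interpConst 𝕜 p 0 1 : ℝ≥0∞) =
      ENNReal.ofReal (4 * (interpConst 𝕜 p 0 1).toReal) := by
    rw [ENNReal.ofReal_mul (by norm_num), ENNReal.ofReal_ofNat,
      ENNReal.ofReal_toReal interpConst_ne_top]
  rw [e, e2, ENNReal.ofReal_rpow_of_nonneg (by positivity) hq.le,
    ← ENNReal.ofReal_mul (by positivity)] at h
  exact (ENNReal.ofReal_le_ofReal_iff (by positivity)).1 h

/-- Compactness of the quarter-wave operator, in the form of pointwise convergence. -/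
theorem exists_tendsto_quarterOp {g : ℕ → ℝ → ℝ} (hg : ∀ m, IntegrableOn (g m) (Ioo 0 1))
    (h0 : ∀ m t, 0 ≤ g m t) (h1 : ∀ m, ∫ t in (0 : ℝ)..1, g m t ≤ 1) :
    ∃ (φ : ℝ → ℝ) (ns : ℕ → ℕ), Continuous φ ∧ (∀ x, 0 ≤ φ x) ∧ StrictMono ns ∧
      (∀ m, ∀ x ∈ Icc (0 : ℝ) 1, quarterOp (g m) x ≤ 1) ∧
      ∀ x ∈ Icc (0 : ℝ) 1, Tendsto (fun m => quarterOp (g (ns m)) x) atTop (𝓝 (φ x)) := by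
  have hlip : ∀ m, ∀ x ∈ Icc (0 : ℝ) 1, ∀ y ∈ Icc (0 : ℝ) 1,
      |quarterOp (g m) x - quarterOp (g m) y| ≤ |x - y| := fun m x hx y hy =>
    (abs_quarterOp_sub_le (hg m) (fun t _ => h0 m t) hx hy).trans
      (mul_le_of_le_one_left (abs_nonneg _) (h1 m))
  have hz : ∀ m, quarterOp (g m) 0 = 0 := fun m => by simp [quarterOp]
  have hnn : ∀ m, ∀ x ∈ Icc (0 : ℝ) 1, 0 ≤ quarterOp (g m) x := fun m x hx =>
    quarterOp_nonneg (fun t _ => h0 m t) hx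
  have hle : ∀ m, ∀ x ∈ Icc (0 : ℝ) 1, quarterOp (g m) x ≤ 1 := fun m x hx => by
    have := hlip m x hx 0 (left_mem_Icc.2 zero_le_one)
    rw [hz, sub_zero, sub_zero, abs_of_nonneg hx.1] at this
    exact (le_abs_self _).trans (this.trans hx.2)
  let A : Set (BoundedContinuousFunction (Icc (0 : ℝ) 1) ℝ) :=
    {F | ∀ x y, F x ∈ Icc (0 : ℝ) 1 ∧ |F x - F y| ≤ |(x : ℝ) - y|}
  have hev : ∀ x : Icc (0 : ℝ) 1,
      Continuous fun F : BoundedContinuousFunction (Icc (0 : ℝ) 1) ℝ => F x := fun x =>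
    (continuous_apply x).comp BoundedContinuousFunction.continuous_coe
  have hclosed : IsClosed A := by
    simp only [A, ofPred_forall]
    refine isClosed_iInter fun x => isClosed_iInter fun y => ?_
    refine IsClosed.inter (isClosed_Icc.preimage (hev x)) ?_
    exact isClosed_le ((hev x).sub (hev y)).abs continuous_const
  have hcomp : IsCompact A := by
    refine BoundedContinuousFunction.arzela_ascoli₂ (Icc 0 1) isCompact_Icc A hclosed
      (fun F x hF => (hF x x).1) ?_
    refine (LipschitzWith.uniformEquicontinuous _ 1 fun F => ?_).equicontinuous
    refine LipschitzWith.of_dist_le_mul fun x y => ?_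
    rw [NNReal.coe_one, one_mul]
    exact (F.2 x y).2
  let Φ : ℕ → BoundedContinuousFunction (Icc (0 : ℝ) 1) ℝ := fun m =>
    BoundedContinuousFunction.mkOfCompact
      ⟨fun x : Icc (0 : ℝ) 1 => quarterOp (g m) x,
        (continuousOn_iff_continuous_domRestrict.1 (continuousOn_quarterOp (hg m)))⟩
  have hΦ : ∀ m, Φ m ∈ A := fun m x y =>
    ⟨⟨hnn m x x.2, hle m x x.2⟩, hlip m x x.2 y y.2⟩
  obtain ⟨F, hF, ns, hns, hlim⟩ := hcomp.tendsto_subseq hΦ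
  refine ⟨fun x => F (projIcc 0 1 zero_le_one x), ns, F.continuous.comp continuous_projIcc,
    fun x => (hF _ (projIcc 0 1 zero_le_one x)).1.1, hns, hle, fun x hx => ?_⟩
  simp only
  rw [projIcc_of_mem zero_le_one hx]
  exact ((hev ⟨x, hx⟩).tendsto F).comp hlim

/-- Existence of an extremal function: `φ = quarterOp k` satisfies the Euler equation. -/
theorem exists_extremal (𝕜 : Type) [RCLike 𝕜] [Fact (1 ≤ p)] (hp1 : 1 < p) (hp : p ≠ ⊤) :
    ∃ k : ℝ → ℝ, Continuous k ∧ (∀ x, 0 ≤ k x) ∧ k 0 = 0 ∧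
      ∫ x in (0 : ℝ)..1, k x ^ p.toReal = 1 ∧
      ∀ x ∈ Icc (0 : ℝ) 1, quarterOp (fun t => quarterOp k t ^ (p.toReal - 1)) x =
        (4 * (interpConst 𝕜 p 0 1).toReal) ^ p.toReal * k x ^ (p.toReal - 1) := by
  have hq1 : 1 < p.toReal := by
    rw [← ENNReal.toReal_one]; exact (ENNReal.toReal_lt_toReal (by simp) hp).2 hp1
  set q := p.toReal with hqdef
  have hq : 0 < q := by linarith
  have hBt : interpConst 𝕜 p 0 1 ≠ ⊤ := interpConst_ne_top
  have hB : 0 < (interpConst 𝕜 p 0 1).toReal := ENNReal.toReal_pos interpConst_pos hBt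
  set B := (interpConst 𝕜 p 0 1).toReal with hBdef
  set Λ := 4 * B with hΛ
  have hΛ0 : 0 < Λ := by positivity
  have hΛq : 0 < Λ ^ q := Real.rpow_pos_of_pos hΛ0 q
  have h0I : (0 : ℝ) ∈ Icc (0 : ℝ) 1 := left_mem_Icc.2 zero_le_one
  have h1I : (1 : ℝ) ∈ Icc (0 : ℝ) 1 := right_mem_Icc.2 zero_le_one
  have hII : ∀ {F : ℝ → ℝ}, IntegrableOn F (Ioo 0 1) → IntervalIntegrable F volume 0 1 := fun hF =>
    intervalIntegrable_of_integrableOn_Ioo hF h0I h1I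
  have hCO : ∀ {F : ℝ → ℝ}, ContinuousOn F (Icc 0 1) → IntegrableOn F (Ioo 0 1) := fun hF =>
    (hF.integrableOn_compact isCompact_Icc).mono_set Ioo_subset_Icc_self
  -- a maximizing sequence
  have hseq : ∀ m : ℕ, ∃ g : ℝ → ℝ, Measurable g ∧ (∀ t, 0 ≤ g t) ∧
      ∫⁻ t in Ioo (0 : ℝ) 1, ENNReal.ofReal (g t) ^ q = 1 ∧
      (Λ * (1 - 1 / ((m : ℝ) + 2))) ^ q ≤ ∫ x in (0 : ℝ)..1, quarterOp g x ^ q := by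
    intro m
    have hm : (0 : ℝ) < 1 - 1 / ((m : ℝ) + 2) := by
      rw [sub_pos, div_lt_one (by positivity)]
      have : (0 : ℝ) ≤ m := by positivity
      linarith
    have hm' : (0 : ℝ) < 1 / ((m : ℝ) + 2) := by positivity
    obtain ⟨g, h1, h2, h3, h4⟩ := exists_near_extremal (𝕜 := 𝕜) hp1 hp
      (r := ENNReal.ofReal (B * (1 - 1 / ((m : ℝ) + 2)))) (by
        rw [ENNReal.ofReal_lt_iff_lt_toReal (by positivity) hBt]
        exact mul_lt_of_lt_one_right hB (by linarith))
    refine ⟨g, h1, h2, h3, ?_⟩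
    rw [← hqdef, ← ofReal_integral_quarterOp_rpow hq
      (facts_of_lintegral_rpow_eq_one hq1 h1 h2 h3).1 fun t _ => h2 t, ← ENNReal.ofReal_ofNat,
      ← ENNReal.ofReal_mul (by norm_num), ENNReal.ofReal_rpow_of_nonneg (by positivity) hq.le,
      ← mul_assoc, ← hΛ, ENNReal.ofReal_le_ofReal_iff] at h4
    · exact h4
    · refine intervalIntegral.integral_nonneg zero_le_one fun x hx => ?_
      exact Real.rpow_nonneg (quarterOp_nonneg (fun t _ => h2 t) hx) q
  choose g hgm hg0 hgn hgl using hseq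
  have hfacts := fun m => facts_of_lintegral_rpow_eq_one hq1 (hgm m) (hg0 m) (hgn m)
  obtain ⟨φ, ns, hφc, hφ0, hns, hle, hlim⟩ := exists_tendsto_quarterOp (fun m => (hfacts m).1) hg0
    fun m => (hfacts m).2.2.1
  have hSnn : ∀ m, ∀ x ∈ Icc (0 : ℝ) 1, 0 ≤ quarterOp (g m) x := fun m x hx =>
    quarterOp_nonneg (fun t _ => hg0 m t) hx
  -- limits of integrals
  have hφq : Tendsto (fun m => ∫ x in (0 : ℝ)..1, quarterOp (g (ns m)) x ^ q) atTop
      (𝓝 (∫ x in (0 : ℝ)..1, φ x ^ q)) := by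
    refine intervalIntegral.tendsto_integral_filter_of_dominated_convergence (fun _ => 1)
      (Eventually.of_forall fun m => ?_) (Eventually.of_forall fun m => ?_)
      intervalIntegrable_const ?_
    · rw [uIoc_of_le zero_le_one]
      exact (((continuousOn_quarterOp (hfacts (ns m)).1).rpow_const fun _ _ =>
        Or.inr hq.le).mono Ioc_subset_Icc_self).aestronglyMeasurable measurableSet_Ioc
    · refine Eventually.of_forall fun x hx => ?_
      rw [uIoc_of_le zero_le_one] at hx
      have hx' := Ioc_subset_Icc_self hx
      rw [Real.norm_eq_abs, abs_of_nonneg (Real.rpow_nonneg (hSnn _ x hx') q)]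
      exact Real.rpow_le_one (hSnn _ x hx') (hle _ x hx') hq.le
    · refine Eventually.of_forall fun x hx => ?_
      rw [uIoc_of_le zero_le_one] at hx
      exact (hlim x (Ioc_subset_Icc_self hx)).rpow_const (Or.inr hq.le)
  have hφcr : Continuous fun x => φ x ^ (q - 1) :=
    hφc.rpow_const fun _ => Or.inr (by linarith)
  have hφr : Tendsto (fun m => ∫ x in (0 : ℝ)..1, φ x ^ (q - 1) * quarterOp (g (ns m)) x) atTop
      (𝓝 (∫ x in (0 : ℝ)..1, φ x ^ q)) := by
    have e : ∀ x, φ x ^ q = φ x ^ (q - 1) * φ x := fun x => by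
      rw [← Real.rpow_add_one' (hφ0 x) (by linarith)]; congr 1; ring
    simp_rw [e]
    refine intervalIntegral.tendsto_integral_filter_of_dominated_convergence
      (fun x => φ x ^ (q - 1)) (Eventually.of_forall fun m => ?_)
      (Eventually.of_forall fun m => ?_) (hφcr.intervalIntegrable _ _) ?_
    · rw [uIoc_of_le zero_le_one]
      exact ((hφcr.continuousOn.mul (continuousOn_quarterOp (hfacts (ns m)).1)).mono
        Ioc_subset_Icc_self).aestronglyMeasurable measurableSet_Ioc
    · refine Eventually.of_forall fun x hx => ?_
      rw [uIoc_of_le zero_le_one] at hx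
      have hx' := Ioc_subset_Icc_self hx
      have hp0 := Real.rpow_nonneg (hφ0 x) (q - 1)
      rw [Real.norm_eq_abs, abs_of_nonneg (mul_nonneg hp0 (hSnn _ x hx'))]
      exact mul_le_of_le_one_right hp0 (hle _ x hx')
    · refine Eventually.of_forall fun x hx => ?_
      rw [uIoc_of_le zero_le_one] at hx
      exact (hlim x (Ioc_subset_Icc_self hx)).const_mul _
  have hΦle : ∫ x in (0 : ℝ)..1, φ x ^ q ≤ Λ ^ q := by
    refine le_of_tendsto hφq (Eventually.of_forall fun m => ?_)
    have := integral_quarterOp_rpow_le (𝕜 := 𝕜) hp (hgm (ns m)) (hfacts (ns m)).1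
      (hfacts (ns m)).2.1 (hg0 (ns m))
    rwa [← hqdef, (hfacts (ns m)).2.2.2, mul_one] at this
  have hΦge : Λ ^ q ≤ ∫ x in (0 : ℝ)..1, φ x ^ q := by
    have h1 : Tendsto (fun m : ℕ => (Λ * (1 - 1 / ((m : ℝ) + 2))) ^ q) atTop (𝓝 (Λ ^ q)) := by
      have h2 : Tendsto (fun m : ℕ => 1 / ((m : ℝ) + 2)) atTop (𝓝 0) := by
        simp_rw [one_div]
        exact tendsto_inv_atTop_zero.comp
          (tendsto_atTop_add_const_right _ _ tendsto_natCast_atTop_atTop)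
      have h3 := (tendsto_const_nhds (x := Λ)).mul ((tendsto_const_nhds (x := (1 : ℝ))).sub h2)
      rw [sub_zero, mul_one] at h3
      exact h3.rpow_const (Or.inr hq.le)
    exact le_of_tendsto_of_tendsto' (h1.comp hns.tendsto_atTop) hφq fun m => hgl (ns m)
  -- the extremal
  set w := quarterOp fun t => φ t ^ (q - 1) with hw
  have hφi : IntegrableOn (fun t => φ t ^ (q - 1)) (Ioo 0 1) := hCO hφcr.continuousOn
  have hw0 : ∀ x ∈ Icc (0 : ℝ) 1, 0 ≤ w x := fun x hx =>
    quarterOp_nonneg (fun t _ => Real.rpow_nonneg (hφ0 t) _) hx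
  have htc : Continuous fun y => ∫ t in y..1, φ t ^ (q - 1) := by
    have := intervalIntegral.continuous_primitive
      (fun a b => hφcr.intervalIntegrable (μ := volume) a b) 1
    simp_rw [fun y => intervalIntegral.integral_symm (μ := volume)
      (f := fun t => φ t ^ (q - 1)) 1 y]
    exact this.neg
  have hwc : Continuous w := intervalIntegral.continuous_primitive
    (fun a b => htc.intervalIntegrable a b) 0
  -- The Euler equation forces this formula for the extremal once the limit `φ` of the images is
  -- known, so no weak limit of the sequence is taken. It remains to see that `k` has norm one and
  -- that `quarterOp k = φ` on `[0, 1]`.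
  set k : ℝ → ℝ := fun x => (max (w x) 0 / Λ ^ q) ^ (1 / (q - 1)) with hk
  have hq10 : 0 < q - 1 := by linarith
  have hbase : ∀ x, 0 ≤ max (w x) 0 / Λ ^ q := fun x => div_nonneg (le_max_right _ _) hΛq.le
  have hkc : Continuous k := ((hwc.max continuous_const).div_const _).rpow_const fun _ =>
    Or.inr (by positivity)
  have hk0 : ∀ x, 0 ≤ k x := fun x => Real.rpow_nonneg (hbase x) _
  have hkw : ∀ x ∈ Icc (0 : ℝ) 1, Λ ^ q * k x ^ (q - 1) = w x := fun x hx => by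
    simp only [hk]
    rw [← Real.rpow_mul (hbase x), one_div_mul_cancel hq10.ne', Real.rpow_one,
      max_eq_left (hw0 x hx), mul_div_cancel₀ _ hΛq.ne']
  have hkz : k 0 = 0 := by
    have : w 0 = 0 := by simp [hw, quarterOp]
    simp only [hk, this, max_self, zero_div]
    exact Real.zero_rpow (by positivity)
  have hki : IntegrableOn k (Ioo 0 1) := hCO hkc.continuousOn
  have hkq : Continuous fun x => k x ^ q := hkc.rpow_const fun _ => Or.inr hq.le
  have hkqi := hkq.intervalIntegrable (μ := volume) 0 1
  have hSk0 : ∀ x ∈ Icc (0 : ℝ) 1, 0 ≤ quarterOp k x := fun x hx =>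
    quarterOp_nonneg (fun t _ => hk0 t) hx
  have hSkc := continuousOn_quarterOp hki
  set κ := ∫ x in (0 : ℝ)..1, k x ^ q with hκ
  -- By self-adjointness the pairing of `φ^(q-1)` with the images of `g m` is `Λ^q ∫ k^(q-1) g m`.
  -- Young's inequality bounds it, and its limit is `∫ φ^q = Λ^q`.
  have hκ1 : 1 ≤ κ := by
    have hpt : ∀ m, (Λ ^ q)⁻¹ * ∫ x in (0 : ℝ)..1, φ x ^ (q - 1) * quarterOp (g m) x ≤
        (1 - 1 / q) * κ + 1 / q := by
      intro m
      rw [integral_mul_quarterOp hφi (hfacts m).1, ← intervalIntegral.integral_const_mul]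
      have hi1 : IntegrableOn (fun x => (Λ ^ q)⁻¹ * (w x * g m x)) (Ioo 0 1) :=
        (integrableOn_continuous_smul (𝕜 := ℝ) hwc (hfacts m).1).const_mul _
      have hi2 := (hkqi.const_mul (1 - 1 / q)).add ((hII (hfacts m).2.1).div_const q)
      refine (intervalIntegral.integral_mono_on zero_le_one (hII hi1) hi2 fun x hx => ?_).trans_eq ?_
      · rw [← hkw x hx]
        have := (young_gap hq1 (hk0 x) (hg0 m x)).1
        have e : (Λ ^ q)⁻¹ * (Λ ^ q * k x ^ (q - 1) * g m x) = k x ^ (q - 1) * g m x := by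
          field_simp
        rw [e]; exact this
      · rw [intervalIntegral.integral_add (hkqi.const_mul _) ((hII (hfacts m).2.1).div_const q),
          intervalIntegral.integral_const_mul, intervalIntegral.integral_div, (hfacts m).2.2.2]
    have hl := le_of_tendsto (hφr.const_mul (Λ ^ q)⁻¹) (Eventually.of_forall fun m => hpt (ns m))
    have h1 : 1 ≤ (Λ ^ q)⁻¹ * ∫ x in (0 : ℝ)..1, φ x ^ q := by
      refine (inv_mul_cancel₀ hΛq.ne').symm.le.trans ?_
      exact mul_le_mul_of_nonneg_left hΦge (by positivity)
    have h2 : 1 ≤ (1 - 1 / q) * κ + 1 / q := h1.trans hl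
    have h3 : 0 < 1 - 1 / q := by rw [sub_pos, div_lt_one hq]; exact hq1
    nlinarith
  have hpair : ∫ x in (0 : ℝ)..1, φ x ^ (q - 1) * quarterOp k x = Λ ^ q * κ := by
    rw [integral_mul_quarterOp hφi hki, hκ, ← intervalIntegral.integral_const_mul]
    refine intervalIntegral.integral_congr fun x hx => ?_
    rw [uIcc_of_le zero_le_one] at hx
    rw [← hw, ← hkw x hx, mul_assoc, ← Real.rpow_add_one' (hk0 x) (by linarith)]
    congr 2; ring
  have hSkq : ∫ x in (0 : ℝ)..1, quarterOp k x ^ q ≤ Λ ^ q * κ :=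
    integral_quarterOp_rpow_le (𝕜 := 𝕜) hp hkc.measurable hki (hCO hkq.continuousOn) hk0
  have hφqi := (hφc.rpow_const (fun _ => Or.inr hq.le) : Continuous fun x => φ x ^ q).intervalIntegrable
    (μ := volume) 0 1
  have hSkqc : ContinuousOn (fun x => quarterOp k x ^ q) (Icc 0 1) :=
    hSkc.rpow_const fun _ _ => Or.inr hq.le
  have hSkqi := hII (hCO hSkqc)
  have hmixc : ContinuousOn (fun x => φ x ^ (q - 1) * quarterOp k x) (Icc 0 1) :=
    hφcr.continuousOn.mul hSkc
  -- The integrated Young defect of `φ` and `quarterOp k` is nonnegative and at most a positive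
  -- multiple of `1 - κ`. With `κ ≥ 1` this forces `κ = 1` and a vanishing defect, hence `quarterOp
  -- k = φ` by the equality case.
  have hgap : ∫ x in (0 : ℝ)..1, ((1 - 1 / q) * φ x ^ q + quarterOp k x ^ q / q -
      φ x ^ (q - 1) * quarterOp k x) ≤ (1 - 1 / q) * (Λ ^ q * (1 - κ)) := by
    rw [intervalIntegral.integral_sub ((hφqi.const_mul _).add (hSkqi.div_const q)) (hII (hCO hmixc)),
      intervalIntegral.integral_add (hφqi.const_mul _) (hSkqi.div_const q),
      intervalIntegral.integral_const_mul, intervalIntegral.integral_div, hpair]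
    have h3 : 0 < 1 - 1 / q := by rw [sub_pos, div_lt_one hq]; exact hq1
    have h4 := mul_le_mul_of_nonneg_left hΦle h3.le
    have h5 : (∫ x in (0 : ℝ)..1, quarterOp k x ^ q) / q ≤ Λ ^ q * κ / q := by gcongr
    have e : (1 - 1 / q) * (Λ ^ q * (1 - κ)) =
        (1 - 1 / q) * Λ ^ q + Λ ^ q * κ / q - Λ ^ q * κ := by field_simp; ring
    rw [e]; linarith
  have hgapnn : ∀ x ∈ Icc (0 : ℝ) 1, 0 ≤ (1 - 1 / q) * φ x ^ q + quarterOp k x ^ q / q -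
      φ x ^ (q - 1) * quarterOp k x := fun x hx =>
    sub_nonneg.2 (young_gap hq1 (hφ0 x) (hSk0 x hx)).1
  have hint0 := intervalIntegral.integral_nonneg (μ := volume) zero_le_one hgapnn
  have hκ2 : κ = 1 := by
    have h3 : 0 < 1 - 1 / q := by rw [sub_pos, div_lt_one hq]; exact hq1
    have h4 : 0 < (1 - 1 / q) * Λ ^ q := by positivity
    nlinarith
  have heq : ∀ x ∈ Icc (0 : ℝ) 1, quarterOp k x = φ x := by
    intro x hx
    refine (young_gap hq1 (hφ0 x) (hSk0 x hx)).2 ?_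
    by_contra hne
    have hlt : 0 < (1 - 1 / q) * φ x ^ q + quarterOp k x ^ q / q - φ x ^ (q - 1) * quarterOp k x :=
      lt_of_le_of_ne (hgapnn x hx) fun h => hne (by linarith)
    have := intervalIntegral.integral_pos zero_lt_one
      ((((hφc.rpow_const (fun _ => Or.inr hq.le)).continuousOn.const_mul (1 - 1 / q)).add
        (hSkqc.div_const q)).sub hmixc) (fun y hy => hgapnn y (Ioc_subset_Icc_self hy)) ⟨x, hx, hlt⟩
    rw [hκ2, sub_self, mul_zero, mul_zero] at hgap
    exact absurd this (not_lt.2 hgap)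
  refine ⟨k, hkc, hk0, hkz, hκ2, fun x hx => ?_⟩
  rw [hkw x hx, hw, quarterOp, quarterOp]
  refine intervalIntegral.integral_congr fun y hy => intervalIntegral.integral_congr fun t ht => ?_
  rw [uIcc_of_le hx.1] at hy
  rw [uIcc_of_le (hy.2.trans hx.2)] at ht
  simp only [heq t ⟨hy.1.trans ht.1, ht.2⟩]

end extremal

end

noncomputable section

/-! ### Waves -/

/-- The integral from `x` to `1`. -/
def tailInt (f : ℝ → ℝ) (x : ℝ) : ℝ := ∫ t in x..1, f t

theorem hasDerivAt_tailInt {f : ℝ → ℝ} (hf : Continuous f) (x : ℝ) :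
    HasDerivAt (tailInt f) (-f x) x :=
  intervalIntegral.integral_hasDerivAt_left (hf.intervalIntegrable _ _)
    (hf.stronglyMeasurableAtFilter _ _) hf.continuousAt

theorem continuous_tailInt {f : ℝ → ℝ} (hf : Continuous f) : Continuous (tailInt f) :=
  continuous_iff_continuousAt.2 fun x => (hasDerivAt_tailInt hf x).continuousAt

theorem hasDerivAt_quarterOp {f : ℝ → ℝ} (hf : Continuous f) (x : ℝ) :
    HasDerivAt (quarterOp f) (tailInt f x) x :=
  intervalIntegral.integral_hasDerivAt_right ((continuous_tailInt hf).intervalIntegrable _ _)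
    ((continuous_tailInt hf).stronglyMeasurableAtFilter _ _) (continuous_tailInt hf).continuousAt

theorem continuous_quarterOp {f : ℝ → ℝ} (hf : Continuous f) : Continuous (quarterOp f) :=
  continuous_iff_continuousAt.2 fun x => (hasDerivAt_quarterOp hf x).continuousAt

theorem integral_eq_tailInt_sub {f : ℝ → ℝ} (hf : Continuous f) (x y : ℝ) :
    ∫ t in x..y, f t = tailInt f x - tailInt f y := by
  have := intervalIntegral.integral_add_adjacent_intervals (μ := volume)
    (hf.intervalIntegrable x y) (hf.intervalIntegrable y 1)
  rw [tailInt, tailInt, ← this, add_sub_cancel_right]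

theorem integral_tailInt {f : ℝ → ℝ} (hf : Continuous f) (x y : ℝ) :
    ∫ t in x..y, tailInt f t = quarterOp f y - quarterOp f x :=
  (intervalIntegral.integral_interval_sub_left ((continuous_tailInt hf).intervalIntegrable _ _)
    ((continuous_tailInt hf).intervalIntegrable _ _)).symm

/-- The symmetries of `x ↦ sin (π x / 2)`: odd, and symmetric about `1`. -/
structure WaveSymm (f : ℝ → ℝ) : Prop where
  odd : ∀ x, f (-x) = -f x
  refl : ∀ x, f (2 - x) = f x

namespace WaveSymm

variable {f g : ℝ → ℝ}

theorem add_two (hf : WaveSymm f) (x : ℝ) : f (x + 2) = -f x := by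
  rw [← hf.odd, ← hf.refl (-x)]
  congr 1; ring

theorem comp_spow (hf : WaveSymm f) (r : ℝ) : WaveSymm fun x => spow r (f x) :=
  ⟨fun x => by rw [hf.odd, spow_neg], fun x => by rw [hf.refl]⟩

theorem tailInt_neg (hf : WaveSymm f) (hc : Continuous f) (x : ℝ) :
    tailInt f (-x) = tailInt f x := by
  have h1 : ∫ t in -x..x, f t = 0 := by
    have := intervalIntegral.integral_comp_neg (a := -x) (b := x) f
    simp only [hf.odd, intervalIntegral.integral_neg, neg_neg] at this
    linarith
  have := integral_eq_tailInt_sub hc (-x) x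
  linarith

theorem tailInt_two_sub (hf : WaveSymm f) (x : ℝ) : tailInt f (2 - x) = -tailInt f x := by
  have := intervalIntegral.integral_comp_sub_left (a := x) (b := 1) f 2
  simp only [hf.refl] at this
  rw [tailInt, tailInt, this, intervalIntegral.integral_symm]
  norm_num

theorem tailInt_add_two (hf : WaveSymm f) (hc : Continuous f) (x : ℝ) :
    tailInt f (x + 2) = -tailInt f x := by
  rw [← hf.tailInt_neg hc x, ← hf.tailInt_two_sub (-x)]
  congr 1; ring

theorem quarterOp (hf : WaveSymm f) (hc : Continuous f) : WaveSymm (quarterOp f) := by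
  constructor
  · intro x
    have := intervalIntegral.integral_comp_neg (a := 0) (b := x) (tailInt f)
    simp only [hf.tailInt_neg hc, neg_zero] at this
    change ∫ y in (0 : ℝ)..-x, tailInt f y = -∫ y in (0 : ℝ)..x, tailInt f y
    rw [this, intervalIntegral.integral_symm]
  · intro x
    have h := intervalIntegral.integral_comp_sub_left (a := x) (b := 2 - x) (tailInt f) 2
    simp only [hf.tailInt_two_sub, intervalIntegral.integral_neg, sub_sub_cancel] at h
    have := integral_tailInt hc x (2 - x)
    linarith

/-- Reflection about `1` determines the values on `[1, 2]`, and `|f - g|` has period `2` because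
both functions change sign under that translation. -/
theorem eq_of_eqOn (hf : WaveSymm f) (hg : WaveSymm g) (h : EqOn f g (Icc 0 1)) : f = g := by
  have hper : Function.Periodic (fun x => |f x - g x|) 2 := fun x => by
    simp only [hf.add_two, hg.add_two]
    rw [← abs_neg]; congr 1; ring
  ext x
  obtain ⟨y, hy, hxy⟩ := hper.exists_mem_Ico₀ (by norm_num) x
  have hy0 : f y = g y := by
    rcases le_total y 1 with h1 | h1
    · exact h ⟨hy.1, h1⟩
    · rw [← hf.refl y, ← hg.refl y]
      exact h ⟨by linarith [hy.2], by linarith⟩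
  simp only [hy0, sub_self, abs_zero, abs_eq_zero] at hxy
  exact sub_eq_zero.1 hxy

theorem add_two_mul (hf : WaveSymm f) (m : ℕ) (x : ℝ) : f (2 * m + x) = (-1) ^ m * f x := by
  induction m with
  | zero => simp
  | succ m ih =>
    rw [show 2 * ((m + 1 : ℕ) : ℝ) + x = 2 * m + x + 2 by push_cast; ring, hf.add_two, ih, pow_succ]
    ring

theorem tailInt_add_two_mul (hf : WaveSymm f) (hc : Continuous f) (m : ℕ) (x : ℝ) :
    tailInt f (2 * m + x) = (-1) ^ m * tailInt f x := by
  induction m with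
  | zero => simp
  | succ m ih =>
    rw [show 2 * ((m + 1 : ℕ) : ℝ) + x = 2 * m + x + 2 by push_cast; ring,
      hf.tailInt_add_two hc, ih, pow_succ]
    ring

end WaveSymm

/-- `H` is (minus the second derivative of) a wave: with `U'' = -H` and `W'' = -|U|^{q-1} sgn U`
one has `W = Λ^q |H|^{q-1} sgn H`. -/
structure IsWave (q Λ : ℝ) (H : ℝ → ℝ) : Prop where
  continuous : Continuous H
  symm : WaveSymm H
  nonneg : ∀ x ∈ Icc (0 : ℝ) 1, 0 ≤ H x
  integral_pos : 0 < ∫ x in (0 : ℝ)..1, H x ^ q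
  euler : ∀ x, quarterOp (fun t => spow (q - 1) (quarterOp H t)) x = Λ ^ q * spow (q - 1) (H x)

/-- The triangle wave with values in `[-1, 1]`. -/
def triangleWave (x : ℝ) : ℝ := 2 / Real.pi * Real.arcsin (Real.sin (Real.pi / 2 * x))

theorem continuous_triangleWave : Continuous triangleWave := by
  unfold triangleWave
  exact continuous_const.mul (Real.continuous_arcsin.comp (Real.continuous_sin.comp
    (continuous_const.mul continuous_id)))

theorem waveSymm_triangleWave : WaveSymm triangleWave := by
  constructor <;> intro x <;> unfold triangleWave
  · rw [mul_neg, Real.sin_neg, Real.arcsin_neg, mul_neg]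
  · rw [show Real.pi / 2 * (2 - x) = Real.pi - Real.pi / 2 * x by ring, Real.sin_pi_sub]

theorem triangleWave_of_mem {x : ℝ} (hx : x ∈ Icc (0 : ℝ) 1) : triangleWave x = x := by
  have hpi := Real.pi_pos
  unfold triangleWave
  rw [Real.arcsin_sin]
  · field_simp
  · nlinarith [hx.1]
  · nlinarith [hx.2]

/-- The odd extension of the extremal is composed with the triangle wave; `k 0 = 0` makes the result
equal to `k` on `[0, 1]`. Both sides of the Euler equation have the wave symmetries, so it need only
be known there. -/
theorem exists_isWave (𝕜 : Type) [RCLike 𝕜] {p : ℝ≥0∞} [Fact (1 ≤ p)] (hp1 : 1 < p)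
    (hp : p ≠ ⊤) : ∃ H, IsWave p.toReal (4 * (interpConst 𝕜 p 0 1).toReal) H := by
  have hq1 : 1 < p.toReal := by
    rw [← ENNReal.toReal_one]; exact (ENNReal.toReal_lt_toReal (by simp) hp).2 hp1
  obtain ⟨k, hkc, hk0, hkz, hk1, hk⟩ := exists_extremal 𝕜 hp1 hp
  set q := p.toReal with hq
  have hq10 : 0 < q - 1 := by linarith
  set Λ := 4 * (interpConst 𝕜 p 0 1).toReal with hΛ
  set kh : ℝ → ℝ := fun s => k (max s 0) - k (max (-s) 0) with hkh
  have hkhc : Continuous kh := by fun_prop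
  have hkho : ∀ s, kh (-s) = -kh s := fun s => by simp [hkh]
  set H : ℝ → ℝ := fun x => kh (triangleWave x) with hH
  have hHc : Continuous H := hkhc.comp continuous_triangleWave
  have hHs : WaveSymm H := ⟨fun x => by simp only [hH, waveSymm_triangleWave.odd, hkho],
    fun x => by simp only [hH, waveSymm_triangleWave.refl]⟩
  have hHk : ∀ x ∈ Icc (0 : ℝ) 1, H x = k x := fun x hx => by
    simp only [hH, hkh, triangleWave_of_mem hx]
    rw [max_eq_left hx.1, max_eq_right (by linarith [hx.1]), hkz, sub_zero]
  have hH0 : ∀ x ∈ Icc (0 : ℝ) 1, 0 ≤ H x := fun x hx => by rw [hHk x hx]; exact hk0 x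
  have hcong : ∀ {f g : ℝ → ℝ}, EqOn f g (Icc 0 1) → EqOn (quarterOp f) (quarterOp g) (Icc 0 1) := by
    intro f g hfg x hx
    refine intervalIntegral.integral_congr (μ := volume) fun y hy => ?_
    refine intervalIntegral.integral_congr (μ := volume) (f := f) (g := g) fun t ht => ?_
    rw [uIcc_of_le hx.1] at hy
    rw [uIcc_of_le (hy.2.trans hx.2)] at ht
    exact hfg ⟨hy.1.trans ht.1, ht.2⟩
  have hUs := hHs.quarterOp hHc
  have hUc := continuous_quarterOp hHc
  have hsc : Continuous fun t => spow (q - 1) (quarterOp H t) := (continuous_spow hq10).comp hUc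
  refine ⟨H, hHc, hHs, hH0, ?_, ?_⟩
  · have : ∫ x in (0 : ℝ)..1, H x ^ q = 1 := by
      refine (intervalIntegral.integral_congr (μ := volume) fun x hx => ?_).trans hk1
      rw [uIcc_of_le zero_le_one] at hx
      simp only [hHk x hx]
    rw [this]; exact zero_lt_one
  · have hR : WaveSymm fun x => Λ ^ q * spow (q - 1) (H x) :=
      ⟨fun x => by rw [hHs.odd, spow_neg, mul_neg], fun x => by rw [hHs.refl]⟩
    have := ((hUs.comp_spow (q - 1)).quarterOp hsc).eq_of_eqOn hR fun x hx => ?_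
    · exact fun x => congrFun this x
    · rw [hHk x hx, spow_of_nonneg hq10 (hk0 x), ← hk x hx]
      refine hcong (fun t ht => ?_) hx
      have e : quarterOp H t = quarterOp k t := hcong hHk ht
      rw [e, spow_of_nonneg hq10 (quarterOp_nonneg (fun t _ => hk0 t) ht)]

end

noncomputable section

/-! ### Alternating functions -/

/-- `f` takes alternating signs at `n` increasing points of `S`. -/
def Alternates (n : ℕ) (S : Set ℝ) (f : ℝ → ℝ) : Prop :=
  ∃ (y : ℕ → ℝ) (ε : ℝ), (∀ j, j + 1 < n → y j < y (j + 1)) ∧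
    ∀ j < n, y j ∈ S ∧ 0 < ε * ((-1) ^ j * f (y j))

theorem Alternates.of_integral {n : ℕ} {S : Set ℝ} {f : ℝ → ℝ} {z : ℕ → ℝ} {ε : ℝ}
    (hz : ∀ j < n, z j ≤ z (j + 1)) (hS : ∀ j < n, Ioc (z j) (z (j + 1)) ⊆ S)
    (h : ∀ j < n, 0 < ε * ((-1) ^ j * ∫ t in z j..z (j + 1), f t)) : Alternates n S f := by
  have key : ∀ j, ∃ t, j < n → t ∈ Ioc (z j) (z (j + 1)) ∧ 0 < ε * ((-1) ^ j * f t) := by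
    intro j
    by_contra! hc
    have hj := (hc 0).1
    refine absurd (h j hj) (not_lt.2 ?_)
    rw [← intervalIntegral.integral_const_mul, ← intervalIntegral.integral_const_mul,
      intervalIntegral.integral_of_le (hz j hj)]
    exact setIntegral_nonpos measurableSet_Ioc fun t ht => (hc t).2 ht
  choose y hy using key
  refine ⟨y, ε, fun j hj => ?_, fun j hj => ⟨hS j hj (hy j hj).1, (hy j hj).2⟩⟩
  exact (hy j (by omega)).1.2.trans_lt (hy (j + 1) hj).1.1

/-- The difference of consecutive values of the primitive has the sign of the first one, and after
the last point its zero value at `C` supplies one more difference. This end condition avoids the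
loss of one sign change in Rolle's theorem. -/
theorem Alternates.of_integral_right {n : ℕ} {A C : ℝ} {f : ℝ → ℝ}
    (hf : IntervalIntegrable f volume A C)
    (h : Alternates n (Ioc A C) fun x => ∫ t in x..C, f t) : Alternates n (Ioc A C) f := by
  obtain ⟨y, ε, hy, h⟩ := h
  beta_reduce at h
  have hi : ∀ u ∈ Icc A C, ∀ v ∈ Icc A C, IntervalIntegrable f volume u v := fun u hu v hv =>
    hf.mono_set (by
      rw [uIcc_of_le (hu.1.trans hu.2)]
      exact uIcc_subset_Icc hu hv)
  set z : ℕ → ℝ := fun j => if j < n then y j else C with hz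
  have hzy : ∀ j < n, z j = y j := fun j hj => if_pos hj
  have hmono : ∀ j < n, z j ≤ z (j + 1) := fun j hj => by
    rw [hzy j hj]
    by_cases h' : j + 1 < n
    · rw [hzy _ h']; exact (hy j h').le
    · simp only [hz, if_neg h']; exact (h j hj).1.2
  refine Alternates.of_integral (z := z) (ε := ε) hmono (fun j hj => ?_) fun j hj => ?_
  · rw [hzy j hj]
    refine Ioc_subset_Ioc (h j hj).1.1.le ?_
    by_cases h' : j + 1 < n
    · rw [hzy _ h']; exact (h _ h').1.2
    · simp only [hz, if_neg h']; exact le_rfl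
  · have hj1 := (h j hj).2
    have hjm : y j ∈ Icc A C := Ioc_subset_Icc_self (h j hj).1
    have hC : C ∈ Icc A C := ⟨hjm.1.trans hjm.2, le_rfl⟩
    rw [hzy j hj]
    by_cases h' : j + 1 < n
    · rw [hzy _ h']
      have hj2 := (h _ h').2
      have hjm' : y (j + 1) ∈ Icc A C := Ioc_subset_Icc_self (h _ h').1
      have := intervalIntegral.integral_add_adjacent_intervals (hi _ hjm _ hjm') (hi _ hjm' _ hC)
      rw [← this] at hj1
      rw [pow_succ] at hj2
      linarith
    · simp only [hz, if_neg h']; exact hj1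

/-- Here the zero of the primitive at `A` supplies the extra difference in front. -/
theorem Alternates.of_integral_left {n : ℕ} {A C : ℝ} {f : ℝ → ℝ}
    (hf : IntervalIntegrable f volume A C)
    (h : Alternates n (Ioc A C) fun x => ∫ t in A..x, f t) : Alternates n (Ioc A C) f := by
  obtain ⟨y, ε, hy, h⟩ := h
  beta_reduce at h
  have hi : ∀ u ∈ Icc A C, ∀ v ∈ Icc A C, IntervalIntegrable f volume u v := fun u hu v hv =>
    hf.mono_set (by
      rw [uIcc_of_le (hu.1.trans hu.2)]
      exact uIcc_subset_Icc hu hv)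
  set z : ℕ → ℝ := fun j => Nat.casesOn j A y with hz
  refine Alternates.of_integral (z := z) (ε := ε) (fun j hj => ?_) (fun j hj => ?_) fun j hj => ?_
  · rcases j with _ | j
    · exact (h 0 hj).1.1.le
    · exact (hy j hj).le
  · refine Ioc_subset_Ioc ?_ (h j hj).1.2
    rcases j with _ | j
    · exact le_rfl
    · exact (h j (by omega)).1.1.le
  · have hj1 := (h j hj).2
    have hjm : y j ∈ Icc A C := Ioc_subset_Icc_self (h j hj).1
    have hA : A ∈ Icc A C := ⟨le_rfl, hjm.1.trans hjm.2⟩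
    rcases j with _ | j
    · exact hj1
    · have hj2 := (h j (by omega)).2
      have hjm' : y j ∈ Icc A C := Ioc_subset_Icc_self (h j (by omega)).1
      have := intervalIntegral.integral_add_adjacent_intervals (hi _ hA _ hjm') (hi _ hjm' _ hjm)
      rw [← this] at hj1
      change 0 < ε * ((-1) ^ (j + 1) * ∫ t in y j..y (j + 1), f t)
      rw [pow_succ] at hj1 ⊢
      linarith

/-- A combination of `n` successive pieces that alternates `n` times involves every piece. -/
theorem Alternates.coeff_pos {n : ℕ} {S : Set ℝ} {h : Fin n → ℝ → ℝ} {e : Fin n → ℝ}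
    (hh : ∀ i t, 0 ≤ h i t)
    (hord : ∀ i j, i < j → ∀ t t', h i t ≠ 0 → h j t' ≠ 0 → t < t') (he : ∀ i, 0 ≤ e i)
    (halt : Alternates n S fun t => ∑ i : Fin n, (-1) ^ (i : ℕ) * e i * h i t) (i : Fin n) : 0 < e i := by
  obtain ⟨y, ε, hy, halt⟩ := halt
  have key : ∀ j : Fin n, ∃ i : Fin n, h i (y j) ≠ 0 ∧ 0 < e i ∧
      0 < ε * ((-1) ^ (j : ℕ) * (-1) ^ (i : ℕ)) := by
    intro j
    have h1 := (halt j j.2).2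
    beta_reduce at h1
    have : ∃ i, h i (y j) ≠ 0 := by
      by_contra! hc
      simp [hc] at h1
    obtain ⟨i, hi⟩ := this
    rw [Finset.sum_eq_single i] at h1
    · have h2 : 0 < ε * ((-1) ^ (j : ℕ) * (-1) ^ (i : ℕ)) * (e i * h i (y j)) := by
        convert h1 using 1; ring
      have h3 : 0 < e i * h i (y j) := by
        refine lt_of_le_of_ne (mul_nonneg (he i) (hh i _)) fun h0 => ?_
        rw [← h0, mul_zero] at h2; exact h2.false
      exact ⟨i, hi, pos_of_mul_pos_left h3 (hh i _), pos_of_mul_pos_left h2 h3.le⟩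
    · intro i' _ hne
      by_contra hc
      have hi' : h i' (y j) ≠ 0 := fun h0 => hc (by rw [h0, mul_zero])
      rcases lt_or_gt_of_ne hne with hlt | hlt
      · exact (hord _ _ hlt _ _ hi' hi).false
      · exact (hord _ _ hlt _ _ hi hi').false
    · simp
  choose I hI1 hI2 hI3 using key
  -- Each piece contributes one constant sign, so consecutive points, carrying opposite signs, lie
  -- in different pieces. An injective self-map of `Fin n` is onto, so all pieces occur.
  have hmono : StrictMono I := by
    rcases n with _ | n
    · exact fun a => a.elim0
    refine Fin.strictMono_iff_lt_succ.2 fun j => ?_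
    have hlt : y (j.castSucc : Fin (n + 1)) < y (j.succ : Fin (n + 1)) := by
      simpa using hy j (by omega)
    refine lt_of_le_of_ne (not_lt.1 fun hc => ?_) fun heq => ?_
    · exact (hlt.trans (hord _ _ hc _ _ (hI1 _) (hI1 _))).false
    · have h1 := hI3 j.castSucc
      have h2 := hI3 j.succ
      rw [← heq, Fin.val_succ, pow_succ] at h2
      rw [Fin.val_castSucc] at h1
      linarith
  obtain ⟨j, rfl⟩ := (Finite.surjective_of_injective hmono.injective) i
  exact hI2 j

/-! ### Bernstein inequality for the twofold integration operator -/

/-- The twofold integral of `h` from `A`. -/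
def twoInt (A : ℝ) (h : ℝ → ℝ) (x : ℝ) : ℝ := ∫ y in A..x, ∫ t in A..y, h t

theorem continuous_twoInt {A : ℝ} {h : ℝ → ℝ} (hh : Integrable h) : Continuous (twoInt A h) := by
  have h1 : Continuous fun y => ∫ t in A..y, h t :=
    intervalIntegral.continuous_primitive (fun _ _ => hh.intervalIntegrable) A
  exact intervalIntegral.continuous_primitive (fun _ _ => h1.intervalIntegrable _ _) A

theorem twoInt_sum {ι : Type*} (s : Finset ι) {A : ℝ} {h : ι → ℝ → ℝ} (c : ι → ℝ)
    (hh : ∀ i, Integrable (h i)) (x : ℝ) :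
    twoInt A (fun t => ∑ i ∈ s, c i * h i t) x = ∑ i ∈ s, c i * twoInt A (h i) x := by
  have h1 : ∀ i, Continuous fun y => ∫ t in A..y, h i t := fun i =>
    intervalIntegral.continuous_primitive (fun _ _ => (hh i).intervalIntegrable) A
  have h2 : ∀ y, ∫ t in A..y, ∑ i ∈ s, c i * h i t = ∑ i ∈ s, c i * ∫ t in A..y, h i t := by
    intro y
    rw [intervalIntegral.integral_finsetSum fun i _ => ((hh i).const_mul _).intervalIntegrable]
    simp
  simp only [twoInt, h2]
  rw [intervalIntegral.integral_finsetSum fun i _ => ((h1 i).const_mul _).intervalIntegrable _ _]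
  simp

theorem integral_mul_twoInt {A C : ℝ} (hAC : A ≤ C) {z h : ℝ → ℝ} (hz : Integrable z)
    (hh : Integrable h) : ∫ x in A..C, z x * twoInt A h x =
      ∫ t in A..C, (∫ y in t..C, ∫ x in y..C, z x) * h t := by
  have h1 : Continuous fun y => ∫ t in A..y, h t :=
    intervalIntegral.continuous_primitive (fun _ _ => hh.intervalIntegrable) A
  have h2 : Continuous fun y => ∫ x in y..C, z x := by
    have := (intervalIntegral.continuous_primitive
      (fun _ _ => hz.intervalIntegrable) C (f := z) (μ := volume)).neg
    exact this.congr fun y => (intervalIntegral.integral_symm _ _).symm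
  have e1 := integral_smul_primitive hAC (f := z) (hz.intervalIntegrable)
    (h1.intervalIntegrable A C)
  have e2 := integral_smul_primitive hAC (f := fun y => ∫ x in y..C, z x)
    (h2.intervalIntegrable A C) (hh.intervalIntegrable)
  simp only [smul_eq_mul] at e1 e2
  exact e1.trans e2

theorem hasDerivAt_integral_abs_rpow {q A C : ℝ} (hq : 1 < q) {E : Set ℝ}
    (hE : MeasurableSet E) (hEs : E ⊆ Icc A C) {g τ : ℝ → ℝ} (hg : Continuous g)
    (hτ : Continuous τ) :
    HasDerivAt (fun s => ∫ x in E, |g x + s * τ x| ^ q)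
      (q * ∫ x in E, spow (q - 1) (g x) * τ x) 0 := by
  have hq0 : 0 < q - 1 := by linarith
  have hfin : volume E ≠ ⊤ := ((measure_mono hEs).trans_lt isCompact_Icc.measure_lt_top).ne
  have hcF : Continuous fun z : ℝ × ℝ => |g z.2 + z.1 * τ z.2| ^ q :=
    (by fun_prop : Continuous fun z : ℝ × ℝ => |g z.2 + z.1 * τ z.2|).rpow_const
      fun _ => Or.inr (by linarith)
  have hcF' : Continuous fun z : ℝ × ℝ => q * spow (q - 1) (g z.2 + z.1 * τ z.2) * τ z.2 := by
    have := continuous_spow hq0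
    fun_prop
  obtain ⟨M, hM⟩ := ((isCompact_Icc (a := (-1 : ℝ)) (b := 1)).prod
    (isCompact_Icc (a := A) (b := C))).exists_bound_of_continuousOn hcF'.continuousOn
  have := hasDerivAt_integral_of_dominated_loc_of_deriv_le (μ := volume.restrict E)
    (F := fun s x => |g x + s * τ x| ^ q)
    (F' := fun s x => q * spow (q - 1) (g x + s * τ x) * τ x) (x₀ := (0 : ℝ))
    (s := Metric.ball 0 1) (bound := fun _ => M) (Metric.ball_mem_nhds _ one_pos) ?_ ?_ ?_ ?_ ?_ ?_
  · have h := this.2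
    simp only [zero_mul, add_zero, mul_assoc] at h
    rwa [integral_const_mul] at h
  · refine Eventually.of_forall fun s => Continuous.aestronglyMeasurable ?_
    exact hcF.comp (Continuous.prodMk_right s)
  · refine IntegrableOn.mono_set ?_ hEs
    exact (hcF.comp (Continuous.prodMk_right 0)).continuousOn.integrableOn_Icc
  · exact (hcF'.comp (Continuous.prodMk_right 0)).aestronglyMeasurable
  · filter_upwards [ae_restrict_mem hE] with x hx s hs
    refine hM (s, x) ⟨?_, hEs hx⟩
    rw [Metric.mem_ball, Real.dist_0_eq_abs, abs_lt] at hs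
    exact ⟨hs.1.le, hs.2.le⟩
  · exact integrableOn_const hfin
  · refine Eventually.of_forall fun x s _ => ?_
    have h1 := (hasDerivAt_abs_rpow_spow hq (g x + s * τ x)).comp s
      (((hasDerivAt_id s).mul_const (τ x)).const_add (g x))
    simpa [Function.comp_def, mul_assoc] using h1


/-- If `m < L`, comparing the dual inequality for `u` with the critical-point equation for `g`
produces `n` sign changes in the twofold integral `v`. They are carried down to the combination of
pieces generating `u - g`, in which the piece `i₀` is missing. -/
theorem le_of_critical {n : ℕ} {q A C L m : ℝ} (hq : 1 < q) (hAC : A ≤ C) {h : Fin n → ℝ → ℝ}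
    (hh : ∀ i t, 0 ≤ h i t) (hhi : ∀ i, Integrable (h i))
    (hord : ∀ i j, i < j → ∀ t t', h i t ≠ 0 → h j t' ≠ 0 → t < t')
    {ν : Fin n → ℝ} (hν : ∀ i, 0 < ν i) {E : Set ℝ} (hE : MeasurableSet E) (hEs : E ⊆ Icc A C)
    (hu : ∀ i : Fin n, L * ν i ≤ (-1) ^ (i : ℕ) *
      ∫ x in E, spow (q - 1) (∑ j : Fin n, (-1) ^ (j : ℕ) * twoInt A (h j) x) * twoInt A (h i) x)
    {d : Fin n → ℝ} (hm : 0 ≤ m) (hd : ∀ i, |d i| ≤ 1) {i₀ : Fin n}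
    (hd₀ : d i₀ = (-1) ^ (i₀ : ℕ))
    (hcrit : ∀ i, ∫ x in E, spow (q - 1) (∑ j, d j * twoInt A (h j) x) * twoInt A (h i) x =
      m * (spow (q - 1) (d i) * ν i)) : L ≤ m := by
  have hq0 : 0 < q - 1 := by linarith
  have hτ : ∀ i, Continuous (twoInt A (h i)) := fun i => continuous_twoInt (hhi i)
  have hsp := continuous_spow hq0
  by_contra! hlt
  set u : ℝ → ℝ := fun x => ∑ j : Fin n, (-1) ^ (j : ℕ) * twoInt A (h j) x with hudef
  set g : ℝ → ℝ := fun x => ∑ j, d j * twoInt A (h j) x with hgdef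
  have huc : Continuous u := by fun_prop
  have hgc : Continuous g := by fun_prop
  set z : ℝ → ℝ := E.indicator fun x => spow (q - 1) (u x) - spow (q - 1) (g x) with hz
  have hon : ∀ {f : ℝ → ℝ}, Continuous f → IntegrableOn f E := fun hf =>
    (hf.continuousOn.integrableOn_Icc (a := A) (b := C)).mono_set hEs
  have hzi : Integrable z := (integrable_indicator_iff hE).2 (hon (by fun_prop))
  set v : ℝ → ℝ := fun t => ∫ y in t..C, ∫ x in y..C, z x with hv
  have hE' : (Ioc A C ∩ E : Set ℝ) =ᵐ[volume] E :=
    (Ioc_ae_eq_Icc.inter (ae_eq_refl E)).trans (inter_eq_right.2 hEs).eventuallyEq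
  -- By Fubini this pairing is that of the signed-power difference with `twoInt A (h i)`; its signed
  -- value is at least `(L - m) ν i`, because `|d i| ≤ 1`.
  have hvi : ∀ i : Fin n, 0 < ∫ t in A..C, (-1) ^ (i : ℕ) * (v t * h i t) := by
    intro i
    rw [intervalIntegral.integral_const_mul, ← integral_mul_twoInt hAC hzi (hhi i),
      intervalIntegral.integral_of_le hAC]
    have e1 : ∫ x in Ioc A C, z x * twoInt A (h i) x =
        ∫ x in E, (spow (q - 1) (u x) * twoInt A (h i) x - spow (q - 1) (g x) * twoInt A (h i) x) := by
      have : ∀ x, z x * twoInt A (h i) x = E.indicator (fun x =>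
          spow (q - 1) (u x) * twoInt A (h i) x - spow (q - 1) (g x) * twoInt A (h i) x) x := by
        intro x
        simp only [hz, indicator]
        split_ifs <;> ring
      simp only [this]
      rw [setIntegral_indicator hE, setIntegral_congr_set hE']
    rw [e1, integral_sub (hon (by fun_prop)) (hon (by fun_prop)), hcrit, mul_sub]
    have h1 := hu i
    have h2 : (-1) ^ (i : ℕ) * (m * (spow (q - 1) (d i) * ν i)) ≤ m * ν i := by
      have h3 : |spow (q - 1) (d i)| ≤ 1 := by
        rw [abs_spow hq0]; exact Real.rpow_le_one (abs_nonneg _) (hd i) hq0.le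
      have h4 : (-1) ^ (i : ℕ) * spow (q - 1) (d i) ≤ 1 := by
        refine (le_abs_self _).trans ?_
        rwa [abs_mul, abs_pow, abs_neg, abs_one, one_pow, one_mul]
      calc _ = m * ν i * ((-1) ^ (i : ℕ) * spow (q - 1) (d i)) := by ring
        _ ≤ m * ν i * 1 := mul_le_mul_of_nonneg_left h4 (mul_nonneg hm (hν i).le)
        _ = m * ν i := mul_one _
    have h5 := mul_lt_mul_of_pos_right hlt (hν i)
    linarith
  have hpt : ∀ i : Fin n, ∃ t ∈ Ioc A C, 0 < (-1) ^ (i : ℕ) * (v t * h i t) := by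
    intro i
    by_contra! hc
    refine absurd (hvi i) (not_lt.2 ?_)
    rw [intervalIntegral.integral_of_le hAC]
    exact setIntegral_nonpos measurableSet_Ioc hc
  choose t ht htv using hpt
  have htne : ∀ i, h i (t i) ≠ 0 := fun i h0 => by
    have := htv i
    simp [h0] at this
  have a0 : Alternates n (Ioc A C) v := by
    refine ⟨fun j => if hj : j < n then t ⟨j, hj⟩ else 0, 1, fun j hj => ?_, fun j hj => ?_⟩
    · beta_reduce
      rw [dif_pos (by omega), dif_pos hj]
      exact hord ⟨j, by omega⟩ ⟨j + 1, hj⟩ (by simp [Fin.lt_def]) _ _ (htne _) (htne _)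
    · simp only [dif_pos hj]
      refine ⟨ht _, ?_⟩
      have := htv ⟨j, hj⟩
      rw [← mul_assoc] at this
      rw [one_mul]
      exact pos_of_mul_pos_left this (hh _ _)
  have hzc : Continuous fun y => ∫ x in y..C, z x := by
    have := (intervalIntegral.continuous_primitive
      (fun _ _ => hzi.intervalIntegrable) C (f := z) (μ := volume)).neg
    exact this.congr fun y => (intervalIntegral.integral_symm _ _).symm
  have a1 := a0.of_integral_right (hzc.intervalIntegrable _ _)
  have a2 := a1.of_integral_right hzi.intervalIntegrable
  -- The coefficients of `u - g` relative to the signs of `u`. They are nonnegative, and `e i₀ = 0`.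
  set e : Fin n → ℝ := fun i => 1 - (-1) ^ (i : ℕ) * d i with he
  set k : ℝ → ℝ := fun t => ∑ i : Fin n, (-1) ^ (i : ℕ) * e i * h i t with hk
  have hki : Integrable k := integrable_finsetSum _ fun i _ => (hhi i).const_mul _
  have hkc : Continuous fun y => ∫ t in A..y, k t :=
    intervalIntegral.continuous_primitive (fun _ _ => hki.intervalIntegrable) A
  have hug : ∀ x, twoInt A k x = u x - g x := by
    intro x
    rw [hk, twoInt_sum _ _ hhi, hudef, hgdef, ← Finset.sum_sub_distrib]
    refine Finset.sum_congr rfl fun i _ => ?_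
    have h1 : ((-1 : ℝ) ^ (i : ℕ)) * (-1) ^ (i : ℕ) = 1 := by
      rw [← mul_pow]; norm_num
    simp only [he]
    linear_combination (-(d i) * twoInt A (h i) x) * h1
  -- The signed power is strictly increasing, so `z` and `u - g` have the same sign on `E`; off `E`,
  -- `z` vanishes and cannot be an alternation point.
  have a3 : Alternates n (Ioc A C) (twoInt A k) := by
    obtain ⟨y, ε, hy, hyz⟩ := a2
    refine ⟨y, ε, hy, fun j hj => ⟨(hyz j hj).1, ?_⟩⟩
    have h1 := (hyz j hj).2
    by_cases hyE : y j ∈ E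
    · rw [hz, indicator_of_mem hyE] at h1
      rw [hug, ← mul_assoc]
      rw [← mul_assoc] at h1
      rcases lt_trichotomy (u (y j)) (g (y j)) with hl | hl | hl
      · have := spow_strictMono hq0 hl
        nlinarith
      · rw [hl] at h1; simp at h1
      · have := spow_strictMono hq0 hl
        nlinarith
    · rw [hz, indicator_of_notMem hyE] at h1; simp at h1
  have a4 := a3.of_integral_left (hkc.intervalIntegrable _ _)
  have a5 := a4.of_integral_left hki.intervalIntegrable
  have he0 : ∀ i, 0 ≤ e i := fun i => by
    have : (-1) ^ (i : ℕ) * d i ≤ 1 := by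
      refine (le_abs_self _).trans ?_
      rw [abs_mul, abs_pow, abs_neg, abs_one, one_pow, one_mul]; exact hd i
    simp only [he]; linarith
  have := a5.coeff_pos hh hord he0 i₀
  simp only [he, hd₀, ← mul_pow] at this
  norm_num at this

/-- Both sides are continuous and homogeneous of degree `q`, so the infimum of the ratio is attained
on the compact unit sphere. -/
theorem exists_min_ratio {n : ℕ} [NeZero n] {q A C : ℝ} (hq : 1 < q) {τ : Fin n → ℝ → ℝ}
    (hτ : ∀ i, Continuous (τ i)) {ν : Fin n → ℝ} (hν : ∀ i, 0 < ν i) {E : Set ℝ}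
    (hEs : E ⊆ Icc A C) :
    ∃ c : Fin n → ℝ, ∃ m : ℝ, c ≠ 0 ∧ 0 ≤ m ∧
      ∫ x in E, |∑ i, c i * τ i x| ^ q = m * ∑ i, |c i| ^ q * ν i ∧
      ∀ c : Fin n → ℝ, m * ∑ i, |c i| ^ q * ν i ≤ ∫ x in E, |∑ i, c i * τ i x| ^ q := by
  have hq0 : 0 ≤ q := by linarith
  set R : (Fin n → ℝ) → ℝ := fun c => ∫ x in E, |∑ i, c i * τ i x| ^ q with hR
  set N : (Fin n → ℝ) → ℝ := fun c => ∑ i, |c i| ^ q * ν i with hN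
  have hRc : Continuous R := by
    have h1 : Continuous (Function.uncurry fun (c : Fin n → ℝ) x => |∑ i, c i * τ i x| ^ q) := by
      refine Continuous.rpow_const ?_ fun _ => Or.inr hq0
      change Continuous fun z : (Fin n → ℝ) × ℝ => |∑ i, z.1 i * τ i z.2|
      fun_prop
    have := continuous_parametric_integral_of_continuous (μ := volume.restrict E) h1
      (isCompact_Icc (a := A) (b := C))
    rwa [Measure.restrict_restrict measurableSet_Icc, inter_eq_right.2 hEs] at this
  have hNc : Continuous N := by
    refine continuous_finsetSum _ fun i _ => Continuous.mul ?_ continuous_const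
    exact (by fun_prop : Continuous fun c : Fin n → ℝ => |c i|).rpow_const fun _ => Or.inr hq0
  have hNpos : ∀ c, c ≠ 0 → 0 < N c := by
    intro c hc
    obtain ⟨i, hi⟩ := Function.ne_iff.1 hc
    refine Finset.sum_pos' (fun i _ => by have := hν i; positivity) ⟨i, Finset.mem_univ i, ?_⟩
    exact mul_pos (Real.rpow_pos_of_pos (abs_pos.2 hi) _) (hν i)
  have hRnn : ∀ c, 0 ≤ R c := fun c => integral_nonneg fun x => by positivity
  have hRs : ∀ (s : ℝ) c, R (s • c) = |s| ^ q * R c := by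
    intro s c
    simp only [hR, ← integral_const_mul]
    congr 1; ext x
    rw [← Real.mul_rpow (abs_nonneg _) (abs_nonneg _), ← abs_mul, Finset.mul_sum]
    simp only [Pi.smul_apply, smul_eq_mul, mul_assoc]
  have hNs : ∀ (s : ℝ) c, N (s • c) = |s| ^ q * N c := by
    intro s c
    simp only [hN, Finset.mul_sum, Pi.smul_apply, smul_eq_mul, abs_mul,
      Real.mul_rpow (abs_nonneg _) (abs_nonneg _), mul_assoc]
  have hne : ∀ c ∈ Metric.sphere (0 : Fin n → ℝ) 1, c ≠ 0 := fun c hc => by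
    rw [← norm_ne_zero_iff]
    rw [mem_sphere_zero_iff_norm] at hc
    rw [hc]; exact one_ne_zero
  have hsne : (Metric.sphere (0 : Fin n → ℝ) 1).Nonempty := by
    refine ⟨fun _ => 1, ?_⟩
    rw [mem_sphere_zero_iff_norm, pi_norm_const, norm_one]
  obtain ⟨c, hc, hmin⟩ := (isCompact_sphere (0 : Fin n → ℝ) 1).exists_isMinOn hsne
    (f := fun c => R c / N c)
    (hRc.continuousOn.div hNc.continuousOn fun c hc => (hNpos c (hne c hc)).ne')
  have hcne := hne c hc
  refine ⟨c, R c / N c, hcne, div_nonneg (hRnn c) (hNpos c hcne).le,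
    (div_mul_cancel₀ _ (hNpos c hcne).ne').symm, fun x => ?_⟩
  rcases eq_or_ne x 0 with rfl | hx
  · have : N 0 = 0 := by simp [hN, Real.zero_rpow (by linarith : q ≠ 0)]
    change R c / N c * N 0 ≤ R 0
    rw [this, mul_zero]; exact hRnn 0
  · have hx' : ‖x‖ ≠ 0 := norm_ne_zero_iff.2 hx
    have h1 : ‖x‖⁻¹ • x ∈ Metric.sphere (0 : Fin n → ℝ) 1 := by
      rw [mem_sphere_zero_iff_norm, norm_smul, norm_inv, norm_norm, inv_mul_cancel₀ hx']
    have h2 : R c / N c ≤ R (‖x‖⁻¹ • x) / N (‖x‖⁻¹ • x) := hmin h1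
    rw [le_div_iff₀ (hNpos _ (hne _ h1)), hRs, hNs, mul_left_comm] at h2
    exact le_of_mul_le_mul_left h2 (Real.rpow_pos_of_pos (abs_pos.2 (inv_ne_zero hx')) _)

/-- If the signed sum `u` of the twofold integrals of successive pieces satisfies the dual
inequality `hu`, then the twofold integration operator is bounded below on their span. -/
theorem bernstein_of_alternating {n : ℕ} {q A C L : ℝ} (hq : 1 < q) (hAC : A ≤ C)
    {h : Fin n → ℝ → ℝ} (hh : ∀ i t, 0 ≤ h i t) (hhi : ∀ i, Integrable (h i))
    (hord : ∀ i j, i < j → ∀ t t', h i t ≠ 0 → h j t' ≠ 0 → t < t')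
    {ν : Fin n → ℝ} (hν : ∀ i, 0 < ν i) {E : Set ℝ} (hE : MeasurableSet E) (hEs : E ⊆ Icc A C)
    (hu : ∀ i : Fin n, L * ν i ≤ (-1) ^ (i : ℕ) *
      ∫ x in E, spow (q - 1) (∑ j : Fin n, (-1) ^ (j : ℕ) * twoInt A (h j) x) * twoInt A (h i) x)
    (c : Fin n → ℝ) :
    L * ∑ i, |c i| ^ q * ν i ≤ ∫ x in E, |∑ i, c i * twoInt A (h i) x| ^ q := by
  have hq0 : 0 < q - 1 := by linarith
  rcases n with _ | n
  · rw [Finset.univ_eq_empty, Finset.sum_empty, mul_zero]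
    exact integral_nonneg fun x => by positivity
  have hτ : ∀ i, Continuous (twoInt A (h i)) := fun i => continuous_twoInt (hhi i)
  obtain ⟨b, m, hb, hm, hbm, hmin⟩ := exists_min_ratio (q := q) hq hτ hν hEs
  suffices L ≤ m from (mul_le_mul_of_nonneg_right this
    (Finset.sum_nonneg fun i _ => by have := hν i; positivity)).trans (hmin c)
  -- The difference of the two sides of `hmin` has its minimum, zero, at `b`; its derivative in each
  -- coordinate direction vanishes.
  have hcrit : ∀ i, ∫ x in E, spow (q - 1) (∑ j, b j * twoInt A (h j) x) * twoInt A (h i) x =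
      m * (spow (q - 1) (b i) * ν i) := by
    intro i
    have h1 := hasDerivAt_integral_abs_rpow hq hE hEs
      (g := fun x => ∑ j, b j * twoInt A (h j) x) (by fun_prop) (hτ i)
    have hup : ∀ (s : ℝ) (F : Fin (n + 1) → ℝ → ℝ), ∑ j, F j ((b + Pi.single i s : Fin (n + 1) → ℝ) j) =
        ∑ j ∈ Finset.univ.erase i, F j (b j) + F i (b i + s) := by
      intro s F
      rw [← Finset.sum_erase_add _ _ (Finset.mem_univ i)]
      congr 1
      · refine Finset.sum_congr rfl fun j hj => ?_
        rw [Pi.add_apply, Pi.single_eq_of_ne (Finset.ne_of_mem_erase hj), add_zero]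
      · rw [Pi.add_apply, Pi.single_eq_same]
    have h2 : HasDerivAt (fun s => m * (∑ j ∈ Finset.univ.erase i, |b j| ^ q * ν j +
        |b i + s| ^ q * ν i)) (m * (q * spow (q - 1) (b i) * ν i)) 0 := by
      have h3 := (hasDerivAt_abs_rpow_spow hq (b i + 0)).comp 0 ((hasDerivAt_id 0).const_add (b i))
      simp only [add_zero, mul_one] at h3
      exact ((h3.mul_const (ν i)).const_add _).const_mul m
    have h4 : IsLocalMin (fun s => (∫ x in E, |∑ j, b j * twoInt A (h j) x +
        s * twoInt A (h i) x| ^ q) - m * (∑ j ∈ Finset.univ.erase i, |b j| ^ q * ν j +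
        |b i + s| ^ q * ν i)) 0 := by
      refine Eventually.of_forall fun s => ?_
      have h5 := hmin (b + Pi.single i s)
      rw [hup s fun j r => |r| ^ q * ν j] at h5
      have h6 : ∀ x, ∑ j, (b + Pi.single i s : Fin (n + 1) → ℝ) j * twoInt A (h j) x =
          ∑ j, b j * twoInt A (h j) x + s * twoInt A (h i) x := by
        intro x
        rw [hup s fun j r => r * twoInt A (h j) x,
          ← Finset.sum_erase_add _ (fun j => b j * twoInt A (h j) x) (Finset.mem_univ i)]
        ring
      simp only [h6] at h5
      have h7 := Finset.sum_erase_add Finset.univ (fun j => |b j| ^ q * ν j) (Finset.mem_univ i)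
      simp only [zero_mul, add_zero]
      rw [hbm, ← h7]
      linarith
    have h8 := h4.hasDerivAt_eq_zero (h1.sub h2)
    have h9 : q * ((∫ x in E, spow (q - 1) (∑ j, b j * twoInt A (h j) x) * twoInt A (h i) x) -
      m * (spow (q - 1) (b i) * ν i)) = 0 := by linarith
    exact sub_eq_zero.1 ((mul_eq_zero.1 h9).resolve_left (by linarith))
  obtain ⟨i₀, -, hi₀⟩ := Finset.exists_max_image Finset.univ (fun i => |b i|) Finset.univ_nonempty
  have hbi : 0 < |b i₀| := by
    obtain ⟨i, hi⟩ := Function.ne_iff.1 hb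
    exact (abs_pos.2 hi).trans_le (hi₀ i (Finset.mem_univ i))
  have hbne : b i₀ ≠ 0 := abs_pos.1 hbi
  -- Rescaled so that the largest coefficient becomes exactly the one that `u` has at `i₀`. The
  -- critical-point equation is homogeneous and survives.
  set r : ℝ := (-1) ^ (i₀ : ℕ) / b i₀ with hr
  refine le_of_critical hq hAC hh hhi hord hν hE hEs hu (d := fun i => r * b i) hm (fun i => ?_)
    (i₀ := i₀) (div_mul_cancel₀ _ hbne) fun i => ?_
  · rw [abs_mul, hr, abs_div, abs_pow, abs_neg, abs_one, one_pow, one_div,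
      inv_mul_le_iff₀ hbi, mul_one]
    exact hi₀ i (Finset.mem_univ i)
  · simp only [mul_assoc, ← Finset.mul_sum, spow_mul hq0]
    rw [integral_const_mul, hcrit]
    ring

end

noncomputable section

/-! ### The alternating configuration built from a wave -/

theorem integral_congr_Ioc {f g : ℝ → ℝ} {a b : ℝ} (hab : a ≤ b) (h : ∀ x ∈ Ioc a b, f x = g x) :
    ∫ x in a..b, f x = ∫ x in a..b, g x := by
  rw [intervalIntegral.integral_of_le hab, intervalIntegral.integral_of_le hab]
  exact setIntegral_congr_fun measurableSet_Ioc h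

theorem antitoneOn_tailInt {f : ℝ → ℝ} (hf : Continuous f) (h0 : ∀ x ∈ Icc (0 : ℝ) 1, 0 ≤ f x) :
    AntitoneOn (tailInt f) (Icc 0 1) := by
  intro x hx y hy hxy
  rw [← sub_nonneg, ← integral_eq_tailInt_sub hf]
  exact intervalIntegral.integral_nonneg hxy fun t ht => h0 t ⟨hx.1.trans ht.1, ht.2.trans hy.2⟩

theorem tailInt_one (f : ℝ → ℝ) : tailInt f 1 = 0 := intervalIntegral.integral_same

theorem quarterOp_zero (f : ℝ → ℝ) : quarterOp f 0 = 0 := intervalIntegral.integral_same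

theorem tailInt_nonneg {f : ℝ → ℝ} (hf : Continuous f) (h0 : ∀ x ∈ Icc (0 : ℝ) 1, 0 ≤ f x) {x : ℝ}
    (hx : x ∈ Icc (0 : ℝ) 1) : 0 ≤ tailInt f x := by
  rw [← tailInt_one f]
  exact antitoneOn_tailInt hf h0 hx (right_mem_Icc.2 zero_le_one) hx.2

theorem tailInt_zero_pos {f : ℝ → ℝ} (hf : Continuous f) (h0 : ∀ x ∈ Icc (0 : ℝ) 1, 0 ≤ f x)
    (hpos : ∃ c ∈ Icc (0 : ℝ) 1, 0 < f c) : 0 < tailInt f 0 :=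
  intervalIntegral.integral_pos zero_lt_one hf.continuousOn
    (fun x hx => h0 x (Ioc_subset_Icc_self hx)) hpos

theorem quarterOp_pos {f : ℝ → ℝ} (hf : Continuous f) (h0 : ∀ x ∈ Icc (0 : ℝ) 1, 0 ≤ f x)
    (hpos : ∃ c ∈ Icc (0 : ℝ) 1, 0 < f c) {x : ℝ} (hx : x ∈ Ioc (0 : ℝ) 1) : 0 < quarterOp f x :=
  intervalIntegral.integral_pos hx.1 (continuous_tailInt hf).continuousOn
    (fun _ hy => tailInt_nonneg hf h0 ⟨hy.1.le, hy.2.trans hx.2⟩)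
    ⟨0, left_mem_Icc.2 hx.1.le, tailInt_zero_pos hf h0 hpos⟩

theorem quarterOp_le_mul {f : ℝ → ℝ} (hf : Continuous f) (h0 : ∀ x ∈ Icc (0 : ℝ) 1, 0 ≤ f x)
    {x : ℝ} (hx : x ∈ Icc (0 : ℝ) 1) : quarterOp f x ≤ tailInt f 0 * x := by
  have h1 : ∫ y in (0 : ℝ)..x, tailInt f y ≤ ∫ _ in (0 : ℝ)..x, tailInt f 0 :=
    intervalIntegral.integral_mono_on hx.1 ((continuous_tailInt hf).intervalIntegrable _ _)
      intervalIntegrable_const fun y hy => antitoneOn_tailInt hf h0 (left_mem_Icc.2 zero_le_one)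
        ⟨hy.1, hy.2.trans hx.2⟩ hy.1
  rw [intervalIntegral.integral_const, smul_eq_mul, sub_zero, mul_comm] at h1
  exact h1

/-- Concavity of `quarterOp f` on `[0, 1]`: the graph lies below its tangent at `γ`. -/
theorem quarterOp_le_tangent {f : ℝ → ℝ} (hf : Continuous f) (h0 : ∀ x ∈ Icc (0 : ℝ) 1, 0 ≤ f x)
    {y γ : ℝ} (hy : 0 ≤ y) (hyγ : y ≤ γ) (hγ : γ ≤ 1) :
    quarterOp f y ≤ quarterOp f γ - (γ - y) * tailInt f γ := by
  have h1 : ∫ _ in y..γ, tailInt f γ ≤ ∫ t in y..γ, tailInt f t :=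
    intervalIntegral.integral_mono_on hyγ intervalIntegrable_const
      ((continuous_tailInt hf).intervalIntegrable _ _) fun t ht =>
      antitoneOn_tailInt hf h0 ⟨hy.trans ht.1, ht.2.trans hγ⟩ ⟨hy.trans hyγ, hγ⟩ ht.2
  rw [intervalIntegral.integral_const, smul_eq_mul, integral_tailInt hf] at h1
  linarith

namespace IsWave

variable {q Λ : ℝ} {H : ℝ → ℝ}

theorem continuous_force (hw : IsWave q Λ H) (hq : 1 < q) :
    Continuous fun t => spow (q - 1) (quarterOp H t) :=
  (continuous_spow (by linarith)).comp (continuous_quarterOp hw.continuous)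

theorem symm_force (hw : IsWave q Λ H) : WaveSymm fun t => spow (q - 1) (quarterOp H t) :=
  (hw.symm.quarterOp hw.continuous).comp_spow _

theorem exists_pos (hw : IsWave q Λ H) (hq : 1 < q) : ∃ c ∈ Icc (0 : ℝ) 1, 0 < H c := by
  by_contra! hc
  have : ∫ x in (0 : ℝ)..1, H x ^ q = ∫ x in (0 : ℝ)..1, (0 : ℝ) :=
    integral_congr_Ioc zero_le_one fun x hx => by
      have hx' := Ioc_subset_Icc_self hx
      rw [le_antisymm (hc x hx') (hw.nonneg x hx'), Real.zero_rpow (by linarith)]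
  have h := hw.integral_pos
  rw [this] at h
  simp at h

theorem force_nonneg (hw : IsWave q Λ H) (hq : 1 < q) :
    ∀ x ∈ Icc (0 : ℝ) 1, 0 ≤ spow (q - 1) (quarterOp H x) := fun x hx => by
  have h0 : 0 ≤ quarterOp H x := quarterOp_nonneg hw.nonneg hx
  rw [spow_of_nonneg (by linarith) h0]; positivity

theorem force_pos (hw : IsWave q Λ H) (hq : 1 < q) {x : ℝ} (hx : x ∈ Ioc (0 : ℝ) 1) :
    0 < spow (q - 1) (quarterOp H x) := by
  have h0 : 0 < quarterOp H x := quarterOp_pos hw.continuous hw.nonneg (hw.exists_pos hq) hx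
  rw [spow_of_nonneg (by linarith) h0.le]; positivity

/-- By the Euler equation a power of `H` is a multiple of `quarterOp` of the force, which is
positive on `(0, 1]`. -/
theorem pos (hw : IsWave q Λ H) (hq : 1 < q) {x : ℝ} (hx : x ∈ Ioo (0 : ℝ) 2) :
    0 < H x := by
  have key : ∀ x ∈ Ioc (0 : ℝ) 1, 0 < H x := by
    intro x hx
    have h1 := quarterOp_pos (hw.continuous_force hq) (hw.force_nonneg hq)
      ⟨1, right_mem_Icc.2 zero_le_one, hw.force_pos hq (right_mem_Ioc.2 zero_lt_one)⟩ hx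
    rw [hw.euler] at h1
    refine lt_of_le_of_ne (hw.nonneg x (Ioc_subset_Icc_self hx)) fun h0 => ?_
    rw [← h0, spow_zero (by linarith), mul_zero] at h1
    exact h1.false
  rcases le_total x 1 with h | h
  · exact key x ⟨hx.1, h⟩
  · rw [← hw.symm.refl]
    exact key _ ⟨by linarith [hx.2], by linarith⟩

theorem nonneg_two (hw : IsWave q Λ H) {x : ℝ} (hx : x ∈ Icc (0 : ℝ) 2) : 0 ≤ H x := by
  rcases le_total x 1 with h | h
  · exact hw.nonneg x ⟨hx.1, h⟩
  · rw [← hw.symm.refl]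
    exact hw.nonneg _ ⟨by linarith [hx.2], by linarith⟩

/-- Exhibits the sign of `H` on the `j`-th arch `(2j - 2, 2j)`: there `2j - x` lies in `(0, 2)`,
where `H` is positive. -/
theorem eq_two_mul_sub (hw : IsWave q Λ H) (j : ℕ) (x : ℝ) :
    H x = -((-1) ^ j * H (2 * j - x)) := by
  have h := hw.symm.add_two_mul j (x - 2 * j)
  rw [show 2 * (j : ℝ) + (x - 2 * j) = x by ring] at h
  rw [h, show x - 2 * (j : ℝ) = -(2 * j - x) by ring, hw.symm.odd]
  ring

/-- The parameters of the right end of the configuration. -/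
theorem exists_end (hw : IsWave q Λ H) (hq : 1 < q) :
    ∃ γ ∈ Icc (0 : ℝ) 1, ∃ ρ ∈ Icc (0 : ℝ) 1,
      tailInt (fun t => spow (q - 1) (quarterOp H t)) γ = tailInt H 0 ^ (q - 1) * ρ ^ q / q ∧
      quarterOp (fun t => spow (q - 1) (quarterOp H t)) γ -
        γ * tailInt (fun t => spow (q - 1) (quarterOp H t)) γ =
        tailInt H 0 ^ (q - 1) * ρ ^ (q + 1) / (q + 1) := by
  set S : ℝ → ℝ := fun t => spow (q - 1) (quarterOp H t) with hS
  have hSc : Continuous S := hw.continuous_force hq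
  have hS0 : ∀ x ∈ Icc (0 : ℝ) 1, 0 ≤ S x := hw.force_nonneg hq
  have hq0 : 0 < q := by linarith
  set μ := tailInt H 0 with hμ
  have hμ0 : 0 < μ := tailInt_zero_pos hw.continuous hw.nonneg (hw.exists_pos hq)
  have hμp : 0 < μ ^ (q - 1) := Real.rpow_pos_of_pos hμ0 _
  -- The first equation is solved for `ρ` in terms of `γ`; the second is then met by the
  -- intermediate value theorem on `[0, 1]`.
  set ρ : ℝ → ℝ := fun γ => (q * tailInt S γ / μ ^ (q - 1)) ^ q⁻¹ with hρ
  have hρc : Continuous ρ := by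
    have := continuous_tailInt hSc
    exact (by fun_prop : Continuous fun γ => q * tailInt S γ / μ ^ (q - 1)).rpow_const
      fun _ => Or.inr (by positivity)
  have hΞ : Continuous fun γ => quarterOp S γ - γ * tailInt S γ -
      μ ^ (q - 1) * ρ γ ^ (q + 1) / (q + 1) := by
    have h1 := continuous_tailInt hSc
    have h2 := continuous_quarterOp hSc
    have h3 : Continuous fun γ => ρ γ ^ (q + 1) :=
      hρc.rpow_const fun _ => Or.inr (by linarith)
    fun_prop
  have hρ0 : ∀ γ ∈ Icc (0 : ℝ) 1, 0 ≤ ρ γ := fun γ hγ =>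
    Real.rpow_nonneg (div_nonneg (mul_nonneg hq0.le (tailInt_nonneg hSc hS0 hγ)) hμp.le) _
  have h01 : (0 : ℝ) ∈ Icc ((fun γ => quarterOp S γ - γ * tailInt S γ -
      μ ^ (q - 1) * ρ γ ^ (q + 1) / (q + 1)) 0) ((fun γ => quarterOp S γ - γ * tailInt S γ -
      μ ^ (q - 1) * ρ γ ^ (q + 1) / (q + 1)) 1) := by
    constructor
    · have h1 := hρ0 0 (left_mem_Icc.2 zero_le_one)
      have : 0 ≤ μ ^ (q - 1) * ρ 0 ^ (q + 1) / (q + 1) := by positivity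
      simp only [quarterOp_zero]; linarith
    · have h1 : ρ 1 = 0 := by
        simp only [hρ, tailInt_one, mul_zero, zero_div]
        exact Real.zero_rpow (inv_ne_zero hq0.ne')
      have h2 : 0 ≤ quarterOp S 1 := quarterOp_nonneg hS0 (right_mem_Icc.2 zero_le_one)
      simp only [h1, tailInt_one, mul_zero, sub_zero]
      rw [Real.zero_rpow (by linarith), mul_zero, zero_div, sub_zero]
      exact h2
  obtain ⟨γ, hγ, hγ0⟩ := intermediate_value_Icc zero_le_one hΞ.continuousOn h01
  have hT0 : 0 ≤ tailInt S γ := tailInt_nonneg hSc hS0 hγ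
  -- Concavity gives `U(t) ≤ μ t`, and integrating `(μ t)^(q-1)` gives the bound. It is what makes
  -- `ρ ≤ 1`.
  have hT : tailInt S γ ≤ μ ^ (q - 1) / q := by
    refine (antitoneOn_tailInt hSc hS0 (left_mem_Icc.2 zero_le_one) hγ hγ.1).trans ?_
    have h1 : ∫ t in (0 : ℝ)..1, S t ≤ ∫ t in (0 : ℝ)..1, μ ^ (q - 1) * t ^ (q - 1) := by
      refine intervalIntegral.integral_mono_on zero_le_one (hSc.intervalIntegrable _ _) ?_ ?_
      · exact (continuous_const.mul (continuous_id.rpow_const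
          fun _ => Or.inr (by linarith))).intervalIntegrable _ _
      · intro t ht
        have h2 : 0 ≤ quarterOp H t := quarterOp_nonneg hw.nonneg ht
        simp only [hS]
        rw [spow_of_nonneg (by linarith) h2, ← Real.mul_rpow hμ0.le ht.1]
        exact Real.rpow_le_rpow h2 (quarterOp_le_mul hw.continuous hw.nonneg ht) (by linarith)
    rw [intervalIntegral.integral_const_mul, integral_rpow (Or.inl (by linarith))] at h1
    simp only [sub_add_cancel, Real.one_rpow, Real.zero_rpow hq0.ne', sub_zero] at h1
    rw [div_eq_mul_one_div]; exact h1
  refine ⟨γ, hγ, ρ γ, ⟨hρ0 γ hγ, ?_⟩, ?_, ?_⟩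
  · refine Real.rpow_le_one (by positivity) ?_ (by positivity)
    rw [div_le_one hμp, mul_comm]
    exact (le_div_iff₀ hq0).1 hT
  · simp only [hρ]
    rw [Real.rpow_inv_rpow (by positivity) hq0.ne']
    field_simp
  · exact sub_eq_zero.1 hγ0

/-- The primitive of the piecewise force: it agrees with the wave between `σ` and `2 N`. -/
theorem twoInt_config (hw : IsWave q Λ H) {σ : ℝ} (hσ : σ ∈ Ioo (0 : ℝ) 1)
    (hσD : tailInt H 0 = 2 * tailInt H σ) {N : ℕ} (hN : 1 ≤ N) {K : ℝ → ℝ} (hK : Integrable K)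
    (hK1 : ∀ x ∈ Ioc (-σ) 0, K x = -H x) (hK2 : ∀ x ∈ Ioc 0 σ, K x = 0)
    (hK3 : ∀ x ∈ Ioc σ (2 * N), K x = -H x) (hK4 : ∀ x, 2 * (N : ℝ) < x → K x = 0) :
    (∀ x ∈ Icc (-σ) σ, quarterOp H x ≤ twoInt (-σ) K x) ∧
    (∀ x ∈ Icc σ (2 * N), twoInt (-σ) K x = quarterOp H x) ∧
    ∀ x, 2 * (N : ℝ) ≤ x → twoInt (-σ) K x = (-1) ^ N * tailInt H 0 * (x - 2 * N) := by
  have hc := hw.continuous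
  have hN' : (1 : ℝ) ≤ N := by exact_mod_cast hN
  obtain ⟨hσ0, hσ1⟩ := hσ
  have hii : ∀ x y, IntervalIntegrable K volume x y := fun x y => hK.intervalIntegrable
  set P : ℝ → ℝ := fun y => ∫ t in -σ..y, K t with hP
  have hPc : Continuous P := intervalIntegral.continuous_primitive hii _
  have hadd : ∀ x y, P y = P x + ∫ t in x..y, K t := fun x y =>
    (intervalIntegral.integral_add_adjacent_intervals (hii _ _) (hii _ _)).symm
  have hP1 : ∀ y ∈ Icc (-σ) 0, P y = tailInt H y - tailInt H σ := by
    intro y hy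
    have : P y = ∫ t in -σ..y, -H t := integral_congr_Ioc hy.1 fun x hx =>
      hK1 x ⟨hx.1, hx.2.trans hy.2⟩
    rw [this, intervalIntegral.integral_neg, integral_eq_tailInt_sub hc, hw.symm.tailInt_neg hc]
    ring
  -- By the choice of `σ`, the slope reached at `0` is already that of the wave at `σ`, and it is
  -- kept across the gap.
  have hP2 : ∀ y ∈ Icc 0 σ, P y = tailInt H σ := by
    intro y hy
    have : ∫ t in (0 : ℝ)..y, K t = ∫ t in (0 : ℝ)..y, (0 : ℝ) := integral_congr_Ioc hy.1
      fun x hx => hK2 x ⟨hx.1, hx.2.trans hy.2⟩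
    rw [hadd 0, this, hP1 0 ⟨by linarith, le_rfl⟩, intervalIntegral.integral_zero]
    linarith
  have hP3 : ∀ y ∈ Icc σ (2 * N), P y = tailInt H y := by
    intro y hy
    have : ∫ t in σ..y, K t = ∫ t in σ..y, -H t := integral_congr_Ioc hy.1
      fun x hx => hK3 x ⟨hx.1, hx.2.trans hy.2⟩
    rw [hadd σ, this, hP2 σ ⟨hσ0.le, le_rfl⟩, intervalIntegral.integral_neg,
      integral_eq_tailInt_sub hc]
    ring
  have hDN : tailInt H (2 * N) = (-1) ^ N * tailInt H 0 := by
    have := hw.symm.tailInt_add_two_mul hc N 0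
    rwa [add_zero] at this
  have hP4 : ∀ y, 2 * (N : ℝ) ≤ y → P y = (-1) ^ N * tailInt H 0 := by
    intro y hy
    have : ∫ t in 2 * (N : ℝ)..y, K t = ∫ t in 2 * (N : ℝ)..y, (0 : ℝ) := integral_congr_Ioc hy
      fun x hx => hK4 x hx.1
    rw [hadd (2 * N), this, hP3 (2 * N) ⟨by linarith, le_rfl⟩, intervalIntegral.integral_zero, hDN,
      add_zero]
  have hPi : ∀ x y, IntervalIntegrable P volume x y := fun x y => hPc.intervalIntegrable x y
  have haddu : ∀ x y, twoInt (-σ) K y = twoInt (-σ) K x + ∫ t in x..y, P t := fun x y =>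
    (intervalIntegral.integral_add_adjacent_intervals (hPi _ _) (hPi _ _)).symm
  have hDc := continuous_tailInt hc
  have hu0 : twoInt (-σ) K (-σ) = 0 := intervalIntegral.integral_same
  have hUσ : quarterOp H (-σ) = -quarterOp H σ := (hw.symm.quarterOp hc).odd σ
  -- The value fits as well: the deficit `σ · tailInt H σ` over `(-σ, 0)` is made up over the gap,
  -- and `∫ tailInt H` over `(-σ, 0)` equals `U(σ)` by oddness.
  have huσ : twoInt (-σ) K σ = quarterOp H σ := by
    have h1 : ∫ t in -σ..0, P t = ∫ t in -σ..0, (tailInt H t - tailInt H σ) :=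
      integral_congr_Ioc (by linarith) fun x hx => hP1 x (Ioc_subset_Icc_self hx)
    have h2 : ∫ t in (0 : ℝ)..σ, P t = ∫ t in (0 : ℝ)..σ, tailInt H σ :=
      integral_congr_Ioc hσ0.le fun x hx => hP2 x (Ioc_subset_Icc_self hx)
    rw [haddu 0, haddu (-σ) 0, hu0, h1, h2, intervalIntegral.integral_sub
      (hDc.intervalIntegrable _ _) intervalIntegrable_const, integral_tailInt hc, quarterOp_zero,
      hUσ]
    simp
  have hu3 : ∀ x ∈ Icc σ (2 * N), twoInt (-σ) K x = quarterOp H x := by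
    intro x hx
    have : ∫ t in σ..x, P t = ∫ t in σ..x, tailInt H t := integral_congr_Ioc hx.1
      fun y hy => hP3 y ⟨hy.1.le, hy.2.trans hx.2⟩
    rw [haddu σ, huσ, this, integral_tailInt hc]
    ring
  refine ⟨fun x hx => ?_, hu3, fun x hx => ?_⟩
  -- The slope is at most that of the wave on `[-σ, σ]`, and both functions agree at `σ`, so going
  -- back to the left `twoInt` lies above.
  · have h1 : ∫ t in x..σ, P t ≤ ∫ t in x..σ, tailInt H t := by
      refine intervalIntegral.integral_mono_on hx.2 (hPi _ _) (hDc.intervalIntegrable _ _) ?_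
      intro t ht
      rcases le_total t 0 with h0 | h0
      · rw [hP1 t ⟨hx.1.trans ht.1, h0⟩]
        have := tailInt_nonneg hc hw.nonneg (x := σ) ⟨hσ0.le, hσ1.le⟩
        linarith
      · rw [hP2 t ⟨h0, ht.2⟩]
        exact antitoneOn_tailInt hc hw.nonneg ⟨h0, ht.2.trans hσ1.le⟩ ⟨hσ0.le, hσ1.le⟩ ht.2
    rw [integral_tailInt hc] at h1
    have := haddu x σ
    linarith
  · have h1 : ∫ t in 2 * (N : ℝ)..x, P t = ∫ t in 2 * (N : ℝ)..x, (-1) ^ N * tailInt H 0 :=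
      integral_congr_Ioc hx fun y hy => hP4 y hy.1.le
    have h2 : quarterOp H (2 * N) = 0 := by
      have := (hw.symm.quarterOp hc).add_two_mul N 0
      rwa [add_zero, quarterOp_zero, mul_zero] at this
    rw [haddu (2 * N), hu3 (2 * N) ⟨by linarith, le_rfl⟩, h1, h2, intervalIntegral.integral_const,
      smul_eq_mul]
    ring

end IsWave

end

/-! ### The dual function and the pieces of the configuration -/

noncomputable section

theorem spow_neg_one_pow {r : ℝ} (hr : 0 < r) (N : ℕ) : spow r ((-1) ^ N) = (-1) ^ N := by
  rcases neg_one_pow_eq_or ℝ N with h | h <;> rw [h]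
  · rw [spow_of_nonneg hr zero_le_one, Real.one_rpow]
  · rw [spow_neg, spow_of_nonneg hr zero_le_one, Real.one_rpow]

theorem integral_sub_rpow {r : ℝ} (hr : 0 < r) (x y z : ℝ) :
    ∫ t in x..y, (t - z) ^ (r - 1) = ((y - z) ^ r - (x - z) ^ r) / r := by
  rw [intervalIntegral.integral_comp_sub_right (fun t => t ^ (r - 1)),
    integral_rpow (Or.inl (by linarith)), sub_add_cancel]

namespace IsWave

variable {q Λ : ℝ} {H : ℝ → ℝ}

/-- The dual function of the configuration, compared with the dual wave. -/
theorem dual_config (hw : IsWave q Λ H) (hq : 1 < q) {σ : ℝ} (hσ : σ ∈ Ioo (0 : ℝ) 1)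
    {N : ℕ} (hN : 1 ≤ N) {u : ℝ → ℝ} (huc : Continuous u)
    (hu1 : ∀ x ∈ Icc (-σ) σ, quarterOp H x ≤ u x)
    (hu2 : ∀ x ∈ Icc σ (2 * N), u x = quarterOp H x)
    (hu3 : ∀ x, 2 * (N : ℝ) ≤ x → u x = (-1) ^ N * tailInt H 0 * (x - 2 * N))
    {γ ρ : ℝ} (hγ : γ ∈ Icc (0 : ℝ) 1) (hρ : 0 ≤ ρ)
    (hm : tailInt (fun t => spow (q - 1) (quarterOp H t)) γ = tailInt H 0 ^ (q - 1) * ρ ^ q / q)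
    (hL : quarterOp (fun t => spow (q - 1) (quarterOp H t)) γ -
        γ * tailInt (fun t => spow (q - 1) (quarterOp H t)) γ =
        tailInt H 0 ^ (q - 1) * ρ ^ (q + 1) / (q + 1))
    {E : Set ℝ} (hE : E = Ioc (-σ) (2 * N - γ) ∪ Ioc (2 * N : ℝ) (2 * N + ρ))
    {v : ℝ → ℝ} (hv : v = fun t => ∫ y in t..2 * N + ρ, ∫ x in y..2 * N + ρ,
      E.indicator (fun x => spow (q - 1) (u x)) x) :
    (∀ t ∈ Icc (-σ) σ, 0 ≤ v t + quarterOp (fun t => spow (q - 1) (quarterOp H t)) t) ∧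
    (∀ t ∈ Icc σ (2 * N - γ), v t + quarterOp (fun t => spow (q - 1) (quarterOp H t)) t = 0) ∧
    ∀ t ∈ Icc (2 * N - γ) (2 * N),
      0 ≤ (-1) ^ N * (v t + quarterOp (fun t => spow (q - 1) (quarterOp H t)) t) := by
  set S : ℝ → ℝ := fun t => spow (q - 1) (quarterOp H t) with hS
  have hq0 : 0 < q - 1 := by linarith
  have hSc : Continuous S := hw.continuous_force hq
  have hS0 : ∀ x ∈ Icc (0 : ℝ) 1, 0 ≤ S x := hw.force_nonneg hq
  have hSs : WaveSymm S := hw.symm_force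
  have hEc := continuous_tailInt hSc
  have hN' : (1 : ℝ) ≤ N := by exact_mod_cast hN
  obtain ⟨hσ0, hσ1⟩ := hσ
  obtain ⟨hγ0, hγ1⟩ := hγ
  set X : ℝ := 2 * N with hX
  set C : ℝ := X + ρ with hC
  set b : ℝ := X - γ with hb
  set κ : ℝ := (-1) ^ N with hκ
  have hκκ : κ * κ = 1 := by rw [hκ, ← mul_pow]; norm_num
  set μ := tailInt H 0 with hμ
  have hμ0 : 0 < μ := tailInt_zero_pos hw.continuous hw.nonneg (hw.exists_pos hq)
  set s : ℝ → ℝ := fun x => spow (q - 1) (u x) with hs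
  have hsc : Continuous s := (continuous_spow hq0).comp huc
  have hEm : MeasurableSet E := by rw [hE]; measurability
  set Z : ℝ → ℝ := E.indicator s with hZ
  have hZi : Integrable Z := by
    rw [hZ, integrable_indicator_iff hEm, hE]
    exact (hsc.integrableOn_Ioc).union hsc.integrableOn_Ioc
  have hii : ∀ x y, IntervalIntegrable Z volume x y := fun x y => hZi.intervalIntegrable
  set T : ℝ → ℝ := fun y => ∫ x in y..C, Z x with hT
  have hTc : Continuous T :=
    (intervalIntegral.continuous_primitive hii C).neg.congr
      fun y => (intervalIntegral.integral_symm _ _).symm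
  have hTi : ∀ x y, IntervalIntegrable T volume x y := fun x y => hTc.intervalIntegrable x y
  have hTadd : ∀ x y, T x = (∫ t in x..y, Z t) + T y := fun x y =>
    (intervalIntegral.integral_add_adjacent_intervals (hii _ _) (hii _ _)).symm
  have hvadd : ∀ x y, v x = (∫ t in x..y, T t) + v y := fun x y => by
    rw [hv]
    exact (intervalIntegral.integral_add_adjacent_intervals (hTi _ _) (hTi _ _)).symm
  have hZ1 : ∀ x ∈ Ioc (-σ) b, Z x = s x := fun x hx =>
    indicator_of_mem (by rw [hE]; exact Or.inl hx) _
  have hZ2 : ∀ x ∈ Ioc b X, Z x = 0 := fun x hx => by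
    refine indicator_of_notMem ?_ _
    rw [hE]
    rintro (h | h)
    · exact (hx.1.trans_le h.2).false
    · exact (h.1.trans_le hx.2).false
  have hZ3 : ∀ x ∈ Ioc X C, Z x = κ * μ ^ (q - 1) * (x - X) ^ (q - 1) := fun x hx => by
    have h1 : Z x = s x := indicator_of_mem (by rw [hE]; exact Or.inr hx) _
    rw [h1, hs]
    simp only
    rw [hu3 x hx.1.le, mul_assoc, spow_mul hq0, spow_neg_one_pow hq0, spow_mul hq0,
      spow_of_nonneg hq0 hμ0.le, spow_of_nonneg hq0 (sub_nonneg.2 hx.1.le), mul_assoc]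
  have hT3 : ∀ y ∈ Icc X C, T y = κ * μ ^ (q - 1) * ((ρ ^ q - (y - X) ^ q) / q) := by
    intro y hy
    have h1 : T y = ∫ x in y..C, κ * μ ^ (q - 1) * (x - X) ^ (q - 1) :=
      integral_congr_Ioc hy.2 fun x hx => hZ3 x ⟨hy.1.trans_lt hx.1, hx.2⟩
    rw [h1, intervalIntegral.integral_const_mul, integral_sub_rpow (by linarith), hC,
      add_sub_cancel_left]
  set m := tailInt S γ with hmdef
  -- The linear stretch of length `ρ` produces exactly the slope that the dual wave has at `2N - γ`;
  -- since `E` skips `(2N - γ, 2N]`, the slope is carried there unchanged.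
  have hTX : T X = κ * m := by
    rw [hT3 X ⟨le_rfl, by linarith⟩, sub_self, Real.zero_rpow (by linarith), sub_zero, hm]
    ring
  have hT2 : ∀ y ∈ Icc b X, T y = κ * m := by
    intro y hy
    have h1 : ∫ x in y..X, Z x = ∫ x in y..X, (0 : ℝ) := integral_congr_Ioc hy.2
      fun x hx => hZ2 x ⟨hy.1.trans_lt hx.1, hx.2⟩
    rw [hTadd y X, h1, intervalIntegral.integral_zero, zero_add, hTX]
  have hvX : v X = κ * (quarterOp S γ - γ * m) := by
    have h1 : v X = ∫ y in X..C, κ * μ ^ (q - 1) * ((ρ ^ q - (y - X) ^ q) / q) := by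
      rw [hv]
      exact integral_congr_Ioc (by linarith) fun x hx => hT3 x (Ioc_subset_Icc_self hx)
    have h2 := integral_sub_rpow (r := q + 1) (by linarith) X C X
    rw [add_sub_cancel_right, hC, add_sub_cancel_left, sub_self, Real.zero_rpow (by linarith),
      sub_zero] at h2
    rw [h1, intervalIntegral.integral_const_mul, intervalIntegral.integral_div,
      intervalIntegral.integral_sub intervalIntegrable_const, h2, hL,
      intervalIntegral.integral_const, smul_eq_mul, add_sub_cancel_left,
      Real.rpow_add_one' hρ (by linarith)]
    · field_simp
      ring
    · exact ((continuous_id.sub continuous_const).rpow_const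
        fun _ => Or.inr (by linarith)).intervalIntegrable _ _
  have hv2 : ∀ t ∈ Icc b X, v t = κ * (quarterOp S γ - (γ - (X - t)) * m) := by
    intro t ht
    have h1 : ∫ y in t..X, T y = ∫ y in t..X, κ * m := integral_congr_Ioc ht.2
      fun x hx => hT2 x ⟨ht.1.trans hx.1.le, hx.2⟩
    rw [hvadd t X, h1, hvX, intervalIntegral.integral_const, smul_eq_mul]
    ring
  have hW : ∀ t, quarterOp S t = -(κ * quarterOp S (X - t)) := by
    intro t
    have h1 := (hSs.quarterOp hSc).add_two_mul N (-(X - t))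
    rw [show 2 * (N : ℝ) + -(X - t) = t by rw [hX]; ring, (hSs.quarterOp hSc).odd] at h1
    rw [h1]; ring
  have hEb : tailInt S b = κ * m := by
    have h1 := hSs.tailInt_add_two_mul hSc N (-γ)
    rwa [hSs.tailInt_neg hSc, show 2 * (N : ℝ) + -γ = b by rw [hb, hX]; ring] at h1
  have hbX : b ≤ X := by linarith
  -- The second tuning equation `hL`, used through `hvX`, matches the values at `b`; with the slopes
  -- matched too, `v` follows the dual wave down to `σ`.
  have hvb : v b = -quarterOp S b := by
    rw [hv2 b ⟨le_rfl, hbX⟩, hW b, hb]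
    simp
  have hσb : σ ≤ b := by linarith
  have hT1 : ∀ y ∈ Icc σ b, T y = tailInt S y := by
    intro y hy
    have h1 : ∫ x in y..b, Z x = ∫ x in y..b, S x := integral_congr_Ioc hy.2 fun x hx => by
      rw [hZ1 x ⟨by linarith [hx.1, hy.1], hx.2⟩, hs, hS]
      simp only
      rw [hu2 x ⟨hy.1.trans hx.1.le, hx.2.trans hbX⟩]
    rw [hTadd y b, h1, integral_eq_tailInt_sub hSc, hT2 b ⟨le_rfl, hbX⟩, hEb]
    ring
  have hv1 : ∀ t ∈ Icc σ b, v t = -quarterOp S t := by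
    intro t ht
    have h1 : ∫ y in t..b, T y = ∫ y in t..b, tailInt S y := integral_congr_Ioc ht.2
      fun x hx => hT1 x ⟨ht.1.trans hx.1.le, hx.2⟩
    rw [hvadd t b, h1, integral_tailInt hSc, hvb]
    ring
  -- On `[-σ, σ]` the force of `u` dominates that of the wave, since `u ≥ U` and the signed power is
  -- increasing.
  have hT0 : ∀ y ∈ Icc (-σ) σ, tailInt S y ≤ T y := by
    intro y hy
    have h1 : ∫ x in y..σ, S x ≤ ∫ x in y..σ, Z x := by
      rw [intervalIntegral.integral_of_le hy.2, intervalIntegral.integral_of_le hy.2]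
      refine setIntegral_mono_on hSc.integrableOn_Ioc hZi.integrableOn measurableSet_Ioc ?_
      intro x hx
      rw [hZ1 x ⟨hy.1.trans_lt hx.1, hx.2.trans hσb⟩]
      exact (spow_strictMono hq0).monotone (hu1 x ⟨hy.1.trans hx.1.le, hx.2⟩)
    rw [integral_eq_tailInt_sub hSc] at h1
    rw [hTadd y σ, hT1 σ ⟨le_rfl, hσb⟩]
    linarith
  refine ⟨fun t ht => ?_, fun t ht => by rw [hv1 t ht, neg_add_cancel], fun t ht => ?_⟩
  · have h1 : ∫ y in t..σ, tailInt S y ≤ ∫ y in t..σ, T y :=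
      intervalIntegral.integral_mono_on ht.2 (hEc.intervalIntegrable _ _) (hTi _ _)
        fun x hx => hT0 x ⟨ht.1.trans hx.1, hx.2⟩
    rw [integral_tailInt hSc] at h1
    rw [hvadd t σ, hv1 σ ⟨le_rfl, hσb⟩]
    linarith
  -- On the skipped interval `v` is affine, up to sign the tangent to the dual wave at `γ`, and
  -- concavity decides the inequality.
  · have h1 := quarterOp_le_tangent hSc hS0 (y := X - t) (γ := γ) (by linarith [ht.2])
      (by linarith [ht.1]) hγ1
    have h2 : κ * (v t + quarterOp S t) =
        κ * κ * (quarterOp S γ - (γ - (X - t)) * m - quarterOp S (X - t)) := by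
      rw [hv2 t ht, hW t]; ring
    rw [h2, hκκ]
    linarith

/-- The left endpoint of the `j`-th piece of the configuration. -/
def pieceLeft (σ : ℝ) : ℕ → ℝ
  | 0 => -σ
  | j + 1 => max σ (2 * j)

/-- The `j`-th piece of the configuration. -/
def piece (H : ℝ → ℝ) (σ : ℝ) (j : ℕ) : ℝ → ℝ :=
  (Ioc (pieceLeft σ j) (2 * j)).indicator fun t => |H t|

theorem piece_nonneg (H : ℝ → ℝ) (σ : ℝ) (j : ℕ) (t : ℝ) : 0 ≤ piece H σ j t :=
  indicator_nonneg (fun _ _ => abs_nonneg _) _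

theorem mem_of_piece_ne_zero {σ : ℝ} {j : ℕ} {t : ℝ} (h : piece H σ j t ≠ 0) :
    t ∈ Ioc (pieceLeft σ j) (2 * j) := by
  by_contra hc
  exact h (indicator_of_notMem hc _)

theorem two_mul_le_pieceLeft (σ : ℝ) {i j : ℕ} (hij : i < j) :
    (2 * i : ℝ) ≤ pieceLeft σ j := by
  obtain ⟨j, rfl⟩ := Nat.exists_eq_add_of_lt hij
  refine le_trans ?_ (le_max_right _ _)
  push_cast
  linarith [Nat.cast_nonneg (α := ℝ) j]

theorem piece_lt_piece {σ : ℝ} {i j : ℕ} (hij : i < j) {t t' : ℝ}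
    (h : piece H σ i t ≠ 0) (h' : piece H σ j t' ≠ 0) : t < t' :=
  ((mem_of_piece_ne_zero h).2.trans (two_mul_le_pieceLeft σ hij)).trans_lt
    (mem_of_piece_ne_zero h').1

theorem two_mul_sub_le_pieceLeft {σ : ℝ} (hσ : σ ≤ 2) (j : ℕ) :
    (2 * j - 2 : ℝ) ≤ pieceLeft σ j := by
  rcases j with _ | j
  · simp only [pieceLeft]; push_cast; linarith
  · refine le_trans (le_of_eq ?_) (le_max_right _ _)
    push_cast; ring

theorem pieceLeft_lt {σ : ℝ} (hσ : σ ∈ Ioo (0 : ℝ) 2) (j : ℕ) : pieceLeft σ j < 2 * j := by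
  rcases j with _ | j
  · simp only [pieceLeft]; push_cast; linarith [hσ.1]
  · refine max_lt ?_ ?_ <;> push_cast <;> linarith [hσ.2, Nat.cast_nonneg (α := ℝ) j]

theorem piece_eq (hw : IsWave q Λ H) {σ : ℝ} (hσ : σ ≤ 2) {j : ℕ} {t : ℝ}
    (ht : t ∈ Ioc (pieceLeft σ j) (2 * j)) : piece H σ j t = -((-1) ^ j * H t) := by
  have h1 := hw.eq_two_mul_sub j t
  have h2 := two_mul_sub_le_pieceLeft hσ j
  have h3 : 0 ≤ H (2 * j - t) := hw.nonneg_two ⟨by linarith [ht.2], by linarith [ht.1]⟩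
  have h4 : ((-1 : ℝ) ^ j) * (-1) ^ j = 1 := by rw [← mul_pow]; norm_num
  rw [piece, indicator_of_mem ht, h1, abs_neg, abs_mul, abs_pow, abs_neg, abs_one, one_pow,
    one_mul, abs_of_nonneg h3]
  linear_combination (-H (2 * j - t)) * h4

theorem integrable_piece (hw : IsWave q Λ H) (σ : ℝ) (j : ℕ) : Integrable (piece H σ j) := by
  rw [piece, integrable_indicator_iff measurableSet_Ioc]
  exact hw.continuous.abs.integrableOn_Ioc

theorem measurable_piece (hw : IsWave q Λ H) (σ : ℝ) (j : ℕ) : Measurable (piece H σ j) :=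
  hw.continuous.abs.measurable.indicator measurableSet_Ioc

theorem integral_piece_rpow_pos (hw : IsWave q Λ H) (hq : 1 < q) {σ : ℝ}
    (hσ : σ ∈ Ioo (0 : ℝ) 2) (j : ℕ) : 0 < ∫ t, piece H σ j t ^ q := by
  have h1 : ∀ t, piece H σ j t ^ q =
      (Ioc (pieceLeft σ j) (2 * j)).indicator (fun t => |H t| ^ q) t := by
    intro t
    simp only [piece, indicator]
    split_ifs
    · rfl
    · exact Real.zero_rpow (by linarith)
  simp only [h1]
  rw [integral_indicator measurableSet_Ioc, ← intervalIntegral.integral_of_le (pieceLeft_lt hσ j).le]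
  have hc : Continuous fun t => |H t| ^ q :=
    hw.continuous.abs.rpow_const fun _ => Or.inr (by linarith)
  refine intervalIntegral.intervalIntegral_pos_of_pos_on (hc.intervalIntegrable _ _) (fun t ht => ?_)
    (pieceLeft_lt hσ j)
  have h2 := two_mul_sub_le_pieceLeft hσ.2.le j
  have h3 : 0 < H (2 * j - t) := hw.pos hq ⟨by linarith [ht.2], by linarith [ht.1]⟩
  rw [hw.eq_two_mul_sub j t, abs_neg, abs_mul, abs_pow, abs_neg, abs_one, one_pow, one_mul]
  exact Real.rpow_pos_of_pos (abs_pos.2 h3.ne') _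

theorem sum_piece_of_mem (hw : IsWave q Λ H) {σ : ℝ} (hσ : σ ∈ Ioo (0 : ℝ) 2) {n : ℕ} (j : Fin n)
    {t : ℝ} (ht : t ∈ Ioc (pieceLeft σ j) (2 * j)) :
    ∑ i : Fin n, (-1) ^ (i : ℕ) * piece H σ i t = -H t := by
  have h4 : ((-1 : ℝ) ^ (j : ℕ)) * (-1) ^ (j : ℕ) = 1 := by rw [← mul_pow]; norm_num
  rw [Finset.sum_eq_single j, hw.piece_eq hσ.2.le ht]
  · linear_combination (-H t) * h4
  · intro i _ hij
    have : piece H σ i t = 0 := by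
      by_contra hc
      have hi := mem_of_piece_ne_zero hc
      rcases lt_or_gt_of_ne hij with h | h
      · exact (ht.1.trans_le (hi.2.trans (two_mul_le_pieceLeft σ h))).false
      · exact (hi.1.trans_le (ht.2.trans (two_mul_le_pieceLeft σ h))).false
    rw [this, mul_zero]
  · simp

theorem sum_piece_of_forall_notMem {σ : ℝ} {n : ℕ} {t : ℝ}
    (ht : ∀ j : Fin n, t ∉ Ioc (pieceLeft σ j) (2 * j)) :
    ∑ i : Fin n, (-1) ^ (i : ℕ) * piece H σ i t = 0 :=
  Finset.sum_eq_zero fun i _ => by rw [piece, indicator_of_notMem (ht i), mul_zero]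

theorem exists_mem_piece {σ : ℝ} (hσ : σ ∈ Ioo (0 : ℝ) 2) {N : ℕ} {t : ℝ}
    (ht : t ∈ Ioc σ (2 * N)) : ∃ j : Fin (N + 1), t ∈ Ioc (pieceLeft σ j) (2 * j) := by
  have ht0 : 0 < t / 2 := by linarith [hσ.1, ht.1]
  have h1 := Nat.le_ceil (t / 2)
  have h2 := Nat.ceil_lt_add_one ht0.le
  have h3 : ⌈t / 2⌉₊ ≤ N := Nat.ceil_le.2 (by linarith [ht.2])
  have h4 : 0 < ⌈t / 2⌉₊ := Nat.ceil_pos.2 ht0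
  obtain ⟨k, hk⟩ := Nat.exists_eq_add_of_lt h4
  refine ⟨⟨⌈t / 2⌉₊, by omega⟩, ?_, by simp only; linarith⟩
  simp only
  rw [hk] at h2 ⊢
  push_cast at h2
  exact max_lt ht.1 (by push_cast; linarith)

end IsWave

end

/-! ### Lower bounds for twofold integration on the span of the pieces -/

noncomputable section

namespace IsWave

variable {q Λ : ℝ} {H : ℝ → ℝ}

theorem integral_piece_rpow (hq : 1 < q) {σ A C : ℝ} {j : ℕ}
    (hA : A ≤ pieceLeft σ j) (hC : 2 * j ≤ C) (hAC : A ≤ C) :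
    ∫ t, piece H σ j t ^ q = ∫ t in A..C, piece H σ j t ^ q := by
  rw [intervalIntegral.integral_of_le hAC]
  refine (setIntegral_eq_integral_of_forall_compl_eq_zero fun t ht => ?_).symm
  rw [piece, indicator_of_notMem, Real.zero_rpow (by linarith)]
  exact fun h => ht ⟨hA.trans_lt h.1, h.2.trans hC⟩

/-- On the `j`-th piece the Euler equation equates the dual wave with `-(-1)^j Λ^q` times the
`(q-1)`-th power of the piece; the sign hypothesis therefore bounds `(-1)^j V` below. -/
theorem dual_piece_le (hw : IsWave q Λ H) (hq : 1 < q) {σ : ℝ} (hσ : σ ≤ 2) (j : ℕ) {t V : ℝ}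
    (hV : t ∈ Ioc (pieceLeft σ j) (2 * j) →
      0 ≤ (-1) ^ j * (V + quarterOp (fun t => spow (q - 1) (quarterOp H t)) t)) :
    Λ ^ q * piece H σ j t ^ q ≤ (-1) ^ j * (V * piece H σ j t) := by
  by_cases ht : t ∈ Ioc (pieceLeft σ j) (2 * j)
  · have hq0 : 0 < q - 1 := by linarith
    have h1 := hV ht
    have hp := hw.piece_eq hσ ht
    have hp0 := piece_nonneg H σ j t
    have h4 : ((-1 : ℝ) ^ j) * (-1) ^ j = 1 := by rw [← mul_pow]; norm_num
    have hH : H t = (-1) ^ j * -piece H σ j t := by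
      rw [hp]; linear_combination (-H t) * h4
    rw [hw.euler, hH, spow_mul hq0, spow_neg_one_pow hq0, spow_neg, spow_of_nonneg hq0 hp0] at h1
    have h2 : piece H σ j t ^ q = piece H σ j t ^ (q - 1) * piece H σ j t := by
      rw [← Real.rpow_add_one' hp0 (by linarith), sub_add_cancel]
    rw [h2]
    have h3 : Λ ^ q * piece H σ j t ^ (q - 1) ≤ (-1) ^ j * V := by
      have : (-1) ^ j * (V + Λ ^ q * ((-1) ^ j * -piece H σ j t ^ (q - 1))) =
          (-1) ^ j * V - Λ ^ q * piece H σ j t ^ (q - 1) := by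
        linear_combination (-(Λ ^ q * piece H σ j t ^ (q - 1))) * h4
      linarith
    nlinarith [mul_le_mul_of_nonneg_right h3 hp0]
  · rw [piece, indicator_of_notMem ht, Real.zero_rpow (by linarith)]
    simp

theorem exists_half (hw : IsWave q Λ H) (hq : 1 < q) :
    ∃ σ ∈ Ioo (0 : ℝ) 1, tailInt H 0 = 2 * tailInt H σ := by
  have hμ0 : 0 < tailInt H 0 := tailInt_zero_pos hw.continuous hw.nonneg (hw.exists_pos hq)
  obtain ⟨σ, hσ, h⟩ := intermediate_value_Ioo' zero_le_one
    (continuous_tailInt hw.continuous).continuousOn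
    (show tailInt H 0 / 2 ∈ Ioo (tailInt H 1) (tailInt H 0) by
      rw [tailInt_one]; constructor <;> linarith)
  exact ⟨σ, hσ, by rw [h]; ring⟩

/-- The dual inequality required by `bernstein_of_alternating` holds with `L = Λ^q`: Fubini moves
the twofold integral onto the dual function `v`, and `dual_config` compares `v` with the dual wave
pointwise. -/
theorem config_bound (hw : IsWave q Λ H) (hq : 1 < q) {N : ℕ} (hN : 1 ≤ N) :
    ∃ σ ∈ Ioo (0 : ℝ) 1, ∃ ρ ∈ Icc (0 : ℝ) 1, ∀ c : Fin (N + 1) → ℝ,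
      Λ ^ q * ∑ i : Fin (N + 1), |c i| ^ q * ∫ t, piece H σ i t ^ q ≤
        ∫ x in Icc (-σ) (2 * N + ρ), |∑ i : Fin (N + 1), c i * twoInt (-σ) (piece H σ i) x| ^ q := by
  obtain ⟨σ, hσ, hσD⟩ := hw.exists_half hq
  obtain ⟨γ, hγ, ρ, hρ, hm, hL⟩ := hw.exists_end hq
  refine ⟨σ, hσ, ρ, hρ, fun c => ?_⟩
  have hq0 : 0 < q - 1 := by linarith
  have hσ2 : σ ∈ Ioo (0 : ℝ) 2 := ⟨hσ.1, hσ.2.trans one_lt_two⟩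
  have hN' : (1 : ℝ) ≤ N := by exact_mod_cast hN
  have hAC : -σ ≤ 2 * N + ρ := by linarith [hσ.1, hρ.1]
  have hpi : ∀ i : Fin (N + 1), Integrable (piece H σ i) := fun i => hw.integrable_piece σ i
  set K : ℝ → ℝ := fun t => ∑ i : Fin (N + 1), (-1) ^ (i : ℕ) * piece H σ i t with hK
  have hKi : Integrable K := integrable_finsetSum _ fun i _ => (hpi i).const_mul _
  have hu : ∀ x, twoInt (-σ) K x =
      ∑ i : Fin (N + 1), (-1) ^ (i : ℕ) * twoInt (-σ) (piece H σ i) x :=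
    twoInt_sum _ _ hpi
  obtain ⟨hu1, hu2, hu3⟩ := hw.twoInt_config hσ hσD hN hKi
    (fun x hx => hw.sum_piece_of_mem hσ2 (0 : Fin (N + 1)) (by simpa [pieceLeft] using hx))
    (fun x hx => sum_piece_of_forall_notMem fun j hj => by
      rcases j with ⟨_ | j, hj'⟩
      · have := hj.2
        simp only [Nat.cast_zero, mul_zero] at this
        linarith [hx.1]
      · exact ((le_max_left _ _).trans_lt hj.1).not_ge hx.2)
    (fun x hx => by
      obtain ⟨j, hj⟩ := exists_mem_piece hσ2 hx
      exact hw.sum_piece_of_mem hσ2 j hj)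
    (fun x hx => sum_piece_of_forall_notMem fun j hj => by
      have h1 : ((j : ℕ) : ℝ) ≤ N := by exact_mod_cast Nat.lt_succ_iff.1 j.2
      linarith [hj.2])
  set E : Set ℝ := Ioc (-σ) (2 * N - γ) ∪ Ioc (2 * N : ℝ) (2 * N + ρ) with hE
  have hEm : MeasurableSet E := by rw [hE]; measurability
  have hEs : E ⊆ Ioc (-σ) (2 * N + ρ) := by
    rw [hE]
    exact union_subset (Ioc_subset_Ioc le_rfl (by linarith [hγ.1, hρ.1]))
      (Ioc_subset_Ioc (by linarith [hσ.1]) le_rfl)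
  have huc : Continuous (twoInt (-σ) K) := continuous_twoInt hKi
  set v : ℝ → ℝ := fun t => ∫ y in t..2 * N + ρ, ∫ x in y..2 * N + ρ,
      E.indicator (fun x => spow (q - 1) (twoInt (-σ) K x)) x with hv
  obtain ⟨hd1, hd2, hd3⟩ := hw.dual_config hq hσ hN huc hu1 hu2 hu3 hγ hρ.1 hm hL hE hv
  set Z : ℝ → ℝ := E.indicator (fun x => spow (q - 1) (twoInt (-σ) K x)) with hZ
  have hZi : Integrable Z := by
    rw [hZ, integrable_indicator_iff hEm]
    exact (((continuous_spow hq0).comp huc).integrableOn_Ioc).mono_set hEs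
  have hvc : Continuous v := by
    have hT : Continuous fun y => ∫ x in y..2 * N + ρ, Z x :=
      (intervalIntegral.continuous_primitive (fun _ _ => hZi.intervalIntegrable) _).neg.congr
        fun y => (intervalIntegral.integral_symm _ _).symm
    exact (intervalIntegral.continuous_primitive (fun _ _ => hT.intervalIntegrable _ _) _).neg.congr
        fun y => (intervalIntegral.integral_symm _ _).symm
  refine (bernstein_of_alternating hq hAC (fun i t => piece_nonneg H σ i t) hpi
    (fun i j hij t t' => piece_lt_piece (σ := σ) hij)
    (fun i => hw.integral_piece_rpow_pos hq hσ2 i) hEm (hEs.trans Ioc_subset_Icc_self)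
    (fun i => ?_) c).trans ?_
  · have hi : ((i : ℕ) : ℝ) ≤ N := by exact_mod_cast Nat.lt_succ_iff.1 i.2
    have e1 : ∫ x in E, spow (q - 1) (∑ j : Fin (N + 1),
        (-1) ^ (j : ℕ) * twoInt (-σ) (piece H σ j) x) * twoInt (-σ) (piece H σ i) x =
        ∫ t in -σ..2 * N + ρ, v t * piece H σ i t := by
      rw [← integral_mul_twoInt hAC hZi (hpi i), intervalIntegral.integral_of_le hAC]
      simp only [← hu]
      have : ∀ x, Z x * twoInt (-σ) (piece H σ i) x = E.indicator (fun x =>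
          spow (q - 1) (twoInt (-σ) K x) * twoInt (-σ) (piece H σ i) x) x := by
        intro x
        simp only [hZ, indicator]
        split_ifs <;> ring
      simp only [this]
      rw [setIntegral_indicator hEm, inter_eq_right.2 hEs]
    have hle : -σ ≤ pieceLeft σ i := by
      rcases i with ⟨_ | i, hi'⟩
      · exact le_rfl
      · exact le_trans (by linarith [hσ.1]) (le_max_left _ _)
    rw [e1, integral_piece_rpow hq hle (by linarith [hρ.1]) hAC,
      ← intervalIntegral.integral_const_mul, ← intervalIntegral.integral_const_mul]
    refine intervalIntegral.integral_mono_on hAC ?_ ?_ fun t _ =>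
      hw.dual_piece_le hq hσ2.2.le i fun ht => ?_
    · refine IntervalIntegrable.const_mul ?_ _
      have h1 : (fun t => piece H σ i t ^ q) =
          (Ioc (pieceLeft σ i) (2 * i)).indicator (fun t => |H t| ^ q) := by
        ext t
        simp only [piece, indicator]
        split_ifs
        · rfl
        · exact Real.zero_rpow (by linarith)
      rw [h1]
      refine Integrable.intervalIntegrable ((integrable_indicator_iff measurableSet_Ioc).2 ?_)
      exact (hw.continuous.abs.rpow_const fun _ => Or.inr (by linarith)).integrableOn_Ioc
    · exact ((hpi i).intervalIntegrable.continuousOn_mul hvc.continuousOn).const_mul _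
    · rcases i with ⟨_ | i, hi'⟩
      · simp only [pieceLeft, Nat.cast_zero, mul_zero] at ht
        simpa using hd1 t ⟨ht.1.le, ht.2.trans hσ.1.le⟩
      · have htσ : σ < t := (le_max_left _ _).trans_lt ht.1
        rcases le_total t (2 * N - γ) with h | h
        · rw [hd2 t ⟨htσ.le, h⟩, mul_zero]
        · have ht2 := ht.2
          -- As `γ ≤ 1`, only the last piece meets the skipped interval, so its sign is the `(-1)^N`
          -- of `dual_config`.
          have hiN : i + 1 = N := by
            have h1 : (N : ℝ) < (i + 1 : ℕ) + 1 := by linarith [hγ.2]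
            have h2 : N < i + 1 + 1 := by exact_mod_cast h1
            omega
          simp only [hiN] at ht2 ⊢
          exact hd3 t ⟨h, ht2⟩
  -- Restoring the part skipped by `E` only increases the right-hand side.
  · refine setIntegral_mono_set ?_ (Eventually.of_forall fun x => by positivity)
      (hEs.trans Ioc_subset_Icc_self).eventuallyLE
    have : Continuous fun x => |∑ i : Fin (N + 1), c i * twoInt (-σ) (piece H σ i) x| := by
      have := fun i : Fin (N + 1) => continuous_twoInt (A := -σ) (hpi i)
      fun_prop
    exact (this.rpow_const fun _ => Or.inr (by linarith)).continuousOn.integrableOn_Icc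

/-- A single piece needs no gap and no tuning at the right end. On `[0, 1]` its twofold integral
grows at least with slope `U'(0)`, hence dominates the concave `U`; pairing the Euler equation with
`H` gives `∫ U^q = Λ^q ∫ H^q` over `(0, 1)`. -/
theorem config_bound_one (hw : IsWave q Λ H) (hq : 1 < q) (c : ℝ) :
    Λ ^ q * (|c| ^ q * ∫ t, piece H 1 0 t ^ q) ≤
      ∫ x in Icc (-1 : ℝ) 1, |c * twoInt (-1) (piece H 1 0) x| ^ q := by
  have hc := hw.continuous
  have hpi := hw.integrable_piece 1 0
  have hii : ∀ x y, IntervalIntegrable (piece H 1 0) volume x y := fun x y => hpi.intervalIntegrable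
  set τ := twoInt (-1) (piece H 1 0) with hτ
  have hτc : Continuous τ := continuous_twoInt hpi
  have hpow : ∀ f : ℝ → ℝ, Continuous f → Continuous fun x => |f x| ^ q := fun f hf =>
    hf.abs.rpow_const fun _ => Or.inr (by linarith)
  have hν : ∫ t, piece H 1 0 t ^ q = ∫ t in (0 : ℝ)..1, |H t| ^ q := by
    rw [integral_piece_rpow (A := -1) (C := 0) hq le_rfl (by simp) (by norm_num)]
    have h1 : ∫ t in (-1 : ℝ)..0, piece H 1 0 t ^ q = ∫ t in (-1 : ℝ)..0, |H t| ^ q :=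
      integral_congr_Ioc (by norm_num) fun x hx => by
        rw [piece, indicator_of_mem (by simpa [pieceLeft] using hx)]
    have h2 := intervalIntegral.integral_comp_neg (a := (0 : ℝ)) (b := 1) fun t => |H t| ^ q
    simp only [hw.symm.odd, abs_neg, neg_zero] at h2
    rw [h1, h2]
  have hE : Λ ^ q * ∫ t in (0 : ℝ)..1, |H t| ^ q = ∫ t in (0 : ℝ)..1, |quarterOp H t| ^ q := by
    have h1 := integral_mul_quarterOp (f := H) (g := fun t => spow (q - 1) (quarterOp H t))
      (hc.integrableOn_Ioc.mono_set Ioo_subset_Ioc_self)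
      ((hw.continuous_force hq).integrableOn_Ioc.mono_set Ioo_subset_Ioc_self)
    have h2 : ∀ x, H x * (Λ ^ q * spow (q - 1) (H x)) = Λ ^ q * |H x| ^ q := fun x => by
      rw [mul_left_comm, mul_spow (by linarith), sub_add_cancel]
    simp only [hw.euler, h2, mul_spow (show 0 < q - 1 by linarith), sub_add_cancel] at h1
    rwa [intervalIntegral.integral_const_mul] at h1
  have hτU : ∀ x ∈ Icc (0 : ℝ) 1, |quarterOp H x| ^ q ≤ |τ x| ^ q := by
    intro x hx
    have hU0 : 0 ≤ quarterOp H x := quarterOp_nonneg hw.nonneg hx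
    refine Real.rpow_le_rpow (abs_nonneg _) (abs_le_abs_of_nonneg hU0 ?_) (by linarith)
    have hP : Continuous fun y => ∫ t in (-1 : ℝ)..y, piece H 1 0 t :=
      intervalIntegral.continuous_primitive hii _
    have h1 : τ x = τ 0 + ∫ y in (0 : ℝ)..x, ∫ t in (-1 : ℝ)..y, piece H 1 0 t :=
      (intervalIntegral.integral_add_adjacent_intervals (hP.intervalIntegrable _ _)
        (hP.intervalIntegrable _ _)).symm
    have h2 : 0 ≤ τ 0 := intervalIntegral.integral_nonneg (by norm_num) fun y hy =>
      intervalIntegral.integral_nonneg hy.1 fun t _ => piece_nonneg _ _ _ _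
    have h3 : ∀ y ∈ Icc 0 x, tailInt H 0 ≤ ∫ t in (-1 : ℝ)..y, piece H 1 0 t := by
      intro y hy
      have h4 : ∫ t in (-1 : ℝ)..0, piece H 1 0 t = ∫ t in (-1 : ℝ)..0, -H t :=
        integral_congr_Ioc (by norm_num) fun x hx => by
          rw [hw.piece_eq one_le_two (by simpa [pieceLeft] using hx)]; simp
      have h5 := intervalIntegral.integral_comp_neg (a := (0 : ℝ)) (b := 1) fun t => -H t
      simp only [hw.symm.odd, neg_neg, neg_zero] at h5
      have h6 : 0 ≤ ∫ t in (0 : ℝ)..y, piece H 1 0 t :=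
        intervalIntegral.integral_nonneg hy.1 fun t _ => piece_nonneg _ _ _ _
      rw [← intervalIntegral.integral_add_adjacent_intervals (hii _ 0) (hii _ _), h4, ← h5]
      exact le_add_of_nonneg_right h6
    have h7 : ∫ y in (0 : ℝ)..x, tailInt H 0 ≤
        ∫ y in (0 : ℝ)..x, ∫ t in (-1 : ℝ)..y, piece H 1 0 t :=
      intervalIntegral.integral_mono_on hx.1 intervalIntegrable_const (hP.intervalIntegrable _ _) h3
    rw [intervalIntegral.integral_const, smul_eq_mul, sub_zero] at h7
    have := quarterOp_le_mul hc hw.nonneg hx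
    linarith
  have hm : ∫ t in (0 : ℝ)..1, |quarterOp H t| ^ q ≤ ∫ x in Icc (-1 : ℝ) 1, |τ x| ^ q := by
    refine (intervalIntegral.integral_mono_on zero_le_one
      ((hpow _ (continuous_quarterOp hc)).intervalIntegrable _ _)
      ((hpow _ hτc).intervalIntegrable _ _) hτU).trans ?_
    rw [intervalIntegral.integral_of_le zero_le_one]
    refine setIntegral_mono_set (hpow _ hτc).continuousOn.integrableOn_Icc
      (Eventually.of_forall fun x => by positivity) ?_
    have : Ioc (0 : ℝ) 1 ⊆ Icc (-1) 1 := fun x hx => ⟨by linarith [hx.1], hx.2⟩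
    exact this.eventuallyLE
  simp only [abs_mul, Real.mul_rpow (abs_nonneg _) (abs_nonneg _)]
  rw [integral_const_mul, mul_left_comm, hν, hE]
  exact mul_le_mul_of_nonneg_left hm (by positivity)

/-- An `n`-dimensional system of disjointly supported functions, supported in an interval of
length `2 n`, on whose span twofold integration is bounded below by `Λ`. -/
theorem exists_config (hw : IsWave q Λ H) (hq : 1 < q) {n : ℕ} (hn : 1 ≤ n) :
    ∃ (A : ℝ) (h : Fin n → ℝ → ℝ), (∀ i t, 0 ≤ h i t) ∧ (∀ i, Measurable (h i)) ∧
      (∀ i, Integrable (h i)) ∧ (∃ M, ∀ i t, h i t ≤ M) ∧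
      (∀ i t, t ∉ Ioc A (A + 2 * n) → h i t = 0) ∧
      (∀ i j, i ≠ j → ∀ t, h i t = 0 ∨ h j t = 0) ∧ (∀ i, 0 < ∫ t, h i t ^ q) ∧
      ∀ c : Fin n → ℝ, Λ ^ q * ∑ i, |c i| ^ q * ∫ t, h i t ^ q ≤
        ∫ x in Icc A (A + 2 * n), |∑ i, c i * twoInt A (h i) x| ^ q := by
  obtain ⟨N, rfl⟩ := Nat.exists_eq_add_of_le' hn
  suffices ∃ σ ∈ Ioc (0 : ℝ) 1, ∀ c : Fin (N + 1) → ℝ,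
      Λ ^ q * ∑ i : Fin (N + 1), |c i| ^ q * ∫ t, piece H σ i t ^ q ≤
        ∫ x in Icc (-σ) (-σ + 2 * (N + 1 : ℕ)),
          |∑ i : Fin (N + 1), c i * twoInt (-σ) (piece H σ i) x| ^ q by
    obtain ⟨σ, hσ, hb⟩ := this
    have hsupp : ∀ (i : Fin (N + 1)) t, t ∉ Ioc (-σ) (-σ + 2 * (N + 1 : ℕ)) →
        piece H σ i t = 0 := fun i t ht => by
      by_contra hc
      have h1 := mem_of_piece_ne_zero hc
      have hi : ((i : ℕ) : ℝ) ≤ N := by exact_mod_cast Nat.lt_succ_iff.1 i.2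
      have h0 : -σ ≤ pieceLeft σ i := by
        rcases i with ⟨_ | i, hi'⟩
        · exact le_rfl
        · exact le_trans (by linarith [hσ.1]) (le_max_left _ _)
      refine ht ⟨h0.trans_lt h1.1, h1.2.trans ?_⟩
      push_cast
      linarith [hσ.2]
    obtain ⟨M, hM⟩ := (isCompact_Icc (a := -σ)
      (b := -σ + 2 * (N + 1 : ℕ))).exists_bound_of_continuousOn hw.continuous.continuousOn
    refine ⟨-σ, fun i => piece H σ i, fun i => piece_nonneg H σ i, fun i => hw.measurable_piece σ i,
      fun i => hw.integrable_piece σ i, ⟨max M 0, fun i t => ?_⟩, hsupp, fun i j hij t => ?_,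
      fun i => hw.integral_piece_rpow_pos hq ⟨hσ.1, by linarith [hσ.2]⟩ i, hb⟩
    · by_cases ht : t ∈ Ioc (-σ) (-σ + 2 * (N + 1 : ℕ))
      · refine le_trans ?_ (le_max_left _ _)
        refine (indicator_le_self' (fun _ _ => abs_nonneg _) t).trans ?_
        exact hM t (Ioc_subset_Icc_self ht)
      · exact (hsupp i t ht).trans_le (le_max_right _ _)
    · by_contra! hc
      rcases lt_or_gt_of_ne hij with h | h
      · exact (piece_lt_piece h hc.1 hc.2).false
      · exact (piece_lt_piece h hc.2 hc.1).false
  rcases N with _ | N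
  · refine ⟨1, ⟨zero_lt_one, le_rfl⟩, fun c => ?_⟩
    have := hw.config_bound_one hq (c 0)
    norm_num
    simpa [Fin.sum_univ_succ] using this
  · obtain ⟨σ, hσ, ρ, hρ, hb⟩ := hw.config_bound hq (N := N + 1) (by omega)
    refine ⟨σ, ⟨hσ.1, hσ.2.le⟩, fun c => (hb c).trans ?_⟩
    refine setIntegral_mono_set ?_ (Eventually.of_forall fun x => by positivity)
      (Icc_subset_Icc le_rfl ?_).eventuallyLE
    · have : Continuous fun x => |∑ i : Fin (N + 1 + 1), c i * twoInt (-σ) (piece H σ i) x| := by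
        have := fun i : Fin (N + 1 + 1) =>
          continuous_twoInt (A := -σ) (hw.integrable_piece σ i)
        fun_prop
      exact (this.rpow_const fun _ => Or.inr (by linarith)).continuousOn.integrableOn_Icc
    -- Both end parameters are at most one, so the configuration has length at most `2n`; this
    -- yields the constant `|I|/n`.
    · push_cast
      linarith [hσ.2, hρ.2]

end IsWave

end

noncomputable section

/-! ### Averaging over rotations -/

/-- Up to a factor, `‖z‖ ^ q` is the average of the `q`-th powers of the real functionals
`z ↦ cos θ re z + sin θ im z`. -/
theorem integral_abs_cos_re_add_sin_im {𝕜 : Type} [RCLike 𝕜] {q : ℝ} (z : 𝕜) :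
    ∫ θ in (0 : ℝ)..2 * Real.pi, |Real.cos θ * RCLike.re z + Real.sin θ * RCLike.im z| ^ q =
      (∫ θ in (0 : ℝ)..2 * Real.pi, |Real.cos θ| ^ q) * ‖z‖ ^ q := by
  set w : ℂ := ⟨RCLike.re z, RCLike.im z⟩ with hw
  have hn : ‖w‖ = ‖z‖ := by
    have h1 : ‖w‖ ^ 2 = ‖z‖ ^ 2 := by
      rw [Complex.sq_norm, Complex.normSq_mk, ← RCLike.normSq_eq_def', RCLike.normSq_apply]
    exact (pow_left_inj₀ (norm_nonneg _) (norm_nonneg _) two_ne_zero).1 h1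
  have h1 : ∀ θ : ℝ, |Real.cos θ * RCLike.re z + Real.sin θ * RCLike.im z| ^ q =
      |Real.cos (θ - w.arg)| ^ q * ‖z‖ ^ q := by
    intro θ
    have hre : RCLike.re z = ‖w‖ * Real.cos w.arg := (Complex.norm_mul_cos_arg w).symm
    have him : RCLike.im z = ‖w‖ * Real.sin w.arg := (Complex.norm_mul_sin_arg w).symm
    rw [← Real.mul_rpow (abs_nonneg _) (norm_nonneg _), ← hn, hre, him, Real.cos_sub,
      ← abs_of_nonneg (norm_nonneg w), ← abs_mul, abs_norm]
    congr 2; ring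
  simp only [h1]
  rw [intervalIntegral.integral_mul_const,
    intervalIntegral.integral_comp_sub_right (fun θ => |Real.cos θ| ^ q)]
  congr 1
  have hper : Function.Periodic (fun θ => |Real.cos θ| ^ q) (2 * Real.pi) := fun θ => by
    simp only [Real.cos_add_two_pi]
  have := hper.intervalIntegral_add_eq (0 - w.arg) 0
  rw [zero_add, show 0 - w.arg + 2 * Real.pi = 2 * Real.pi - w.arg by ring] at this
  exact this

/-- A lower bound for real linear combinations extends to scalar linear combinations. -/
theorem integral_norm_sum_rpow_ge {𝕜 : Type} [RCLike 𝕜] {n : ℕ} {q L a b : ℝ} (hq : 1 < q)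
    (hab : a ≤ b) {τ : Fin n → ℝ → ℝ} (hτ : ∀ i, Continuous (τ i)) {ν : Fin n → ℝ}
    (hreal : ∀ c : Fin n → ℝ, L * ∑ i, |c i| ^ q * ν i ≤ ∫ x in a..b, |∑ i, c i * τ i x| ^ q)
    (c : Fin n → 𝕜) :
    L * ∑ i, ‖c i‖ ^ q * ν i ≤ ∫ x in a..b, ‖∑ i, τ i x • c i‖ ^ q := by
  have hq0 : 0 ≤ q := by linarith
  have hpi : (0 : ℝ) < 2 * Real.pi := by positivity
  set φ : ℝ → 𝕜 → ℝ := fun θ z => Real.cos θ * RCLike.re z + Real.sin θ * RCLike.im z with hφ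
  set K : ℝ := ∫ θ in (0 : ℝ)..2 * Real.pi, |Real.cos θ| ^ q with hK
  have hKpos : 0 < K := by
    refine intervalIntegral.integral_pos hpi ?_ (fun x _ => by positivity)
      ⟨0, ⟨le_rfl, hpi.le⟩, by simp⟩
    exact (Real.continuous_cos.abs.rpow_const fun _ => Or.inr hq0).continuousOn
  have hφc : ∀ z : 𝕜, Continuous fun θ => |φ θ z| ^ q := fun z =>
    (by fun_prop : Continuous fun θ => |φ θ z|).rpow_const fun _ => Or.inr hq0
  have hg : Continuous fun x => ∑ i, τ i x • c i :=
    continuous_finsetSum _ fun i _ => (hτ i).smul continuous_const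
  have hφg : Continuous fun z : ℝ × ℝ => |φ z.1 (∑ i, τ i z.2 • c i)| ^ q := by
    refine Continuous.rpow_const (Continuous.abs ?_) fun _ => Or.inr hq0
    have h1 := hg.comp (continuous_snd (X := ℝ) (Y := ℝ))
    exact ((Real.continuous_cos.comp continuous_fst).mul (RCLike.continuous_re.comp h1)).add
      ((Real.continuous_sin.comp continuous_fst).mul (RCLike.continuous_im.comp h1))
  -- Each rotated real part of the sum is a real combination with coefficients `φ θ (c i)`.
  -- Averaging over `θ` restores norms on both sides with the same factor `K`.
  have h1 : ∀ θ, L * ∑ i, |φ θ (c i)| ^ q * ν i ≤ ∫ x in a..b, |φ θ (∑ i, τ i x • c i)| ^ q := by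
    intro θ
    have h2 : ∀ x, φ θ (∑ i, τ i x • c i) = ∑ i, φ θ (c i) * τ i x := by
      intro x
      simp only [hφ, map_sum, RCLike.smul_re, RCLike.smul_im, Finset.mul_sum,
        ← Finset.sum_add_distrib]
      exact Finset.sum_congr rfl fun i _ => by ring
    simp only [h2]
    exact hreal _
  have hswap : ∫ θ in (0 : ℝ)..2 * Real.pi, ∫ x in a..b, |φ θ (∑ i, τ i x • c i)| ^ q =
      ∫ x in a..b, ∫ θ in (0 : ℝ)..2 * Real.pi, |φ θ (∑ i, τ i x • c i)| ^ q := by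
    simp only [intervalIntegral.integral_of_le hpi.le, intervalIntegral.integral_of_le hab]
    refine integral_integral_swap ?_
    rw [Measure.prod_restrict]
    exact (hφg.continuousOn.integrableOn_compact (isCompact_Icc.prod isCompact_Icc)).mono_set
      (prod_mono Ioc_subset_Icc_self Ioc_subset_Icc_self)
  have hm : ∫ θ in (0 : ℝ)..2 * Real.pi, L * ∑ i, |φ θ (c i)| ^ q * ν i ≤
      ∫ θ in (0 : ℝ)..2 * Real.pi, ∫ x in a..b, |φ θ (∑ i, τ i x • c i)| ^ q := by
    refine intervalIntegral.integral_mono_on hpi.le ?_ ?_ fun θ _ => h1 θ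
    · exact (continuous_const.mul (continuous_finsetSum _ fun i _ =>
        (hφc (c i)).mul continuous_const)).intervalIntegrable _ _
    · exact (intervalIntegral.continuous_parametric_intervalIntegral_of_continuous'
        hφg a b).intervalIntegrable _ _
  rw [hswap, intervalIntegral.integral_const_mul, intervalIntegral.integral_finsetSum fun i _ =>
    ((hφc (c i)).intervalIntegrable _ _).mul_const _] at hm
  simp only [intervalIntegral.integral_mul_const, hφ, integral_abs_cos_re_add_sin_im] at hm
  rw [intervalIntegral.integral_const_mul, ← hK] at hm
  refine le_of_mul_le_mul_left (le_trans (le_of_eq ?_) hm) hKpos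
  rw [Finset.mul_sum, Finset.mul_sum, Finset.mul_sum]
  exact Finset.sum_congr rfl fun i _ => by ring

/-! ### Scaling -/

theorem twoInt_comp_div_add {A a ℓ : ℝ} (hℓ : ℓ ≠ 0) (h : ℝ → ℝ) (x : ℝ) :
    twoInt a (fun t => h (t / ℓ + (A - a / ℓ))) x = ℓ ^ 2 * twoInt A h (x / ℓ + (A - a / ℓ)) := by
  simp only [twoInt]
  have h1 : ∀ y, ∫ t in a..y, h (t / ℓ + (A - a / ℓ)) =
      ℓ * ∫ t in A..y / ℓ + (A - a / ℓ), h t := by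
    intro y
    rw [intervalIntegral.integral_comp_div_add h hℓ, smul_eq_mul, add_sub_cancel]
  simp only [h1]
  rw [intervalIntegral.integral_const_mul,
    intervalIntegral.integral_comp_div_add (fun y => ∫ t in A..y, h t) hℓ, smul_eq_mul,
    add_sub_cancel]
  ring

/-- The configuration of `IsWave.exists_config` on an arbitrary interval. -/
theorem IsWave.exists_config_scaled {q Λ : ℝ} {H : ℝ → ℝ} (hw : IsWave q Λ H) (hq : 1 < q)
    (hΛ : 0 ≤ Λ) {n : ℕ} (hn : 1 ≤ n) {a b : ℝ} (hab : a < b) :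
    ∃ f : Fin n → ℝ → ℝ, (∀ i t, 0 ≤ f i t) ∧ (∀ i, Measurable (f i)) ∧
      (∀ i, Integrable (f i)) ∧ (∃ M, ∀ i t, f i t ≤ M) ∧
      (∀ i j, i ≠ j → ∀ t, f i t = 0 ∨ f j t = 0) ∧ (∀ i, 0 < ∫ t in a..b, f i t ^ q) ∧
      ∀ c : Fin n → ℝ, (((b - a) / (2 * n)) ^ 2 * Λ) ^ q *
          ∑ i, |c i| ^ q * ∫ t in a..b, f i t ^ q ≤
        ∫ x in a..b, |∑ i, c i * twoInt a (f i) x| ^ q := by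
  obtain ⟨A, h, hh, hm, hi, ⟨M, hM⟩, hs, hd, hν, hb⟩ := hw.exists_config hq hn
  have hn' : (0 : ℝ) < n := by exact_mod_cast hn
  -- The dilation taking length `2n` to `b - a`; twofold integration contributes `ℓ²`.
  set ℓ : ℝ := (b - a) / (2 * n) with hℓ
  have hℓ0 : 0 < ℓ := div_pos (sub_pos.2 hab) (by positivity)
  have hbe : b / ℓ + (A - a / ℓ) = A + 2 * n := by
    have : (b - a) / ℓ = 2 * n := by
      rw [hℓ]; field_simp [(sub_pos.2 hab).ne']
    rw [← this]; ring
  have hcv : ∀ F : ℝ → ℝ, ∫ t in a..b, F (t / ℓ + (A - a / ℓ)) =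
      ℓ * ∫ t in A..A + 2 * n, F t := by
    intro F
    rw [intervalIntegral.integral_comp_div_add F hℓ0.ne', smul_eq_mul, add_sub_cancel, hbe]
  have hAC : A ≤ A + 2 * n := by linarith
  have hνi : ∀ i, ∫ t, h i t ^ q = ∫ t in A..A + 2 * n, h i t ^ q := by
    intro i
    rw [intervalIntegral.integral_of_le hAC]
    refine (setIntegral_eq_integral_of_forall_compl_eq_zero fun t ht => ?_).symm
    rw [hs i t ht, Real.zero_rpow (by linarith)]
  have hνs : ∀ i, ∫ t in a..b, h i (t / ℓ + (A - a / ℓ)) ^ q = ℓ * ∫ t, h i t ^ q := by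
    intro i
    rw [hνi, hcv fun t => h i t ^ q]
  refine ⟨fun i t => h i (t / ℓ + (A - a / ℓ)), fun i t => hh i _, fun i =>
    (hm i).comp (by fun_prop), fun i => ?_, ⟨M, fun i t => hM i _⟩, fun i j hij t => hd i j hij _,
    fun i => ?_, fun c => ?_⟩
  · exact ((hi i).comp_add_right (A - a / ℓ)).comp_div hℓ0.ne'
  · rw [hνs]; exact mul_pos hℓ0 (hν i)
  · simp only [hνs, twoInt_comp_div_add hℓ0.ne']
    have h1 : ∀ x, |∑ i, c i * (ℓ ^ 2 * twoInt A (h i) (x / ℓ + (A - a / ℓ)))| ^ q =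
        (ℓ ^ 2) ^ q * |∑ i, c i * twoInt A (h i) (x / ℓ + (A - a / ℓ))| ^ q := by
      intro x
      rw [← abs_of_pos (pow_pos hℓ0 2), ← Real.mul_rpow (abs_nonneg _) (abs_nonneg _), ← abs_mul,
        Finset.mul_sum, abs_of_pos (pow_pos hℓ0 2)]
      congr 2
      exact Finset.sum_congr rfl fun i _ => by ring
    simp only [h1]
    rw [intervalIntegral.integral_const_mul, hcv fun x => |∑ i, c i * twoInt A (h i) x| ^ q,
      Real.mul_rpow (by positivity) hΛ]
    have h2 := hb c
    rw [integral_Icc_eq_integral_Ioc, ← intervalIntegral.integral_of_le hAC] at h2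
    have h3 : ∑ i, |c i| ^ q * (ℓ * ∫ t, h i t ^ q) = ℓ * ∑ i, |c i| ^ q * ∫ t, h i t ^ q := by
      rw [Finset.mul_sum]
      exact Finset.sum_congr rfl fun i _ => by ring
    rw [h3]
    have h4 : 0 ≤ (ℓ ^ 2) ^ q * ℓ := by positivity
    calc _ = (ℓ ^ 2) ^ q * ℓ * (Λ ^ q * ∑ i, |c i| ^ q * ∫ t, h i t ^ q) := by ring
      _ ≤ _ := mul_le_mul_of_nonneg_left h2 h4
      _ = _ := by ring

end

/-! ### A subspace on which `T₂` is bounded below -/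

noncomputable section

theorem Lp_norm_rpow {𝕜 : Type} [RCLike 𝕜] {p : ℝ≥0∞} [Fact (1 ≤ p)] (hp : p ≠ ⊤)
    {μ : Measure ℝ} (f : Lp 𝕜 p μ) : ‖f‖ ^ p.toReal = ∫ x, ‖f x‖ ^ p.toReal ∂μ := by
  have hp0 : p ≠ 0 := (zero_lt_one.trans_le (Fact.out : (1 : ℝ≥0∞) ≤ p)).ne'
  have h0 : 0 ≤ ∫ x, ‖f x‖ ^ p.toReal ∂μ := integral_nonneg fun x => by positivity
  rw [Lp.norm_def, (Lp.memLp f).eLpNorm_eq_integral_rpow_norm hp0 hp,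
    ENNReal.toReal_ofReal (by positivity),
    Real.rpow_inv_rpow h0 (ENNReal.toReal_pos hp0 hp).ne']

/-- There is an `n`-dimensional subspace on which `T₂` is bounded below by
`(|I| / n) ^ 2 * 𝓑(0, 1)`. -/
theorem exists_bounded_below (𝕜 : Type) [RCLike 𝕜] {p : ℝ≥0∞} [Fact (1 ≤ p)] (hp1 : 1 < p)
    (hp : p ≠ ⊤) {a b : ℝ} (hab : a < b) {n : ℕ} (hn : 1 ≤ n) :
    ∃ Φ : (Fin n → 𝕜) →ₗ[𝕜] Lp 𝕜 p (volume.restrict (Ioo a b)), Function.Injective Φ ∧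
      ∀ c, ((b - a) / n) ^ 2 * (interpConst 𝕜 p 0 1).toReal * ‖Φ c‖ ≤
        ‖volterraTwo 𝕜 p a b (Φ c)‖ := by
  have hq : 1 < p.toReal := by
    rw [← ENNReal.toReal_one]; exact (ENNReal.toReal_lt_toReal (by simp) hp).2 hp1
  obtain ⟨H, hw⟩ := exists_isWave 𝕜 hp1 hp
  set q := p.toReal with hqdef
  have hq0 : 0 < q := by linarith
  obtain ⟨f, hf0, hfm, hfi, ⟨M, hM⟩, hfd, hfν, hb⟩ :=
    hw.exists_config_scaled hq (by positivity) hn hab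
  have hn' : (0 : ℝ) < n := by exact_mod_cast hn
  -- The `4` in `Λ = 4B` cancels the `2²` from the length `2n`.
  have hscale : ((b - a) / (2 * n)) ^ 2 * (4 * (interpConst 𝕜 p 0 1).toReal) =
      ((b - a) / n) ^ 2 * (interpConst 𝕜 p 0 1).toReal := by field_simp; ring
  rw [hscale] at hb
  set lam := ((b - a) / n) ^ 2 * (interpConst 𝕜 p 0 1).toReal with hlam
  have hlam0 : 0 ≤ lam := by positivity
  set G : (Fin n → 𝕜) → ℝ → 𝕜 := fun c t => ∑ i, f i t • c i with hG
  have hGm : ∀ c, MemLp (G c) p (volume.restrict (Ioo a b)) := by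
    intro c
    refine memLp_finsetSum _ fun i _ => ?_
    refine MemLp.of_bound ((hfm i).aestronglyMeasurable.smul aestronglyMeasurable_const)
      (M * ‖c i‖) (Eventually.of_forall fun t => ?_)
    rw [norm_smul, Real.norm_of_nonneg (hf0 i t)]
    exact mul_le_mul_of_nonneg_right (hM i t) (norm_nonneg _)
  set Φ : (Fin n → 𝕜) →ₗ[𝕜] Lp 𝕜 p (volume.restrict (Ioo a b)) :=
    { toFun := fun c => (hGm c).toLp (G c)
      map_add' := fun c d => by
        rw [← MemLp.toLp_add]
        congr 1
        ext t
        simp [hG, smul_add, Finset.sum_add_distrib]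
      map_smul' := fun r c => by
        rw [RingHom.id_apply, ← MemLp.toLp_const_smul]
        congr 1
        ext t
        simp [hG, Finset.mul_sum, mul_left_comm, Algebra.smul_def] } with hΦ
  have hΦc : ∀ c, Φ c =ᵐ[volume.restrict (Ioo a b)] G c := fun c => (hGm c).coeFn_toLp
  have hIoo : ∀ F : ℝ → ℝ, ∫ x in Ioo a b, F x = ∫ x in a..b, F x := fun F => by
    rw [intervalIntegral.integral_of_le hab.le, integral_Ioc_eq_integral_Ioo]
  -- At each point at most one `f i` is nonzero, by disjointness of the supports.
  have hpt : ∀ c t, ‖G c t‖ ^ q = ∑ i, ‖c i‖ ^ q * f i t ^ q := by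
    intro c t
    by_cases h : ∃ i, f i t ≠ 0
    · obtain ⟨i, hi⟩ := h
      have h0 : ∀ j, j ≠ i → f j t = 0 := fun j hj => (hfd j i hj t).resolve_right hi
      simp only [hG]
      rw [Finset.sum_eq_single i (fun j _ hj => by rw [h0 j hj, zero_smul]) (by simp),
        Finset.sum_eq_single i (fun j _ hj => by rw [h0 j hj, Real.zero_rpow hq0.ne', mul_zero])
          (by simp), norm_smul, Real.norm_of_nonneg (hf0 i t),
        Real.mul_rpow (hf0 i t) (norm_nonneg _), mul_comm]
    · push Not at h
      simp [hG, h, Real.zero_rpow hq0.ne']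
  have hpow : ∀ i, IntervalIntegrable (fun t => f i t ^ q) volume a b := by
    intro i
    rw [intervalIntegrable_iff_integrableOn_Ioc_of_le hab.le]
    refine Measure.integrableOn_of_bounded (M := M ^ q) (by simp)
      ((hfm i).pow_const q).aestronglyMeasurable (Eventually.of_forall fun t => ?_)
    rw [Real.norm_of_nonneg (Real.rpow_nonneg (hf0 i t) _)]
    exact Real.rpow_le_rpow (hf0 i t) (hM i t) hq0.le
  have hnorm : ∀ c, ‖Φ c‖ ^ q = ∑ i, ‖c i‖ ^ q * ∫ t in a..b, f i t ^ q := by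
    intro c
    rw [Lp_norm_rpow hp, integral_congr_ae (g := fun t => ∑ i, ‖c i‖ ^ q * f i t ^ q), hIoo,
      intervalIntegral.integral_finsetSum fun i _ => (hpow i).const_mul _]
    · simp only [intervalIntegral.integral_const_mul]
    · filter_upwards [hΦc c] with t ht
      rw [ht, hpt]
  have hvol : ∀ c, ∀ x ∈ Ioo a b, volterraFun a (Φ c) x = ∑ i, twoInt a (f i) x • c i := by
    intro c x hx
    have hi1 : ∀ i y z, IntervalIntegrable (fun t => f i t • c i) volume y z := fun i y z =>
      ((hfi i).smul_const (c i)).intervalIntegrable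
    have hGi : IntervalIntegrable (G c) volume a x := by
      have := IntervalIntegrable.sum Finset.univ fun i _ => hi1 i a x
      refine this.congr fun t _ => ?_
      rw [Finset.sum_apply]
    have hi2 : ∀ i, IntervalIntegrable (fun y => (∫ t in a..y, f i t) • c i) volume a x :=
      fun i => ((intervalIntegral.continuous_primitive
        (fun _ _ => (hfi i).intervalIntegrable) a).smul continuous_const).intervalIntegrable _ _
    rw [volterraFun_congr (hΦc c) hx, volterraFun_eq_primitive hx.1.le hGi]
    have h1 : ∀ y, ∫ t in a..y, G c t = ∑ i, (∫ t in a..y, f i t) • c i := by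
      intro y
      simp only [hG]
      rw [intervalIntegral.integral_finsetSum fun i _ => hi1 i a y]
      simp only [intervalIntegral.integral_smul_const]
    simp only [h1]
    rw [intervalIntegral.integral_finsetSum fun i _ => hi2 i]
    simp only [intervalIntegral.integral_smul_const, twoInt]
  refine ⟨Φ, ?_, fun c => ?_⟩
  · rw [injective_iff_map_eq_zero]
    intro c hc
    by_contra hne
    obtain ⟨i, hi⟩ := Function.ne_iff.1 hne
    have h1 := hnorm c
    rw [hc, norm_zero, Real.zero_rpow hq0.ne'] at h1
    have h2 := (Finset.sum_eq_zero_iff_of_nonneg fun i _ => by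
      have := hfν i; positivity).1 h1.symm i (Finset.mem_univ i)
    exact (mul_pos (Real.rpow_pos_of_pos (norm_pos_iff.2 hi) q) (hfν i)).ne' h2
  · refine (Real.rpow_le_rpow_iff (by positivity) (norm_nonneg _) hq0).1 ?_
    rw [Real.mul_rpow hlam0 (norm_nonneg _), hnorm, Lp_norm_rpow hp,
      integral_congr_ae (g := fun x => ‖∑ i, twoInt a (f i) x • c i‖ ^ q), hIoo]
    · exact integral_norm_sum_rpow_ge hq hab.le (fun i => continuous_twoInt (hfi i)) hb c
    · filter_upwards [volterraTwo_coeFn (Φ c), ae_restrict_mem measurableSet_Ioo] with x hx hxm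
      rw [hx]
      change ‖volterraFun a (Φ c) x‖ ^ q = _
      rw [hvol c x hxm]

/-! ### Lower bounds for approximation numbers and injective strict `s`-numbers -/

/-- An operator of rank below `n` annihilates a nonzero vector of the `n`-dimensional range of `Φ`,
where `T - F` acts as `T`. -/
theorem le_approxNumber {𝕜 : Type} [RCLike 𝕜] {X Y : Type} [NormedAddCommGroup X]
    [NormedSpace 𝕜 X] [NormedAddCommGroup Y] [NormedSpace 𝕜 Y] (T : X →L[𝕜] Y) {n : ℕ}
    (hn : 1 ≤ n) {lam : ℝ} {Φ : (Fin n → 𝕜) →ₗ[𝕜] X} (hΦ : Function.Injective Φ)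
    (h : ∀ c, lam * ‖Φ c‖ ≤ ‖T (Φ c)‖) : lam ≤ approxNumber T n := by
  refine le_csInf ⟨_, 0, ?_, rfl⟩ ?_
  · rw [ContinuousLinearMap.toLinearMap_zero, LinearMap.rank_zero]
    exact_mod_cast hn
  · rintro _ ⟨F, hF, rfl⟩
    have hni : ¬ Function.Injective ((F : X →ₗ[𝕜] Y).comp Φ) := fun hinj => by
      have h1 := LinearMap.rank_comp_le_left Φ (F : X →ₗ[𝕜] Y)
      rw [LinearMap.rank, rank_range_of_injective _ hinj, rank_fin_fun] at h1
      exact (h1.trans_lt hF).false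
    rw [injective_iff_map_eq_zero] at hni
    push Not at hni
    obtain ⟨c, hc, hc0⟩ := hni
    have hFc : F (Φ c) = 0 := hc
    have hpos : 0 < ‖Φ c‖ := norm_pos_iff.2 fun h0 => hc0 (hΦ (by rw [h0, map_zero]))
    refine le_of_mul_le_mul_right ((h c).trans ?_) hpos
    have := (T - F).le_opNorm (Φ c)
    rwa [_root_.sub_apply, hFc, sub_zero] at this

/-- The identity of `M = range Φ` factors through `T : M → T(M)` and an inverse of norm at most
`lam⁻¹`. Injectivity of `s` allows the target to be shrunk to `T(M)`, so no projection of `Y` onto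
it is needed. -/
theorem IsStrictSNumber.le_of_injective {𝕜 : Type} [RCLike 𝕜] {s : OperatorSequence 𝕜}
    (hs : IsStrictSNumber s) (hinj : IsInjectiveSNumber s) {X Y : Type} [NormedAddCommGroup X]
    [NormedSpace 𝕜 X] [CompleteSpace X] [NormedAddCommGroup Y] [NormedSpace 𝕜 Y] [CompleteSpace Y]
    (T : X →L[𝕜] Y) {n : ℕ} (hn : 1 ≤ n) {lam : ℝ} (hlam : 0 < lam)
    {Φ : (Fin n → 𝕜) →ₗ[𝕜] X} (hΦ : Function.Injective Φ)
    (h : ∀ c, lam * ‖Φ c‖ ≤ ‖T (Φ c)‖) : lam ≤ s T n := by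
  set M := LinearMap.range Φ with hM
  have hbel : ∀ x : M, lam * ‖x‖ ≤ ‖T x‖ := by
    rintro ⟨_, c, rfl⟩
    exact h c
  have : FiniteDimensional 𝕜 M := inferInstance
  have : CompleteSpace M := FiniteDimensional.complete 𝕜 M
  set TM : M →L[𝕜] Y := T.comp M.subtypeL with hTM
  have hTMi : Function.Injective (TM : M →ₗ[𝕜] Y) := by
    rw [injective_iff_map_eq_zero]
    intro x hx
    have h1 := hbel x
    have h2 : T x = 0 := hx
    rw [h2, norm_zero] at h1
    have h3 : ‖x‖ ≤ 0 := by
      by_contra! hc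
      exact absurd (mul_pos hlam hc) (not_lt.2 h1)
    exact norm_le_zero_iff.1 h3
  set N := LinearMap.range (TM : M →ₗ[𝕜] Y) with hN
  have : FiniteDimensional 𝕜 N := inferInstance
  have : CompleteSpace N := FiniteDimensional.complete 𝕜 N
  set T₀ : M →L[𝕜] N := TM.codRestrict N fun x => ⟨x, rfl⟩ with hT₀
  set e := LinearEquiv.ofInjective (TM : M →ₗ[𝕜] Y) hTMi with he
  set R : N →L[𝕜] M := LinearMap.mkContinuous (e.symm : N →ₗ[𝕜] M) lam⁻¹ (fun y => by
    obtain ⟨x, rfl⟩ := e.surjective y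
    rw [LinearEquiv.coe_coe, e.symm_apply_apply, inv_mul_eq_div, le_div_iff₀ hlam, mul_comm]
    exact hbel x) with hR
  have hRn : ‖R‖ ≤ lam⁻¹ := LinearMap.mkContinuous_norm_le _ (inv_nonneg.2 hlam.le) _
  have hRT : (R.comp T₀).comp (ContinuousLinearMap.id 𝕜 M) = ContinuousLinearMap.id 𝕜 M := by
    ext x
    have : R (T₀ x) = x := e.symm_apply_apply x
    simp [this]
  have hrank : (n : Cardinal) ≤ Module.rank 𝕜 M := by
    rw [hM, rank_range_of_injective Φ hΦ, rank_fin_fun]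
  have h1 : 1 ≤ lam⁻¹ * s T₀ n := by
    have h2 := hs.comp_le R T₀ (ContinuousLinearMap.id 𝕜 M) n hn
    rw [hRT, hs.id_eq_one n hn hrank] at h2
    have h3 := hs.nonneg T₀ n hn
    calc (1 : ℝ) ≤ ‖R‖ * s T₀ n * ‖ContinuousLinearMap.id 𝕜 M‖ := h2
      _ ≤ ‖R‖ * s T₀ n * 1 := by
        gcongr
        exact ContinuousLinearMap.norm_id_le
      _ = ‖R‖ * s T₀ n := mul_one _
      _ ≤ _ := mul_le_mul_of_nonneg_right hRn h3
  have h4 : s T₀ n ≤ s T n := by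
    rw [← hinj N.subtypeₗᵢ T₀ n hn]
    have h5 : N.subtypeₗᵢ.toContinuousLinearMap.comp T₀ =
        ((ContinuousLinearMap.id 𝕜 Y).comp T).comp M.subtypeL := by
      ext x; rfl
    rw [h5]
    have h3 := hs.nonneg T n hn
    refine (hs.comp_le _ _ _ n hn).trans ?_
    calc _ ≤ 1 * s T n * 1 := by
          gcongr
          · exact ContinuousLinearMap.norm_id_le
          · exact Submodule.norm_subtypeL_le M
      _ = s T n := by ring
  refine le_trans ?_ h4
  have := mul_le_mul_of_nonneg_left h1 hlam.le
  rwa [mul_one, mul_inv_cancel_left₀ hlam.ne'] at this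

/-- For `F` of rank below `n`, additivity gives `s_n(T) ≤ s_n(F) + ‖T - F‖ = ‖T - F‖`. -/
theorem IsStrictSNumber.le_approxNumber {𝕜 : Type} [RCLike 𝕜] {s : OperatorSequence 𝕜}
    (hs : IsStrictSNumber s) {X Y : Type} [NormedAddCommGroup X]
    [NormedSpace 𝕜 X] [CompleteSpace X] [NormedAddCommGroup Y] [NormedSpace 𝕜 Y] [CompleteSpace Y]
    (T : X →L[𝕜] Y) {n : ℕ} (hn : 1 ≤ n) : s T n ≤ approxNumber T n := by
  refine le_csInf ⟨_, 0, ?_, rfl⟩ ?_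
  · rw [ContinuousLinearMap.toLinearMap_zero, LinearMap.rank_zero]
    exact_mod_cast hn
  · rintro _ ⟨F, hF, rfl⟩
    have := hs.add_le F (T - F) n hn
    rwa [add_sub_cancel, hs.eq_zero_of_rank_lt F n hn hF, zero_add] at this

theorem tendsto_sq_mul_of_two_sided {d B : ℝ} {x : ℕ → ℝ}
    (h : ∀ n : ℕ, 1 ≤ n → (d / n) ^ 2 * B ≤ x n ∧ x n ≤ (d / ((n : ℝ) - 3 / 2)) ^ 2 * B) :
    Tendsto (fun n : ℕ => (n : ℝ) ^ 2 * x n) atTop (𝓝 (d ^ 2 * B)) := by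
  have h1 : Tendsto (fun n : ℕ => ((n : ℝ) / (n + (-(3 / 2)))) ^ 2 * (d ^ 2 * B)) atTop
      (𝓝 (d ^ 2 * B)) := by
    have := ((tendsto_natCast_div_add_atTop (-(3 / 2) : ℝ)).pow 2).mul_const (d ^ 2 * B)
    rwa [one_pow, one_mul] at this
  refine tendsto_of_tendsto_of_tendsto_of_le_of_le' tendsto_const_nhds h1 ?_ ?_
  · filter_upwards [eventually_ge_atTop 1] with n hn
    have hn' : (0 : ℝ) < n := by exact_mod_cast hn
    have := mul_le_mul_of_nonneg_left (h n hn).1 (sq_nonneg (n : ℝ))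
    refine le_trans (le_of_eq ?_) this
    field_simp
  · filter_upwards [eventually_ge_atTop 1] with n hn
    refine (mul_le_mul_of_nonneg_left (h n hn).2 (sq_nonneg (n : ℝ))).trans (le_of_eq ?_)
    rw [← sub_eq_add_neg]
    ring

end

theorem theorem4p2 {𝕜 : Type} [RCLike 𝕜] {p : ℝ≥0∞} [Fact (1 ≤ p)] (hp1 : 1 < p) (hp : p ≠ ⊤)
    {a b : ℝ} (hab : a < b) :
    interpConst 𝕜 p 0 1 ≠ ⊤ ∧
    (∀ n : ℕ, 1 ≤ n →
      ((b - a) / n) ^ 2 * (interpConst 𝕜 p 0 1).toReal ≤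
          approxNumber (volterraTwo 𝕜 p a b) n ∧
        approxNumber (volterraTwo 𝕜 p a b) n ≤
          ((b - a) / ((n : ℝ) - 3 / 2)) ^ 2 * (interpConst 𝕜 p 0 1).toReal) ∧
    Tendsto (fun n : ℕ => (n : ℝ) ^ 2 * approxNumber (volterraTwo 𝕜 p a b) n) atTop
      (𝓝 ((b - a) ^ 2 * (interpConst 𝕜 p 0 1).toReal)) ∧
    ∀ s : OperatorSequence 𝕜, IsStrictSNumber s → IsInjectiveSNumber s →
      (∀ n : ℕ, 1 ≤ n →
        ((b - a) / n) ^ 2 * (interpConst 𝕜 p 0 1).toReal ≤ s (volterraTwo 𝕜 p a b) n ∧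
          s (volterraTwo 𝕜 p a b) n ≤
            ((b - a) / ((n : ℝ) - 3 / 2)) ^ 2 * (interpConst 𝕜 p 0 1).toReal) ∧
      Tendsto (fun n : ℕ => (n : ℝ) ^ 2 * s (volterraTwo 𝕜 p a b) n) atTop
        (𝓝 ((b - a) ^ 2 * (interpConst 𝕜 p 0 1).toReal)) := by
  have hB : 0 < (interpConst 𝕜 p 0 1).toReal :=
    ENNReal.toReal_pos interpConst_pos interpConst_ne_top
  have hup := fun (n : ℕ) (hn : 1 ≤ n) => approxNumber_volterraTwo_le (𝕜 := 𝕜) (p := p) hp hab hn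
  have ha : ∀ n : ℕ, 1 ≤ n →
      ((b - a) / n) ^ 2 * (interpConst 𝕜 p 0 1).toReal ≤ approxNumber (volterraTwo 𝕜 p a b) n ∧
        approxNumber (volterraTwo 𝕜 p a b) n ≤
          ((b - a) / ((n : ℝ) - 3 / 2)) ^ 2 * (interpConst 𝕜 p 0 1).toReal := fun n hn => by
    obtain ⟨Φ, hΦ, h⟩ := exists_bounded_below 𝕜 hp1 hp hab hn
    exact ⟨le_approxNumber _ hn hΦ h, hup n hn⟩
  refine ⟨interpConst_ne_top, ha, tendsto_sq_mul_of_two_sided ha, fun s hs hinj => ?_⟩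
  have hsn : ∀ n : ℕ, 1 ≤ n →
      ((b - a) / n) ^ 2 * (interpConst 𝕜 p 0 1).toReal ≤ s (volterraTwo 𝕜 p a b) n ∧
        s (volterraTwo 𝕜 p a b) n ≤
          ((b - a) / ((n : ℝ) - 3 / 2)) ^ 2 * (interpConst 𝕜 p 0 1).toReal := fun n hn => by
    obtain ⟨Φ, hΦ, h⟩ := exists_bounded_below 𝕜 hp1 hp hab hn
    have hn' : (0 : ℝ) < n := by exact_mod_cast hn
    have hpos : 0 < ((b - a) / n) ^ 2 * (interpConst 𝕜 p 0 1).toReal :=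
      mul_pos (pow_pos (div_pos (sub_pos.2 hab) hn') 2) hB
    exact ⟨hs.le_of_injective hinj _ hn hpos hΦ h, (hs.le_approxNumber _ hn).trans (hup n hn)⟩
  exact ⟨hsn, tendsto_sq_mul_of_two_sided hsn⟩
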